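/- Let $\Sigma$ be a finite alphabet. A *lasso* of length $n$ over $\Sigma$ is a pair $(u,v)\in\Sigma^*\times\Sigma^+$ with $|u\cdot v|=n$. For a property $\varphi\subseteq\Sigma^\omega$ let $\#_\varphi(n)=|\{(u,v)\in\Sigma^*\times\Sigma^+ : |u\cdot v|=n,\ u\cdot v^\omega\in\varphi\}|$ be the number of its $n$-models, and let the density function $r_\varphi(n)$ be the ratio of $\#_\varphi(n)$ to the number of all lassos of length $n$ over $\Sigma$ (with $0/0=0$ in the degenerate cases $n=0$ or $\Sigma=\emptyset$). A parity automaton $(Q,Q_0,\delta,c)$ over $\Sigma$ has a finite state set $Q$, initial states $Q_0\subseteq Q$, transitions $\delta:Q\times\Sigma\to 2^Q$ and colors $c:Q\to\mathbb N$. A run is accepting if the maximal color seen infinitely often is even, and a word is accepted if it has an accepting run. The automaton is a (nondeterministic) Büchi automaton if all its colors are in $\{1,2\}$, and deterministic if $|Q_0|=1$ and $|\delta(q,a)|\le 1$ for all $q,a$. A function $f:I^*\to\mathbb N$ on the words over a finite alphabet $I$ is in #P if there is a nondeterministic polynomial-time Turing machine that has exactly $f(x)$ accepting runs on each input $x\in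 I^*$. **Theorem.** For an $\omega$-regular property $\varphi$ that is given by 1. an LTL formula over a finite set $AP$ of atomic propositions (with $\Sigma=2^{AP}$), or 2. a nondeterministic Büchi automaton over $\Sigma$, or 3. a deterministic parity automaton over $\Sigma$, and for a given bound $n$ in unary, the problem of computing $r_\varphi(n)$ is in #P, in the following sense. For each of the three representations there is a function $f$ in #P such that, for every representation of a property $\varphi$ of this kind and every $n\in\mathbb N$, on the word $x$ that encodes the representation together with $n$, $$f(x)=\#_\varphi(n)\qquad\text{and}\qquad r_\varphi(n)=\frac{f(x)}{n\cdot|\Sigma|^n}.$$ Here the representation is part of the input. A formula is built from true, atomic propositions, $\neg$, $\wedge$, Next and Until (the other operators are derived); it is written in postfix notation, with $|AP|$ and the indices of propositions in unary. An automaton is written with $n$, $|\Sigma|$ and $|Q|$ in unary, the initial states as a bit vector, the colors in binary, and the transition relation as a table with one bit for each element of $Q\times\Sigma\times Q$. -/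

import Mathlib

namespace LassoDensity

section Lassos

/-- A lasso `(u, v)` over `α`: a finite word `u` together with a nonempty finite word `v`. -/
structure Lasso (α : Type) where
  stem : List α
  loop : List α
  loop_ne : loop ≠ []

/-- The length `|u · v|` of a lasso `(u, v)`. -/
def Lasso.length {α : Type} (l : Lasso α) : ℕ :=
  l.stem.length + l.loop.length

/-- The ultimately periodic infinite word `u · v^ω` induced by a lasso `(u, v)`. -/
def Lasso.word {α : Type} (l : Lasso α) : ℕ → α := fun i =>
  if h : i < l.stem.length then l.stem[i]
  else l.loop[(i - l.stem.length) % l.loop.length]'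
    (Nat.mod_lt _ (List.length_pos_of_ne_nil l.loop_ne))

/-- The set of all lassos of length `n`. -/
def lassos (α : Type) (n : ℕ) : Set (Lasso α) :=
  {l | l.length = n}

/-- The `n`-models of a linear-time property `P ⊆ α^ω`. -/
def models {α : Type} (P : Set (ℕ → α)) (n : ℕ) : Set (Lasso α) :=
  {l | l.length = n ∧ l.word ∈ P}

/-- The cardinality `#_P(n)`: the number of `n`-models of `P` (used for finite alphabets only). -/
noncomputable def numModels {α : Type} (P : Set (ℕ → α)) (n : ℕ) : ℕ :=
  (models P n).ncard

/-- The density function `r_P(n)`: the ratio between the number of `n`-models of `P` and the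
number of all lassos of length `n`. -/
noncomputable def density {α : Type} (P : Set (ℕ → α)) (n : ℕ) : ℚ :=
  (numModels P n : ℚ) / ((lassos α n).ncard : ℚ)

end Lassos

section LTLFormulas

/-- Formulas of linear-time temporal logic over the atomic propositions `AP`. -/
inductive LTL (AP : Type) : Type where
  | tt : LTL AP
  | atom (p : AP) : LTL AP
  | neg (φ : LTL AP) : LTL AP
  | conj (φ ψ : LTL AP) : LTL AP
  | next (φ : LTL AP) : LTL AP
  | untl (φ ψ : LTL AP) : LTL AP

namespace LTL

variable {AP : Type}

/-- Derived operator: disjunction. -/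
def disj (φ ψ : LTL AP) : LTL AP := neg (conj (neg φ) (neg ψ))

/-- Derived operator: release, the dual of until. -/
def release (φ ψ : LTL AP) : LTL AP := neg (untl (neg φ) (neg ψ))

/-- Derived operator: eventually. -/
def eventually (φ : LTL AP) : LTL AP := untl tt φ

/-- Derived operator: globally. -/
def globally (φ : LTL AP) : LTL AP := neg (eventually (neg φ))

/-- `φ.Sat w i`: the suffix of the infinite word `w` that starts at position `i` satisfies `φ`. -/
def Sat (w : ℕ → Set AP) : ℕ → LTL AP → Prop
  | _, tt => True
  | i, atom p => p ∈ w i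
  | i, neg φ => ¬ Sat w i φ
  | i, conj φ ψ => Sat w i φ ∧ Sat w i ψ
  | i, next φ => Sat w (i + 1) φ
  | i, untl φ ψ => ∃ j, i ≤ j ∧ Sat w j ψ ∧ ∀ m, i ≤ m → m < j → Sat w m φ

/-- The property `L(φ)` over the alphabet `2^AP` that is defined by the formula `φ`. -/
def language (φ : LTL AP) : Set (ℕ → Set AP) :=
  {w | Sat w 0 φ}

end LTL

end LTLFormulas

section Automata

/-- Parity automata with state set `Q` over the alphabet `α`. -/
structure ParityAutomaton (α Q : Type) where
  init : Finset Q
  trans : Q → α → Finset Q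
  color : Q → ℕ

namespace ParityAutomaton

variable {α Q : Type}

/-- `r` is a run of the automaton on the infinite word `w`. -/
def IsRun (A : ParityAutomaton α Q) (w : ℕ → α) (r : ℕ → Q) : Prop :=
  r 0 ∈ A.init ∧ ∀ i, r (i + 1) ∈ A.trans (r i) (w i)

/-- The set of states that occur infinitely often in `r`. -/
def infStates (r : ℕ → Q) : Set Q :=
  {q | ∀ i, ∃ j, i < j ∧ r j = q}

/-- A run is accepting if the maximal color that occurs infinitely often is even. -/
def IsAccepting (A : ParityAutomaton α Q) (r : ℕ → Q) : Prop :=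
  ∃ c, IsGreatest (A.color '' infStates r) c ∧ Even c

/-- The property accepted by the automaton. -/
def language (A : ParityAutomaton α Q) : Set (ℕ → α) :=
  {w | ∃ r, A.IsRun w r ∧ A.IsAccepting r}

/-- Büchi automata are the parity automata with colors in `{1, 2}`. -/
def IsBuchi (A : ParityAutomaton α Q) : Prop :=
  ∀ q, A.color q = 1 ∨ A.color q = 2

/-- One initial state, and at most one successor for each state and letter. -/
def IsDeterministic (A : ParityAutomaton α Q) : Prop :=
  A.init.card = 1 ∧ ∀ q a, (A.trans q a).card ≤ 1

end ParityAutomaton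

end Automata

section CountingMachines

open Turing

/-- A nondeterministic Turing machine with input alphabet `I`. It is the nondeterministic version
of the multi-stack Turing machines of Mathlib (`Turing.TM2`, `Turing.FinTM2`): each label carries a
finite list of statements, one of which is chosen when the label is executed. All stacks have a
finite alphabet, and the input is initially on the stack `inputStack`. -/
structure NTM (I : Type) where
  /-- the stacks -/
  K : Type
  [decK : DecidableEq K]
  [finK : Finite K]
  /-- the stack alphabets -/
  Γ : K → Type
  [finΓ : ∀ k, Finite (Γ k)]
  /-- the labels -/
  Λ : Type
  [finΛ : Finite Λ]
  /-- the internal states -/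
  σ : Type
  [finσ : Finite σ]
  inputStack : K
  /-- how an input letter is written on the input stack -/
  inputLetter : I → Γ inputStack
  main : Λ
  initialState : σ
  /-- the statements among which the machine may choose at a label -/
  choices : Λ → List (TM2.Stmt Γ Λ σ)
  /-- the internal states in which a halting configuration is accepting -/
  accept : Set σ

attribute [instance] NTM.decK NTM.finK NTM.finΓ NTM.finΛ NTM.finσ

namespace NTM

variable {I : Type} (M : NTM I)

/-- Configurations: current label (`none` if the machine has halted), internal state, stacks. -/
abbrev Cfg : Type := TM2.Cfg M.Γ M.Λ M.σ

/-- The initial configuration on the input word `x`. -/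
def initCfg (x : List I) : M.Cfg where
  l := some M.main
  var := M.initialState
  stk := Function.update (fun _ => []) M.inputStack (x.map M.inputLetter)

/-- One computation step: a statement of the current label is chosen and executed. -/
def Step (c c' : M.Cfg) : Prop :=
  ∃ l, c.l = some l ∧ ∃ q ∈ M.choices l, c' = TM2.stepAux q c.var c.stk

/-- A (not necessarily maximal) run on the input `x`, as the list of its configurations. -/
def IsRun (x : List I) (ρ : List M.Cfg) : Prop :=
  ρ.head? = some (M.initCfg x) ∧ ρ.IsChain M.Step

/-- The accepting runs on the input `x`: the runs that end in an accepting halting configuration. -/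
def acceptingRuns (x : List I) : Set (List M.Cfg) :=
  {ρ | M.IsRun x ρ ∧ ∃ c, ρ.getLast? = some c ∧ c.l = none ∧ c.var ∈ M.accept}

/-- On every input `x`, each run has at most `p(|x|)` steps, for some fixed polynomial `p`. -/
def IsPolyTime : Prop :=
  ∃ p : Polynomial ℕ, ∀ x ρ, M.IsRun x ρ → ρ.length ≤ p.eval x.length + 1

end NTM

/-- The class #P of functions on words over the alphabet `I`: the functions that count the accepting
runs of a nondeterministic polynomial-time Turing machine. -/
def SharpP (I : Type) : Set (List I → ℕ) :=
  {f | ∃ M : NTM I, M.IsPolyTime ∧ ∀ x, (M.acceptingRuns x).encard = f x}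

end CountingMachines

section Encodings

/-- The symbols used to write a bound and an LTL formula. -/
inductive LTLSymbol : Type where
  | tick
  | sep
  | tt
  | atom
  | neg
  | conj
  | next
  | untl

/-- An LTL formula over `{0, …, k - 1}` in postfix notation, with proposition `i` written as
`i` ticks followed by the symbol `atom`. -/
def LTL.code {k : ℕ} : LTL (Fin k) → List LTLSymbol
  | .tt => [.tt]
  | .atom p => List.replicate p .tick ++ [.atom]
  | .neg φ => φ.code ++ [.neg]
  | .conj φ ψ => φ.code ++ ψ.code ++ [.conj]
  | .next φ => φ.code ++ [.next]
  | .untl φ ψ => φ.code ++ ψ.code ++ [.untl]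

/-- The instance consisting of a bound `n` and an LTL formula over `k` atomic propositions; both
numbers are written in unary. -/
def encodeLTL {k : ℕ} (φ : LTL (Fin k)) (n : ℕ) : List LTLSymbol :=
  List.replicate n .tick ++ [.sep] ++ List.replicate k .tick ++ [.sep] ++ φ.code

/-- The symbols used to write a bound and an automaton. -/
inductive AutSymbol : Type where
  | sep
  | bit (b : Bool)

/-- The instance consisting of a bound `n` and a parity automaton with `m` states over an alphabet
with `s` letters: the numbers `n`, `s`, `m` in unary, the set of initial states as a bit vector,
the colors in binary, and the table of the transition relation, with one bit for each triple
of a state, a letter, and a state. -/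
def encodeAutomaton {s m : ℕ} (A : ParityAutomaton (Fin s) (Fin m)) (n : ℕ) : List AutSymbol :=
  List.replicate n (.bit true) ++ [.sep] ++
  List.replicate s (.bit true) ++ [.sep] ++
  List.replicate m (.bit true) ++ [.sep] ++
  (List.finRange m).map (fun q => .bit (decide (q ∈ A.init))) ++
  (List.finRange m).flatMap (fun q => (A.color q).bits.map .bit ++ [.sep]) ++
  (List.finRange m).flatMap (fun q => (List.finRange s).flatMap (fun a =>
    (List.finRange m).map (fun q' => .bit (decide (q' ∈ A.trans q a)))))

end Encodings

end LassoDensity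

/-!
The three counting problems are instances of one principle: for a fixed first-order sentence, the
number of families of relations on the positions of the input word that satisfy it is a function in
#P (`card_tables_mem_sharpP`). A nondeterministic machine guesses the tables of the relations bit by
bit and then evaluates the sentence deterministically, each quantifier by a head that scans the
input; as the sentence is fixed, this takes polynomial time. The bookkeeping is done by `Out`,
which says that the executions of a structured program correspond to a given list of results, and
which carries exact numbers of accepting runs through sequences and loops. The relation symbols
range over relations of any fixed arity, and the variables over the positions of the input
including the one behind its last letter.

The lassos of length `n` correspond to the pairs of a loop start `l < n` and a word of length `n`
(`numModels_eq`), which gives the denominator of the density (`density_eq`). Since `n` is given in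
unary, such a pair is a relation on the positions of the input. The other relations that occur in
the sentences are solutions of equations by recursion on the first argument; such an equation has
exactly one solution (`existsUnique_rec`). So each lasso belongs to exactly one family of tables,
and the number of families that satisfy the sentence is the number of models
(`ncard_eq_of_existsUnique`).

For an LTL formula in postfix notation, a subformula is represented by the position of its last
symbol. Recursion on this position yields the start of its text and its truth values at the
positions of the lasso. The truth of an until formula is a first-order condition on the truth values
of its operands, as it is decided before the loop is passed for the second time (`sat_untl_lword`,
`valRec_iff`).

A single sentence serves for all parity automata, whether Büchi, deterministic or neither. A lasso
is accepted if and only if the product of the automaton and the lasso has a reachable cycle whose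
maximal color is even (`ParityAutomaton.lword_mem_language`). Whether this holds is unique even if
there are many accepting runs, so nothing but the reachability relation has to be guessed. It is
described by repeated squaring (`reachRec_iff`), where the recursion counts the exponent of the
length of paths. Addition and multiplication are described by recursion as well, in order to find
entries in the transition table, and a further relation locates the binary digits of the colors.
-/

namespace LassoDensity

open Turing Function

/-! ### Counting accepting runs -/

section Counting

variable {K : Type} [DecidableEq K] {Γ : K → Type} {σ : Type} {Λ : Type}

/-- One step of a machine with choices `ch`. -/
def StepRel (ch : Λ → List (TM2.Stmt Γ Λ σ)) (c c' : TM2.Cfg Γ Λ σ) : Prop :=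
  ∃ l, c.l = some l ∧ ∃ q ∈ ch l, c' = TM2.stepAux q c.var c.stk

/-- The accepting runs that start in the configuration `c`. -/
def accRuns (ch : Λ → List (TM2.Stmt Γ Λ σ)) (acc : Set σ) (c : TM2.Cfg Γ Λ σ) :
    Set (List (TM2.Cfg Γ Λ σ)) :=
  {ρ | (ρ.head? = some c ∧ ρ.IsChain (StepRel ch)) ∧
    ∃ d, ρ.getLast? = some d ∧ d.l = none ∧ d.var ∈ acc}

/-- All runs from `c` have at most `T` steps, and exactly `m` of them are accepting. -/
def Cnt (ch : Λ → List (TM2.Stmt Γ Λ σ)) (acc : Set σ) (c : TM2.Cfg Γ Λ σ) (T m : ℕ) : Prop :=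
  (∀ ρ : List (TM2.Cfg Γ Λ σ), ρ.head? = some c → ρ.IsChain (StepRel ch) → ρ.length ≤ T + 1) ∧
    (accRuns ch acc c).encard = m

variable {ch : Λ → List (TM2.Stmt Γ Λ σ)} {acc : Set σ}

theorem Cnt.mono {c : TM2.Cfg Γ Λ σ} {T T' m : ℕ} (h : Cnt ch acc c T m) (hT : T ≤ T') :
    Cnt ch acc c T' m :=
  ⟨fun ρ h1 h2 => (h.1 ρ h1 h2).trans (by omega), h.2⟩

open Classical in
/-- A halted configuration starts exactly one run, which is accepting if its internal state is. -/
theorem Cnt.halted {c : TM2.Cfg Γ Λ σ} (hc : c.l = none) :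
    Cnt ch acc c 0 (if c.var ∈ acc then 1 else 0) := by
  have key : ∀ ρ : List (TM2.Cfg Γ Λ σ), ρ.head? = some c → ρ.IsChain (StepRel ch) → ρ = [c] := by
    intro ρ h1 h2
    match ρ, h1, h2 with
    | [a], h1, _ => simpa using h1
    | a :: b :: r, h1, h2 =>
      obtain rfl : a = c := by simpa using h1
      obtain ⟨l, hl, _⟩ := (List.isChain_cons_cons.1 h2).1
      simp [hc] at hl
  refine ⟨fun ρ h1 h2 => by simp [key ρ h1 h2], ?_⟩
  split_ifs with h
  · have : accRuns ch acc c = {[c]} := by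
      ext ρ
      constructor
      · rintro ⟨⟨h1, h2⟩, _⟩
        exact key ρ h1 h2
      · rintro rfl
        exact ⟨⟨rfl, List.isChain_singleton _⟩, c, rfl, hc, h⟩
    simp [this]
  · have : accRuns ch acc c = ∅ := by
      ext ρ
      constructor
      · rintro ⟨⟨h1, h2⟩, d, h3, _, h4⟩
        rw [key ρ h1 h2] at h3
        obtain rfl : c = d := by simpa using h3
        exact absurd h4 h
      · rintro ⟨⟩
    simp [this]

theorem accRuns_eq_biUnion {l : Λ} {v : σ} {S : ∀ k, List (Γ k)} :
    accRuns ch acc ⟨some l, v, S⟩ =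
      ⋃ c' ∈ {c' | c' ∈ (ch l).map fun q => TM2.stepAux q v S},
        List.cons ⟨some l, v, S⟩ '' accRuns ch acc c' := by
  ext ρ
  simp only [Set.mem_iUnion, Set.mem_image]
  constructor
  · rintro ⟨⟨h1, h2⟩, d, h3, h4, h5⟩
    match ρ, h1, h2, h3 with
    | [a], h1, _, h3 =>
      obtain rfl : a = _ := by simpa using h1
      obtain rfl : _ = d := by simpa using h3
      simp at h4
    | a :: b :: r, h1, h2, h3 =>
      obtain rfl : a = _ := by simpa using h1
      obtain ⟨⟨l', hl, q, hq, rfl⟩, h7⟩ := List.isChain_cons_cons.1 h2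
      obtain rfl : l = l' := by simpa using hl
      refine ⟨_, List.mem_map.2 ⟨q, hq, rfl⟩, _, ⟨⟨rfl, h7⟩, d, ?_, h4, h5⟩, rfl⟩
      simpa using h3
  · rintro ⟨c', hc', r, ⟨⟨h1, h2⟩, d, h3, h4, h5⟩, rfl⟩
    obtain ⟨q, hq, rfl⟩ := List.mem_map.1 hc'
    match r, h1, h2, h3 with
    | b :: r, h1, h2, h3 =>
      obtain rfl : b = _ := by simpa using h1
      exact ⟨⟨rfl, List.isChain_cons_cons.2 ⟨⟨l, rfl, q, hq, rfl⟩, h2⟩⟩, d, by simpa using h3, h4, h5⟩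

/-- The number of accepting runs is the sum of the numbers for the successor configurations,
provided that different choices lead to different configurations. -/
theorem Cnt.step {l : Λ} {v : σ} {S : ∀ k, List (Γ k)} {T : ℕ} {m : TM2.Cfg Γ Λ σ → ℕ}
    (hn : ((ch l).map fun q => TM2.stepAux q v S).Nodup)
    (h : ∀ c' ∈ (ch l).map fun q => TM2.stepAux q v S, Cnt ch acc c' T (m c')) :
    Cnt ch acc ⟨some l, v, S⟩ (T + 1) (((ch l).map fun q => TM2.stepAux q v S).map m).sum := by
  classical
  refine ⟨fun ρ h1 h2 => ?_, ?_⟩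
  · match ρ, h1, h2 with
    | [a], h1, _ => simp
    | a :: b :: r, h1, h2 =>
      obtain rfl : a = _ := by simpa using h1
      obtain ⟨⟨l', hl, q, hq, rfl⟩, h7⟩ := List.isChain_cons_cons.1 h2
      obtain rfl : l = l' := by simpa using hl
      have := (h _ (List.mem_map.2 ⟨q, hq, rfl⟩)).1 _ rfl h7
      simpa using this
  · rw [accRuns_eq_biUnion, Set.Finite.encard_biUnion (List.finite_toSet _)]
    · generalize hL : ((ch l).map fun q => TM2.stepAux q v S) = L at *
      have e : {c' | c' ∈ L} = (L.toFinset : Set (TM2.Cfg Γ Λ σ)) := by ext; simp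
      rw [e, finsum_mem_coe_finset, List.sum_toFinset _ hn]
      simp only [(List.cons_injective).encard_image]
      rw [Nat.cast_list_sum, List.map_map]
      congr 1
      exact List.map_congr_left fun c' hc' => (h c' hc').2
    · intro a _ b _ hab
      simp only [onFun]
      rw [Set.disjoint_iff_forall_ne]
      rintro _ ⟨r, ⟨⟨h1, _⟩, _⟩, rfl⟩ _ ⟨r', ⟨⟨h1', _⟩, _⟩, rfl⟩ hEq
      obtain rfl : r = r' := by simpa using hEq
      rw [h1] at h1'
      exact hab (by simpa using h1')

end Counting

/-! ### Structured nondeterministic programs -/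

section Programs

variable {K : Type} {Γ : K → Type} {σ : Type}

/-- Structured nondeterministic programs over the stacks `Γ` and the internal states `σ`. -/
inductive Prog (Γ : K → Type) (σ : Type) : Type
  /-- choose one of the statements and execute it in one step -/
  | act (qs : List (TM2.Stmt Γ Unit σ)) : Prog Γ σ
  | seq (p q : Prog Γ σ) : Prog Γ σ
  | ite (c : σ → Bool) (p q : Prog Γ σ) : Prog Γ σ
  /-- execute `p`, and repeat as long as `c` holds after the execution -/
  | rep (p : Prog Γ σ) (c : σ → Bool) : Prog Γ σ

/-- A statement all of whose jumps go to the label `e`. -/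
def relabel {Λ : Type} (e : Λ) : TM2.Stmt Γ Unit σ → TM2.Stmt Γ Λ σ
  | .push k f q => .push k f (relabel e q)
  | .peek k f q => .peek k f (relabel e q)
  | .pop k f q => .pop k f (relabel e q)
  | .load f q => .load f (relabel e q)
  | .branch f q q' => .branch f (relabel e q) (relabel e q')
  | .goto _ => .goto fun _ => e
  | .halt => .halt

/-- The statement does not halt the machine. -/
def NoHalt : TM2.Stmt Γ Unit σ → Prop
  | .push _ _ q => NoHalt q
  | .peek _ _ q => NoHalt q
  | .pop _ _ q => NoHalt q
  | .load _ q => NoHalt q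
  | .branch _ q q' => NoHalt q ∧ NoHalt q'
  | .goto _ => True
  | .halt => False

namespace Prog

/-- The labels of the compiled program. -/
def Lbl : Prog Γ σ → Type
  | act _ => Unit
  | seq p q => Lbl p ⊕ Lbl q
  | ite _ p q => Option (Lbl p ⊕ Lbl q)
  | rep p _ => Option (Lbl p)

/-- The label at which the compiled program starts. -/
def entry : (p : Prog Γ σ) → Lbl p
  | act _ => ()
  | seq p _ => Sum.inl (entry p)
  | ite _ _ _ => (none : Option _)
  | rep p _ => some (entry p)

theorem finite_lbl : (p : Prog Γ σ) → Finite p.Lbl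
  | act _ => inferInstanceAs (Finite Unit)
  | seq p q =>
    have := finite_lbl p
    have := finite_lbl q
    inferInstanceAs (Finite (p.Lbl ⊕ q.Lbl))
  | ite _ p q =>
    have := finite_lbl p
    have := finite_lbl q
    inferInstanceAs (Finite (Option (p.Lbl ⊕ q.Lbl)))
  | rep p _ =>
    have := finite_lbl p
    inferInstanceAs (Finite (Option p.Lbl))

/-- The statements of the compiled program in a machine in which the label `x` of the program
is called `emb x`, and which continues with the label `ex` after the program. -/
def code {Λ : Type} : (p : Prog Γ σ) → (p.Lbl → Λ) → Λ → p.Lbl → List (TM2.Stmt Γ Λ σ)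
  | act qs, _, ex, _ => qs.map (relabel ex)
  | seq p q, emb, ex, x => match x with
    | .inl x => p.code (fun y => emb (.inl y)) (emb (.inr q.entry)) x
    | .inr x => q.code (fun y => emb (.inr y)) ex x
  | ite c p q, emb, ex, x => match x with
    | none => [.branch c (.goto fun _ => emb (some (.inl p.entry)))
        (.goto fun _ => emb (some (.inr q.entry)))]
    | some (.inl x) => p.code (fun y => emb (some (.inl y))) ex x
    | some (.inr x) => q.code (fun y => emb (some (.inr y))) ex x
  | rep p c, emb, ex, x => match x with
    | none => [.branch c (.goto fun _ => emb (some p.entry)) (.goto fun _ => ex)]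
    | some x => p.code (fun y => emb (some y)) (emb none) x

end Prog

variable [DecidableEq K]

/-- The effect of a statement on the internal state and the stacks. -/
def exec (q : TM2.Stmt Γ Unit σ) (s : σ × ∀ k, List (Γ k)) : σ × ∀ k, List (Γ k) :=
  ((TM2.stepAux q s.1 s.2).var, (TM2.stepAux q s.1 s.2).stk)

/-- A compiled statement has the effect of the original one and passes the control to the label `e`.
-/
theorem stepAux_relabel {Λ : Type} (e : Λ) (q : TM2.Stmt Γ Unit σ) (hq : NoHalt q)
    (v : σ) (S : ∀ k, List (Γ k)) :
    TM2.stepAux (relabel e q) v S = ⟨some e, (exec q (v, S)).1, (exec q (v, S)).2⟩ := by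
  induction q generalizing v S with
  | push k f q ih => exact ih hq _ _
  | peek k f q ih => exact ih hq _ _
  | pop k f q ih => exact ih hq _ _
  | load f q ih => exact ih hq _ _
  | branch f q q' ih ih' =>
    simp only [relabel, exec, TM2.stepAux]
    cases f v
    · exact ih' hq.2 _ _
    · exact ih hq.1 _ _
  | goto f => rfl
  | halt => exact hq.elim

/-- Started in `s`, the program `p` ends after at most `t` steps; its executions correspond to the
elements of `l`, which are the final states of these executions. This is expressed by the way in
which bounds and numbers of accepting runs are propagated backwards through any machine that
contains the compiled program. -/
def Out (p : Prog Γ σ) (s : σ × ∀ k, List (Γ k)) (l : List (σ × ∀ k, List (Γ k))) (t : ℕ) :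
    Prop :=
  ∀ (Λ : Type) (ch : Λ → List (TM2.Stmt Γ Λ σ)) (acc : Set σ) (emb : p.Lbl → Λ) (ex : Λ),
    (∀ x, ch (emb x) = p.code emb ex x) → ∀ (T : ℕ) (m : (σ × ∀ k, List (Γ k)) → ℕ),
      (∀ s' ∈ l, Cnt ch acc ⟨some ex, s'.1, s'.2⟩ T (m s')) →
        Cnt ch acc ⟨some (emb p.entry), s.1, s.2⟩ (T + t) (l.map m).sum

theorem sum_map_flatMap {α β : Type} (m : β → ℕ) (f : α → List β) (l : List α) :
    ((l.flatMap f).map m).sum = (l.map fun a => ((f a).map m).sum).sum := by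
  induction l with
  | nil => rfl
  | cons a l ih => simp [ih]

/-- The numbers of accepting runs that belong to a list of stores may be given as a function of
an index, as the number of accepting runs from a store is unique. -/
theorem cnt_index {ι Λ : Type} {ch : Λ → List (TM2.Stmt Γ Λ σ)} {acc : Set σ} {ws : List ι}
    {F : ι → σ × ∀ k, List (Γ k)} {n : ι → ℕ} {ex : Λ} {T T' : ℕ} {c : TM2.Cfg Γ Λ σ}
    (h : ∀ m : (σ × ∀ k, List (Γ k)) → ℕ,
      (∀ s' ∈ ws.map F, Cnt ch acc ⟨some ex, s'.1, s'.2⟩ T (m s')) →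
        Cnt ch acc c T' ((ws.map F).map m).sum)
    (hn : ∀ w ∈ ws, Cnt ch acc ⟨some ex, (F w).1, (F w).2⟩ T (n w)) :
    Cnt ch acc c T' (ws.map n).sum := by
  have := h (fun s' => (accRuns ch acc ⟨some ex, s'.1, s'.2⟩).encard.toNat) ?_
  · convert this using 2
    rw [List.map_map]
    exact List.map_congr_left fun w hw => by simp [(hn w hw).2]
  · simp only [List.mem_map]
    rintro _ ⟨w, hw, rfl⟩
    exact ⟨(hn w hw).1, by simp [(hn w hw).2]⟩

namespace Out

variable {s : σ × ∀ k, List (Γ k)} {l : List (σ × ∀ k, List (Γ k))} {t t' : ℕ} {p q : Prog Γ σ}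

theorem mono (h : Out p s l t) (ht : t ≤ t') : Out p s l t' :=
  fun Λ ch acc emb ex hc T m hm => (h Λ ch acc emb ex hc T m hm).mono (by omega)

theorem congr {l' : List (σ × ∀ k, List (Γ k))} (h : Out p s l t) (hl : l = l') :
    Out p s l' t := hl ▸ h

/-- A nondeterministic choice has one execution for each statement. The results have to be
different, as equal successors of a configuration give only one run. -/
theorem act {qs : List (TM2.Stmt Γ Unit σ)} (hq : ∀ q ∈ qs, NoHalt q)
    (hn : (qs.map fun q => exec q s).Nodup) : Out (.act qs) s (qs.map fun q => exec q s) 1 := by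
  intro Λ ch acc emb ex hc T m hm
  have e : ((ch (emb ())).map fun q => TM2.stepAux q s.1 s.2) =
      (qs.map fun q => exec q s).map fun s' => ⟨some ex, s'.1, s'.2⟩ := by
    rw [hc ()]
    simp only [Prog.code, List.map_map]
    exact List.map_congr_left fun q h => stepAux_relabel ex q (hq q h) s.1 s.2
  have := Cnt.step (ch := ch) (acc := acc) (l := emb ()) (v := s.1) (S := s.2) (T := T)
    (m := fun c => m (c.var, c.stk)) ?_ ?_
  · rw [e, List.map_map] at this
    exact this
  · rw [e]
    refine hn.map ?_
    intro a b hab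
    exact Prod.ext (congrArg TM2.Cfg.var hab) (congrArg TM2.Cfg.stk hab)
  · rw [e]
    simp only [List.mem_map]
    rintro _ ⟨_, ⟨q, hq', rfl⟩, rfl⟩
    exact hm _ (List.mem_map.2 ⟨q, hq', rfl⟩)

theorem act_one {q : TM2.Stmt Γ Unit σ} (hq : NoHalt q) : Out (.act [q]) s [exec q s] 1 :=
  act (by simpa using hq) (by simp)

theorem act_eq {q : TM2.Stmt Γ Unit σ} {s' : σ × ∀ k, List (Γ k)} (hq : NoHalt q)
    (h : exec q s = s') : Out (.act [q]) s [s'] 1 :=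
  h ▸ act_one hq

/-- Sequential composition. The executions of `p` are indexed by a list `ws`, and `H w` lists the
results of `q` after the execution with index `w`. -/
theorem seq {ι : Type} {ws : List ι} {F : ι → σ × ∀ k, List (Γ k)}
    {H : ι → List (σ × ∀ k, List (Γ k))} (hp : Out p s (ws.map F) t)
    (hq : ∀ w ∈ ws, Out q (F w) (H w) t') : Out (.seq p q) s (ws.flatMap H) (t + t') := by
  intro Λ ch acc emb ex hc T m hm
  refine Cnt.mono (T := T + t' + t) ?_ (by omega)
  rw [sum_map_flatMap]
  -- the numbers for the final states of `p`, as a function of the index `w`, depend only on `F w`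
  have key : ∀ w ∈ ws, Cnt ch acc ⟨some (emb (.inr q.entry)), (F w).1, (F w).2⟩ (T + t')
      ((H w).map m).sum := fun w hw =>
    hq w hw Λ ch acc (fun y => emb (.inr y)) ex (fun x => hc (.inr x)) T m fun s'' hs'' =>
      hm s'' (List.mem_flatMap.2 ⟨w, hw, hs''⟩)
  exact cnt_index (hp Λ ch acc (fun y => emb (.inl y)) (emb (.inr q.entry))
    (fun x => hc (.inl x)) (T + t')) key

theorem det_seq {s' : σ × ∀ k, List (Γ k)} (hp : Out p s [s'] t) (hq : Out q s' l t') :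
    Out (.seq p q) s l (t + t') := by
  have := seq (ws := [()]) (F := fun _ => s') (H := fun _ => l) hp fun _ _ => hq
  simpa using this

theorem ite {c : σ → Bool} (hp : c s.1 = true → Out p s l t) (hq : c s.1 = false → Out q s l t) :
    Out (.ite c p q) s l (t + 1) := by
  intro Λ ch acc emb ex hc T m hm
  have e := hc none
  have := Cnt.step (ch := ch) (acc := acc) (l := emb none) (v := s.1) (S := s.2) (T := T + t)
    (m := fun _ => (l.map m).sum) ?_ ?_
  · rw [e] at this
    simp only [Prog.code, List.map_cons, List.map_nil, List.sum_cons, List.sum_nil, add_zero] at this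
    exact this.mono (by omega)
  · rw [e]
    simp [Prog.code]
  · rw [e]
    simp only [Prog.code, List.map_cons, List.map_nil, List.mem_singleton, forall_eq, TM2.stepAux]
    cases h : c s.1
    · exact hq h Λ ch acc (fun y => emb (some (.inr y))) ex (fun x => hc (some (.inr x))) T m hm
    · exact hp h Λ ch acc (fun y => emb (some (.inl y))) ex (fun x => hc (some (.inl x))) T m hm

/-- One round of a loop: the executions for which the condition fails end the loop, and the others
continue with another round. -/
theorem rep {c : σ → Bool} {ι : Type} {ws : List ι} {F : ι → σ × ∀ k, List (Γ k)}
    {H : ι → List (σ × ∀ k, List (Γ k))} (hp : Out p s (ws.map F) t)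
    (hs : ∀ w ∈ ws, c (F w).1 = false → H w = [F w])
    (ha : ∀ w ∈ ws, c (F w).1 = true → Out (.rep p c) (F w) (H w) t') :
    Out (.rep p c) s (ws.flatMap H) (t + 1 + t') := by
  intro Λ ch acc emb ex hc T m hm
  refine Cnt.mono (T := T + t' + 1 + t) ?_ (by omega)
  rw [sum_map_flatMap]
  have e := hc none
  refine cnt_index (hp Λ ch acc (fun y => emb (some y)) (emb none) (fun x => hc (some x))
    (T + t' + 1)) fun w hw => ?_
  have := Cnt.step (ch := ch) (acc := acc) (l := emb none) (v := (F w).1) (S := (F w).2)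
    (T := T + t') (m := fun _ => ((H w).map m).sum) ?_ ?_
  · rw [e] at this
    simpa [Prog.code] using this
  · rw [e]
    simp [Prog.code]
  · rw [e]
    simp only [Prog.code, List.map_cons, List.map_nil, List.mem_singleton, forall_eq,
      TM2.stepAux]
    cases h : c (F w).1
    · have h2 := hs w hw h
      have := hm (F w) (List.mem_flatMap.2 ⟨w, hw, by simp [h2]⟩)
      simpa [h2] using this.mono (by omega)
    · exact ha w hw h Λ ch acc emb ex hc T m fun s'' hs'' =>
        hm s'' (List.mem_flatMap.2 ⟨w, hw, hs''⟩)

theorem rep_done {c : σ → Bool} {s' : σ × ∀ k, List (Γ k)} (hp : Out p s [s'] t)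
    (hc : c s'.1 = false) : Out (.rep p c) s [s'] (t + 1) := by
  have := rep (c := c) (ws := [()]) (F := fun _ => s') (H := fun _ => [s']) (t' := 0) hp
    (fun _ _ _ => rfl) (fun _ _ h => by rw [hc] at h; cases h)
  simpa using this

theorem rep_again {c : σ → Bool} {s' : σ × ∀ k, List (Γ k)} (hp : Out p s [s'] t)
    (hc : c s'.1 = true) (h' : Out (.rep p c) s' l t') : Out (.rep p c) s l (t + 1 + t') := by
  have := rep (c := c) (ws := [()]) (F := fun _ => s') (H := fun _ => l) (t' := t') hp
    (fun _ _ h => by rw [hc] at h; cases h) (fun _ _ _ => h')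
  simpa using this

end Out

end Programs

end LassoDensity

namespace LassoDensity

open Turing Function

/-! ### Two-way heads on words -/

section Heads

variable {Z A : Type} [DecidableEq Z]

/-- The stacks of a family of two-way heads: the head `z` on the word `cont z` at the position
`pos z` is represented by one stack with the part of the word to its left and one with the rest. -/
def zip (cont : Z → List A) (pos : Z → ℕ) (k : Z × Bool) : List A :=
  if k.2 then (cont k.1).drop (pos k.1) else ((cont k.1).take (pos k.1)).reverse

/-- Programs for a family of heads. The internal state consists of a truth value and of the letter
that was read last. -/
abbrev HProg (Z A : Type) : Type := Prog (K := Z × Bool) (fun _ => A) (Bool × Option A)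

/-- The internal state and the stacks of a machine with heads. -/
abbrev HStore (Z A : Type) : Type := (Bool × Option A) × ((k : Z × Bool) → List ((fun _ => A) k))

/-- The store with truth value `b` and last letter `c`, and heads on `cont` at `pos`. -/
def st (b : Bool) (c : Option A) (cont : Z → List A) (pos : Z → ℕ) : HStore Z A :=
  ((b, c), zip cont pos)

namespace HProg

/-- Read the letter under the head and move the head one letter forward. -/
def fwd [Inhabited A] (z : Z) : HProg Z A :=
  .act [.pop (z, true) (fun s o => (s.1, o)) (.branch (fun s => s.2.isSome)
    (.push (z, false) (fun s => s.2.getD default) (.goto fun _ => ())) (.goto fun _ => ()))]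

/-- Move the head one letter backward and read the letter under it. -/
def bwd [Inhabited A] (z : Z) : HProg Z A :=
  .act [.pop (z, false) (fun s o => (s.1, o)) (.branch (fun s => s.2.isSome)
    (.push (z, true) (fun s => s.2.getD default) (.goto fun _ => ())) (.goto fun _ => ()))]

/-- Read the letter under the head. -/
def read (z : Z) : HProg Z A :=
  .act [.peek (z, true) (fun s o => (s.1, o)) (.goto fun _ => ())]

/-- Read the letter before the head. -/
def low (z : Z) : HProg Z A :=
  .act [.peek (z, false) (fun s o => (s.1, o)) (.goto fun _ => ())]

/-- Change the internal state. -/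
def load (f : Bool × Option A → Bool × Option A) : HProg Z A :=
  .act [.load f (.goto fun _ => ())]

/-- Forget the letter that was read last. -/
def clear : HProg Z A := load fun s => (s.1, none)

/-- Execute `p`, and repeat as long as a letter has been read last. -/
def loop (p : HProg Z A) : HProg Z A := .rep p fun s => s.2.isSome

/-- Execute `p` if a letter has been read last, and `q` otherwise. -/
def ifSome (p q : HProg Z A) : HProg Z A := .ite (fun s => s.2.isSome) p q

/-- Move the head to the start of its word. -/
def rewind [Inhabited A] (z : Z) : HProg Z A := loop (bwd z)

end HProg

open HProg

variable {b : Bool} {c : Option A} {cont : Z → List A} {pos : Z → ℕ} {z : Z}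

theorem out_load {f : Bool × Option A → Bool × Option A} :
    Out (load f) (st b c cont pos) [st (f (b, c)).1 (f (b, c)).2 cont pos] 1 :=
  Out.act_one (s := st b c cont pos) (q := .load f (.goto fun _ => ())) trivial

theorem out_clear : Out clear (st b c cont pos) [st b none cont pos] 1 := out_load

theorem out_read :
    Out (read z) (st b c cont pos) [st b (cont z)[pos z]? cont pos] 1 := by
  refine Out.act_eq trivial ?_
  unfold exec
  simp [st, TM2.stepAux, zip, List.head?_drop]

theorem head?_reverse_take {l : List A} {n : ℕ} (h : n ≤ l.length) :
    (l.take n).reverse.head? = if n = 0 then none else l[n - 1]? := by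
  rw [List.head?_reverse]
  split_ifs with h0
  · simp [h0]
  · rw [List.getLast?_eq_getElem?, List.getElem?_take]
    simp only [List.length_take]
    rw [min_eq_left h, if_pos (by omega)]

/-- The letter before the head, if the head is not at the start of its word. -/
theorem out_low (h : pos z ≤ (cont z).length) :
    Out (low z) (st b c cont pos)
      [st b (if pos z = 0 then none else (cont z)[pos z - 1]?) cont pos] 1 := by
  refine Out.act_eq trivial ?_
  unfold exec
  simp [st, TM2.stepAux, zip, ← head?_reverse_take h]

theorem out_ifSome {p q : HProg Z A} {l : List (HStore Z A)} {t : ℕ}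
    (hp : c.isSome = true → Out p (st b c cont pos) l t)
    (hq : c = none → Out q (st b c cont pos) l t) :
    Out (ifSome p q) (st b c cont pos) l (t + 1) :=
  Out.ite hp fun h => hq (by simpa [st] using h)

/-- A loop whose body is executed `n + 1` times; `I` is an invariant of the internal state. -/
theorem out_loop {p : HProg Z A} {t : ℕ} {I : Bool × Option A → Prop} {e : HStore Z A}
    (he : e.1.2 = none) (n : ℕ) (S : ℕ → (k : Z × Bool) → List ((fun _ => A) k))
    (hp : ∀ i < n, ∀ x, I x → ∃ y, I y ∧ y.2.isSome = true ∧ Out p (x, S i) [(y, S (i + 1))] t)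
    (hl : ∀ x, I x → Out p (x, S n) [e] t) (x : Bool × Option A) (hx : I x) :
    Out (loop p) (x, S 0) [e] ((n + 1) * (t + 1)) := by
  induction n generalizing S x with
  | zero => simpa [loop] using (hl x hx).rep_done (c := fun s => s.2.isSome) (by simp [he])
  | succ n ih =>
    obtain ⟨y, hy, hy', h⟩ := hp 0 (by omega) x hx
    have := ih (fun i => S (i + 1)) (fun i hi => hp (i + 1) (by omega)) hl y hy
    refine (Out.rep_again (c := fun s : Bool × Option A => s.2.isSome) h hy' this).mono ?_
    ring_nf
    omega

theorem reverse_take_succ {l : List A} {k : ℕ} (h : k < l.length) :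
    (l.take (k + 1)).reverse = l[k] :: (l.take k).reverse := by
  rw [List.take_succ_eq_append_getElem h]
  simp

variable [Inhabited A]

theorem out_fwd (h : pos z ≤ (cont z).length) :
    Out (fwd z) (st b c cont pos)
      [st b (cont z)[pos z]? cont (update pos z (min (pos z + 1) (cont z).length))] 1 := by
  refine Out.act_eq ⟨trivial, trivial⟩ ?_
  rcases h.lt_or_eq with h | h
  · unfold exec
    simp only [st, TM2.stepAux]
    have e : (zip cont pos (z, true)).head? = some (cont z)[pos z] := by
      simp [zip, List.head?_drop, h]
    simp only [e, Option.isSome_some, cond_true, Option.getD_some]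
    refine Prod.ext ?_ ?_
    · simp [h]
    · ext1 ⟨z', d⟩
      rw [min_eq_left h]
      by_cases hz : z' = z
      · subst hz
        cases d
        · simp [zip, reverse_take_succ h]
        · simp [zip]
      · simp [zip, hz]
  · unfold exec
    simp only [st, TM2.stepAux]
    have e : (zip cont pos (z, true)).head? = none := by
      simp [zip, h]
    simp only [e, Option.isSome_none, cond_false]
    refine Prod.ext ?_ ?_
    · simp [h]
    · ext1 ⟨z', d⟩
      by_cases hz : z' = z
      · subst hz
        cases d <;> simp [zip, h]
      · simp [zip, hz]

theorem out_bwd (h : pos z ≤ (cont z).length) :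
    Out (bwd z) (st b c cont pos)
      [st b (if pos z = 0 then none else (cont z)[pos z - 1]?) cont
        (update pos z (pos z - 1))] 1 := by
  refine Out.act_eq ⟨trivial, trivial⟩ ?_
  by_cases h0 : pos z = 0
  · unfold exec
    simp only [st, TM2.stepAux]
    have e : (zip cont pos (z, false)).head? = none := by
      simp [zip, h0]
    simp only [e, Option.isSome_none, cond_false]
    refine Prod.ext ?_ ?_
    · simp [h0]
    · ext1 ⟨z', d⟩
      by_cases hz : z' = z
      · subst hz
        cases d <;> simp [zip, h0]
      · simp [zip, hz]
  · obtain ⟨k, hk⟩ := Nat.exists_eq_succ_of_ne_zero h0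
    have hk' : k < (cont z).length := by omega
    unfold exec
    simp only [st, TM2.stepAux]
    have e : (zip cont pos (z, false)).head? = some (cont z)[k] := by
      have := head?_reverse_take h
      rw [if_neg h0, hk] at this
      simpa [zip, hk, hk'] using this
    simp only [e, Option.isSome_some, cond_true, Option.getD_some]
    refine Prod.ext ?_ ?_
    · simp [hk, hk']
    · ext1 ⟨z', d⟩
      by_cases hz : z' = z
      · subst hz
        cases d
        · simp [zip, hk, reverse_take_succ hk']
        · simp [zip, hk]
      · simp [zip, hz]

theorem out_rewind (h : pos z ≤ (cont z).length) :
    Out (rewind z) (st b c cont pos) [st b none cont (update pos z 0)]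
      (((cont z).length + 1) * 2) := by
  have := out_loop (p := bwd z) (t := 1) (I := fun x => x.1 = b)
    (e := st b none cont (update pos z 0)) rfl (pos z) (fun i => zip cont (update pos z (pos z - i)))
    ?_ ?_ (b, c) rfl
  · simp only [Nat.sub_zero, update_eq_self] at this
    exact this.mono (by gcongr)
  · rintro i hi ⟨b', c⟩ rfl
    refine ⟨_, ?_, ?_, by
      simpa [st, Nat.sub_sub] using out_bwd (b := b') (c := c) (cont := cont) (z := z)
        (pos := update pos z (pos z - i)) (by simp; omega)⟩
    · rfl
    · rw [if_neg (by omega)]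
      have : pos z - (i + 1) < (cont z).length := by omega
      simp [this]
  · rintro ⟨b', c⟩ rfl
    have := out_bwd (b := b') (c := c) (cont := cont) (z := z)
        (pos := update pos z (pos z - pos z)) (by simp)
    simpa [st] using this

end Heads

end LassoDensity

namespace LassoDensity

open Turing Function

/-! ### Counting with heads -/

section Counters

variable {Z A : Type} [DecidableEq Z] [Inhabited A]

namespace HProg

/-- Move the head `g` forward by `(L + 1) ^ k` letters, where `L` is the length of the words under
the auxiliary heads `Y 0, …, Y (k - 1)`; these heads start and end at position `0`. -/
def adv (g : Z) (Y : ℕ → Z) : ℕ → HProg Z A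
  | 0 => .seq (fwd g) clear
  | k + 1 => .seq (loop (.seq (adv g Y k) (fwd (Y k)))) (rewind (Y k))

/-- Move the head `T` back to the start of its word, and execute `p` for each of the moves. -/
def restore (T : Z) (p : HProg Z A) : HProg Z A :=
  loop (.seq (bwd T) (ifSome p clear))

/-- Move the head `g` forward by `n * (L + 1) ^ k` letters, where `n` is the position of the
head `i`; the position of `i` is saved by means of the head `T`. -/
def timesAdv (T g : Z) (Y : ℕ → Z) (i : Z) (k : ℕ) : HProg Z A :=
  .seq (loop (.seq (bwd i) (ifSome (.seq (fwd T) (.seq (adv g Y k)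
    (load fun s => (s.1, some default)))) clear))) (restore T (fwd i))

/-- Compare the positions of two different heads, by moving them backward in lockstep. -/
def less (T i j : Z) : HProg Z A :=
  .seq (loop (.seq (low i) (ifSome
      (.seq (low j) (ifSome (.seq (bwd i) (.seq (bwd j) (fwd T))) (load fun _ => (false, none))))
      (.seq (low j) (load fun s => (s.2.isSome, none))))))
    (restore T (.seq (fwd i) (fwd j)))

/-- A time bound for `adv`. -/
def advTime (L : ℕ) : ℕ → ℕ
  | 0 => 2
  | k + 1 => (L + 1) * (advTime L k + 2) + (L + 1) * 2

end HProg

open HProg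

variable {b : Bool} {c : Option A} {cont : Z → List A} {pos : Z → ℕ}

theorem out_fwd_lt {z : Z} (h : pos z < (cont z).length) :
    Out (fwd z) (st b c cont pos) [st b (some (cont z)[pos z]) cont (update pos z (pos z + 1))] 1 := by
  have := out_fwd (b := b) (c := c) (cont := cont) (pos := pos) (z := z) h.le
  rwa [min_eq_left h, List.getElem?_eq_getElem h] at this

theorem out_bwd_succ {z : Z} {k : ℕ} (hk : pos z = k + 1) (h : k < (cont z).length) :
    Out (bwd z) (st b c cont pos) [st b (some (cont z)[k]) cont (update pos z k)] 1 := by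
  have := out_bwd (b := b) (c := c) (cont := cont) (pos := pos) (z := z) (by omega)
  rw [if_neg (by omega), hk] at this
  simpa [h] using this

theorem out_bwd_zero {z : Z} (hk : pos z = 0) :
    Out (bwd z) (st b c cont pos) [st b none cont pos] 1 := by
  have := out_bwd (b := b) (c := c) (cont := cont) (pos := pos) (z := z) (by omega)
  rw [if_pos hk] at this
  rwa [show update pos z (pos z - 1) = pos by simp [hk]] at this

/-- By induction on `k`, a pass of the counter `Y k` over its word repeats the move by `(L + 1) ^ k`
letters `L + 1` times. A head that reaches the end of its word stays there. -/
theorem out_adv {g : Z} {Y : ℕ → Z} {L : ℕ} (k : ℕ) (hL : ∀ j < k, (cont (Y j)).length = L)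
    (hg : ∀ j < k, Y j ≠ g) (hY : ∀ j < k, ∀ i < j, Y i ≠ Y j) (b : Bool) (c : Option A)
    (pos : Z → ℕ) (h0 : ∀ j < k, pos (Y j) = 0) (hp : pos g ≤ (cont g).length) :
    Out (adv g Y k) (st b c cont pos)
      [st b none cont (update pos g (min (pos g + (L + 1) ^ k) (cont g).length))]
      (advTime L k) := by
  induction k generalizing b c pos with
  | zero => simpa [advTime, adv] using (out_fwd hp).det_seq out_clear
  | succ k ih =>
    have ih := ih (fun j hj => hL j (by omega)) (fun j hj => hg j (by omega))
      (fun j hj => hY j (by omega))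
    have hgk := hg k (by omega)
    have hLk := hL k (by omega)
    have h0k := h0 k (by omega)
    have hYk := hY k (by omega)
    set M := (L + 1) ^ k with hM
    have body : ∀ i ≤ L, ∀ b c, Out (.seq (adv g Y k) (fwd (Y k)))
        (st b c cont (update (update pos (Y k) i) g (min (pos g + i * M) (cont g).length)))
        [st b (cont (Y k))[i]? cont (update (update pos (Y k) (min (i + 1) L)) g
          (min (pos g + (i + 1) * M) (cont g).length))] (advTime L k + 1) := by
      intro i hi b c
      have h1 := ih b c (update (update pos (Y k) i) g (min (pos g + i * M) (cont g).length))
        (fun j hj => by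
          rw [update_of_ne (hg j (by omega)), update_of_ne (hYk j hj), h0 j (by omega)])
        (by simp)
      refine h1.det_seq ?_
      have h2 := out_fwd (b := b) (c := none) (cont := cont) (z := Y k)
        (pos := update (update (update pos (Y k) i) g (min (pos g + i * M) (cont g).length)) g
          (min ((update (update pos (Y k) i) g (min (pos g + i * M) (cont g).length)) g + M)
            (cont g).length)) (by simp [hgk, hLk, hi])
      convert h2 using 2
      congr 1
      · simp [hgk]
      · have : (i + 1) * M = i * M + M := by ring
        rw [update_idem, update_comm hgk.symm, update_idem, update_self, update_of_ne hgk,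
          update_self, hLk]
        congr 1
        omega
    have hl := out_loop (p := .seq (adv g Y k) (fwd (Y k))) (t := advTime L k + 1)
      (I := fun x => x.1 = b) (e := st b none cont (update (update pos (Y k) L) g
          (min (pos g + (L + 1) * M) (cont g).length))) rfl L
      (fun i => zip cont (update (update pos (Y k) i) g (min (pos g + i * M) (cont g).length)))
      ?_ ?_ (b, c) rfl
    · have e : update (update pos (Y k) 0) g (min (pos g + 0 * M) (cont g).length) = pos := by
        rw [zero_mul, add_zero, min_eq_left hp, ← h0k, update_eq_self, update_eq_self]
      rw [e] at hl
      refine (Out.det_seq hl (out_rewind (by simp [hgk, hLk]))).mono ?_ |>.congr ?_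
      · rw [hLk, advTime]
      · rw [update_comm hgk, update_idem, update_comm hgk.symm, ← h0k, update_eq_self, pow_succ',
          ← hM]
    · rintro i hi ⟨b', c⟩ rfl
      have h := body i hi.le b' c
      rw [min_eq_left (by omega : i + 1 ≤ L)] at h
      refine ⟨(b', (cont (Y k))[i]?), rfl, ?_, h⟩
      simp [hLk, hi]
    · rintro ⟨b', c⟩ rfl
      have h := body L le_rfl b' c
      rw [min_eq_right (by omega : L ≤ L + 1), List.getElem?_eq_none hLk.le] at h
      exact h

/-- Here `S m` are the positions of the heads when `T` is at the position `m`; the program `p` is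
executed after `T` has moved from `m + 1` to `m`, and leads from `S (m + 1)` to `S m`. -/
theorem out_restore {T : Z} {p : HProg Z A} {t : ℕ} (n : ℕ) (S : ℕ → Z → ℕ)
    (hn : n < (cont T).length + 1) (hT : ∀ m ≤ n, S m T = m)
    (hp : ∀ m < n, ∀ c, ∃ a, Out p (st b c cont (update (S (m + 1)) T m))
      [st b (some a) cont (S m)] t) :
    Out (restore T p) (st b c cont (S n)) [st b none cont (S 0)] ((n + 1) * (t + 4)) := by
  have hl := out_loop (p := .seq (bwd T) (ifSome p clear)) (t := t + 3)
      (I := fun x => x.1 = b) (e := st b none cont (S 0)) rfl n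
      (fun i => zip cont (S (n - i))) ?_ ?_ (b, c) rfl
  · exact hl
  · rintro i hi ⟨b', c⟩ rfl
    obtain ⟨m, hm⟩ : ∃ m, n - i = m + 1 := ⟨n - i - 1, by omega⟩
    have hm' : n - (i + 1) = m := by omega
    have h1 := out_bwd_succ (b := b') (c := c) (cont := cont) (pos := S (m + 1)) (z := T) (k := m)
      (hT _ (by omega)) (by omega)
    obtain ⟨a, h2⟩ := hp m (by omega) (some (cont T)[m])
    refine ⟨(b', some a), rfl, rfl, ?_⟩
    rw [hm, hm']
    refine (h1.det_seq (out_ifSome (t := t + 1) (fun _ => h2.mono (by omega)) ?_)).mono (by omega)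
    intro h
    cases h
  · rintro ⟨b', c⟩ rfl
    rw [Nat.sub_self]
    refine ((out_bwd_zero (hT 0 (by omega))).det_seq (out_ifSome (t := t + 1) ?_
      fun _ => out_clear.mono (by omega))).mono (by omega)
    intro h
    cases h

/-- A time bound for `timesAdv`. -/
def HProg.timesTime (L k : ℕ) : ℕ := (L + 1) * (advTime L k + 5) + (L + 1) * 5

/-- The head `i` moves back to its start and `g` advances with each of the moves, while `T` counts
them; then `T` moves back to its start and takes `i` forward to its old position. -/
theorem out_timesAdv {T g i : Z} {Y : ℕ → Z} {L : ℕ} (k : ℕ)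
    (hL : ∀ j < k, (cont (Y j)).length = L) (hiL : (cont i).length = L) (hTL : (cont T).length = L)
    (hg : ∀ j < k, Y j ≠ g) (hY : ∀ j < k, ∀ i < j, Y i ≠ Y j)
    (hYT : ∀ j < k, Y j ≠ T) (hYi : ∀ j < k, Y j ≠ i) (hTg : T ≠ g) (hig : i ≠ g) (hiT : i ≠ T)
    (h0 : ∀ j < k, pos (Y j) = 0) (hT : pos T = 0) (hi : pos i ≤ L) (hp : pos g ≤ (cont g).length) :
    Out (timesAdv T g Y i k) (st b c cont pos)
      [st b none cont (update pos g (min (pos g + pos i * (L + 1) ^ k) (cont g).length))]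
      (timesTime L k) := by
  set M := (L + 1) ^ k with hM
  set len := (cont g).length with hlen
  have hl := out_loop (p := .seq (bwd i) (ifSome (.seq (fwd T) (.seq (adv g Y k)
    (load fun s => (s.1, some default)))) clear)) (t := advTime L k + 4)
      (I := fun x => x.1 = b) (e := st b none cont
        (update (update (update pos i 0) T (pos i)) g (min (pos g + pos i * M) len))) rfl (pos i)
      (fun m => zip cont
        (update (update (update pos i (pos i - m)) T m) g (min (pos g + m * M) len)))
      ?_ ?_ (b, c) rfl
  · have e : update (update (update pos i (pos i - 0)) T 0) g (min (pos g + 0 * M) len) = pos := by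
      rw [zero_mul, add_zero, min_eq_left hp, Nat.sub_zero, update_eq_self, ← hT, update_eq_self,
        update_eq_self]
    rw [e] at hl
    have h2 := out_restore (b := b) (c := none) (cont := cont) (T := T) (p := fwd i) (t := 1) (pos i)
      (fun m => update (update (update pos i (pos i - m)) T m) g (min (pos g + pos i * M) len))
      (by omega) (fun m _ => by simp [hTg]) (fun m hm c => by
        have hlt : pos i - (m + 1) < (cont i).length := by omega
        refine ⟨(cont i)[pos i - (m + 1)], ?_⟩
        have := out_fwd_lt (b := b) (c := c) (cont := cont) (z := i)
          (pos := update (update (update (update pos i (pos i - (m + 1))) T (m + 1)) g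
            (min (pos g + pos i * M) len)) T m) (by simp [hig, hiT]; omega)
        convert this using 2
        congr 1
        · simp [hig, hiT]
        · have : pos i - m = pos i - (m + 1) + 1 := by omega
          rw [update_of_ne hiT, update_of_ne hig, update_of_ne hiT, update_self, ← this,
            update_comm hTg.symm, update_idem, update_comm hig.symm, update_comm hiT.symm,
            update_idem])
    rw [Nat.sub_self] at h2
    refine (hl.det_seq h2).mono ?_ |>.congr ?_
    · rw [timesTime]
      gcongr
    · rw [Nat.sub_zero, update_eq_self, ← hT, update_eq_self]
  · rintro m hm ⟨b', c⟩ rfl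
    refine ⟨(b', some default), rfl, rfl, ?_⟩
    have hlt : pos i - (m + 1) < (cont i).length := by omega
    refine (Out.det_seq (t' := advTime L k + 3)
      (out_bwd_succ (k := pos i - (m + 1)) ?_ hlt) (out_ifSome (t := advTime L k + 2)
        (fun _ => ?_) fun h => by cases h)).mono (by omega)
    · simp [hig, hiT]
      omega
    · have hlt' : m < (cont T).length := by omega
      refine (Out.det_seq (out_fwd_lt (z := T) ?_) (Out.det_seq (out_adv (L := L) k hL hg hY _ _ _
        ?_ ?_) (out_load.congr (l' := [st b' (some default) cont _]) rfl))).mono (by omega) |>.congr ?_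
      · simp [hTg, hiT.symm]
        omega
      · intro j hj
        simp [hYT j hj, hYi j hj, hg j hj, h0 j hj]
      · simp [hTg.symm, hig.symm, hlen]
      · change [st _ _ _ _] = [st _ _ _ _]
        congr 2
        have : (m + 1) * M = m * M + M := by ring
        funext z
        rcases eq_or_ne z g with rfl | hzg
        · simp only [update_self, update_of_ne hTg.symm, update_of_ne hig.symm]
          omega
        · rcases eq_or_ne z T with rfl | hzT
          · simp [hzg, hiT.symm]
          · rcases eq_or_ne z i with rfl | hzi
            · simp [hzg, hzT]
            · simp [hzg, hzT, hzi]
  · rintro ⟨b', c⟩ rfl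
    refine (Out.det_seq (out_bwd_zero ?_) (out_ifSome (t := 1) (fun h => by cases h) fun _ =>
      out_clear)).mono (by omega) |>.congr ?_
    · simp [hig, hiT]
    · rw [Nat.sub_self]

/-- A time bound for `less`. -/
def HProg.lessTime (L : ℕ) : ℕ := (L + 1) * 9 + (L + 1) * 6

/-- The heads `i` and `j` move backward together until one of them is at the start; `T` counts these
moves, so that both can be brought back. -/
theorem out_less {T i j : Z} {L : ℕ} (hiL : (cont i).length = L) (hjL : (cont j).length = L)
    (hTL : (cont T).length = L) (hij : i ≠ j) (hiT : i ≠ T) (hjT : j ≠ T) (hT : pos T = 0)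
    (hi : pos i ≤ L) (hj : pos j ≤ L) :
    Out (less T i j) (st b c cont pos) [st (decide (pos i < pos j)) none cont pos]
      (lessTime L) := by
  set n := min (pos i) (pos j) with hn
  have hni : n ≤ pos i := min_le_left _ _
  have hnj : n ≤ pos j := min_le_right _ _
  set S : ℕ → Z → ℕ := fun m => update (update (update pos i (pos i - m)) j (pos j - m)) T m with hS
  have hSi : ∀ m, S m i = pos i - m := fun m => by simp [hS, hij, hiT]
  have hSj : ∀ m, S m j = pos j - m := fun m => by simp [hS, hjT]
  have hST : ∀ m, S m T = m := fun m => by simp [hS]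
  have hS0 : S 0 = pos := by
    simp only [hS, Nat.sub_zero, update_eq_self]
    rw [← hT, update_eq_self]
  have hSe : ∀ m, ∀ f : Z → ℕ, f i = pos i - m → f j = pos j - m → f T = m →
      (∀ z, z ≠ i → z ≠ j → z ≠ T → f z = pos z) → f = S m := by
    intro m f h1 h2 h3 h4
    funext z
    by_cases hzi : z = i
    · rw [hzi, h1, hSi]
    by_cases hzj : z = j
    · rw [hzj, h2, hSj]
    by_cases hzT : z = T
    · rw [hzT, h3, hST]
    rw [h4 z hzi hzj hzT]
    simp [hS, hzi, hzj, hzT]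
  have hSo : ∀ m z, z ≠ i → z ≠ j → z ≠ T → S m z = pos z := fun m z h1 h2 h3 => by
    simp [hS, h1, h2, h3]
  have hl := out_loop (p := .seq (low i) (ifSome
      (.seq (low j) (ifSome (.seq (bwd i) (.seq (bwd j) (fwd T))) (load fun _ => (false, none))))
      (.seq (low j) (load fun s => (s.2.isSome, none))))) (t := 8)
      (I := fun x => True) (e := st (decide (pos i < pos j)) none cont (S n)) rfl n
      (fun m => zip cont (S m)) ?_ ?_ (b, c) trivial
  · have h2 := out_restore (b := decide (pos i < pos j)) (c := none) (cont := cont) (T := T)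
      (p := .seq (fwd i) (fwd j)) (t := 2) n S (by omega) (fun m _ => hST m) (fun m hm c => by
        have hlt : pos i - (m + 1) < (cont i).length := by omega
        have hlt' : pos j - (m + 1) < (cont j).length := by omega
        refine ⟨(cont j)[pos j - (m + 1)], ?_⟩
        refine Out.det_seq (out_fwd_lt (z := i) ?_) ((out_fwd_lt (z := j) ?_).congr ?_)
        · rwa [update_of_ne hiT, hSi]
        · rwa [update_of_ne hij.symm, update_of_ne hjT, hSj]
        · congr 2
          · simp [hij.symm, hjT, hSj]
          · apply hSe
            · simp [hij, hiT, hSi]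
              omega
            · simp [hij.symm, hjT, hSj]
              omega
            · simp [hiT.symm, hjT.symm]
            · intro z h1 h2 h3
              simp [h1, h2, h3, hSo])
    rw [hS0] at h2
    change Out (loop _) (st b c cont (S 0)) _ _ at hl
    rw [hS0] at hl
    refine (hl.det_seq h2).mono ?_
    rw [lessTime]
    gcongr <;> omega
  · rintro m hm ⟨b', c⟩ -
    have hlt : pos i - (m + 1) < (cont i).length := by omega
    have hlt' : pos j - (m + 1) < (cont j).length := by omega
    have hmT : m < (cont T).length := by omega
    refine ⟨(b', some (cont T)[m]), trivial, rfl, ?_⟩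
    refine (Out.det_seq (t' := 6) (out_low (z := i) ?_) (out_ifSome (t := 5) (fun _ => Out.det_seq
      (t' := 4) (out_low (z := j) ?_) (out_ifSome (t := 3) (fun _ => (Out.det_seq
      (out_bwd_succ (k := pos i - (m + 1)) ?_ hlt) (Out.det_seq
        (out_bwd_succ (k := pos j - (m + 1)) ?_ hlt') (out_fwd_lt (z := T) ?_))).congr ?_)
      (fun h => ?_))) (fun h => ?_))).mono (by omega)
    · rw [hSi]
      omega
    · rw [hSj]
      omega
    · rw [hSi]
      omega
    · rw [update_of_ne hij.symm, hSj]
      omega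
    · rw [update_of_ne hjT.symm, update_of_ne hiT.symm, hST]
      omega
    · change [st _ _ _ _] = [st _ _ _ _]
      congr 2
      · simp [hiT.symm, hjT.symm, hST]
      · apply hSe
        · simp [hij, hiT]
        · simp [hjT]
        · simp [hiT.symm, hjT.symm, hST]
        · intro z h1 h2 h3
          simp [h1, h2, h3, hSo]
    · rw [hSj, if_neg (by omega)] at h
      rw [List.getElem?_eq_none_iff] at h
      omega
    · rw [hSi, if_neg (by omega)] at h
      rw [List.getElem?_eq_none_iff] at h
      omega
  · rintro ⟨b', c⟩ -
    refine (Out.det_seq (t' := 6) (out_low (z := i) ?_) (out_ifSome (t := 5) (fun h => Out.det_seq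
      (t' := 4) (out_low (z := j) ?_) (out_ifSome (t := 3) (fun h' => ?_)
      (fun h' => out_load.mono (by omega) |>.congr ?_))) (fun h => (Out.det_seq (out_low (z := j) ?_)
      out_load).mono (by omega) |>.congr ?_))).mono (by omega)
    · rw [hSi]
      omega
    · rw [hSj]
      omega
    · rw [hSi] at h
      rw [hSj] at h'
      have h1 : pos i - n ≠ 0 := fun h0 => by simp [h0] at h
      have h2 : pos j - n ≠ 0 := fun h0 => by simp [h0] at h'
      omega
    · rw [hSi] at h
      have h1 : pos i - n ≠ 0 := fun h0 => by simp [h0] at h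
      congr 2
      simp
      omega
    · rw [hSj]
      omega
    · rw [hSi] at h
      have h1 : pos i - n = 0 := by
        by_contra h0
        rw [if_neg h0, List.getElem?_eq_none_iff] at h
        omega
      congr 2
      rw [hSj]
      split_ifs with h2
      · simp
        omega
      · have : pos j - n - 1 < (cont j).length := by omega
        simp [this]
        omega

end Counters

end LassoDensity

namespace LassoDensity

open Turing Function

/-! ### First-order formulas and their evaluation -/

section Formulas

/-- First-order formulas with variables `V` over a word with letters `I`, the order of its
positions, and relation symbols `a : G` of arity `ar a`. -/
inductive Fml (I V G : Type) (ar : G → ℕ) : Type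
  | lt (i j : V) : Fml I V G ar
  | sym (i : V) (a : I) : Fml I V G ar
  | rel (a : G) (v : Fin (ar a) → V) : Fml I V G ar
  | neg (φ : Fml I V G ar) : Fml I V G ar
  | and (φ ψ : Fml I V G ar) : Fml I V G ar
  | ex (v : V) (φ : Fml I V G ar) : Fml I V G ar

/-- Interpretations of the relation symbols over `{0, …, L}`. -/
abbrev Tables (G : Type) (ar : G → ℕ) (L : ℕ) : Type := ∀ a : G, Set (Fin (ar a) → Fin (L + 1))

variable {I V G : Type} {ar : G → ℕ}

/-- The heads of the machine that evaluates formulas: heads on the input for the variables and for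
auxiliary counters, and one head for each table. -/
abbrev Head (V G : Type) (r : ℕ) : Type := (V ⊕ Fin (r + 1) ⊕ Unit) ⊕ G

namespace Head

variable {r : ℕ}

/-- The head for a variable. -/
def var (v : V) : Head V G r := .inl (.inl v)

/-- The auxiliary counters that are used to move the heads on the tables. -/
def odo (k : ℕ) : Head V G r := .inl (.inr (.inl (Fin.ofNat (r + 1) k)))

/-- An auxiliary counter, and the head that scans the input at the beginning. -/
def tmp : Head V G r := .inl (.inr (.inr ()))

/-- The head for a table. -/
def tab (a : G) : Head V G r := .inr a

end Head

variable {r : ℕ}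

theorem odo_ne {i j : ℕ} (hij : i < j) (hj : j ≤ r) : (Head.odo i : Head V G r) ≠ Head.odo j := by
  simp only [Head.odo, ne_eq, Sum.inl.injEq, Sum.inr.injEq, Fin.ext_iff, Fin.val_ofNat]
  rw [Nat.mod_eq_of_lt (by omega), Nat.mod_eq_of_lt (by omega)]
  omega

/-- The words under the heads: the input `x`, and the tables `W`. -/
def contOf (x : List I) (W : G → List Bool) : Head V G r → List (I ⊕ Bool) :=
  Sum.elim (fun _ => x.map .inl) fun a => (W a).map .inr

/-- The positions of the heads when the variables have the values `ρ`. -/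
def posOf (ρ : V → ℕ) : Head V G r → ℕ := Sum.elim (Sum.elim ρ fun _ => 0) fun _ => 0

theorem contOf_inl (x : List I) (W : G → List Bool) (z : V ⊕ Fin (r + 1) ⊕ Unit) :
    (contOf x W : Head V G r → _) (.inl z) = x.map .inl := rfl

theorem length_contOf_var (x : List I) (W : G → List Bool) (v : V) :
    ((contOf x W : Head V G r → _) (Head.var v)).length = x.length := List.length_map _

theorem length_contOf_tab (x : List I) (W : G → List Bool) (a : G) :
    ((contOf x W : Head V G r → _) (Head.tab a)).length = (W a).length := List.length_map _

theorem posOf_var (ρ : V → ℕ) (v : V) : (posOf ρ : Head V G r → ℕ) (Head.var v) = ρ v := rfl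

theorem st_congr {Z A : Type} {b b' : Bool} {c : Option A} {cont : Z → List A} {pos : Z → ℕ}
    (h : b = true ↔ b' = true) : [st b c cont pos] = [st b' c cont pos] := by
  rw [Bool.eq_iff_iff.2 h]

variable [DecidableEq V]

namespace Fml

/-- The truth value of a formula. The variables range over the positions of the word `x`, including
the position `|x|` behind the last letter. -/
def eval (x : List I) (T : Tables G ar x.length) : Fml I V G ar → (V → Fin (x.length + 1)) → Prop
  | lt i j, ρ => ρ i < ρ j
  | sym i a, ρ => x[(ρ i : ℕ)]? = some a
  | rel a v, ρ => (fun i => ρ (v i)) ∈ T a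
  | neg φ, ρ => ¬ eval x T φ ρ
  | and φ ψ, ρ => eval x T φ ρ ∧ eval x T ψ ρ
  | ex v φ, ρ => ∃ a, eval x T φ (update ρ v a)

/-- No quantifier binds one of the variables in `S`, or a variable that is bound by a quantifier
around it. -/
def WF : List V → Fml I V G ar → Bool
  | _, lt _ _ => true
  | _, sym _ _ => true
  | _, rel _ _ => true
  | S, neg φ => WF S φ
  | S, and φ ψ => WF S φ && WF S ψ
  | S, ex v φ => !S.contains v && WF (v :: S) φ

end Fml

open HProg

variable [DecidableEq G]

/-- The tables that are described by lists of truth values. -/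
def tablesOf (L : ℕ) (W : G → List Bool) : Tables G ar L := fun a =>
  {v | (W a)[(finFunctionFinEquiv v : ℕ)]? = some true}

instance : Inhabited (I ⊕ Bool) := ⟨.inr false⟩

open Classical in
/-- A program that evaluates a formula. -/
noncomputable def Fml.prog (r : ℕ) : Fml I V G ar → HProg (Head V G r) (I ⊕ Bool)
  | lt i j => if i = j then load fun _ => (false, none) else less Head.tmp (Head.var i) (Head.var j)
  | sym i a => .seq (read (Head.var i)) (load fun s => (decide (s.2 = some (.inl a)), none))
  | rel a v => .seq ((List.finRange (ar a)).foldr (fun j p =>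
        .seq (timesAdv Head.tmp (Head.tab a) Head.odo (Head.var (v j)) j) p) clear)
      (.seq (read (Head.tab a)) (.seq (load fun s => (decide (s.2 = some (.inr true)), none))
        (rewind (Head.tab a))))
  | neg φ => .seq (prog r φ) (load fun s => (!s.1, s.2))
  | and φ ψ => .seq (prog r φ) (.ite (fun s => s.1) (prog r ψ) clear)
  | ex v φ => .seq (loop (.seq (prog r φ) (.ite (fun s => s.1) clear (fwd (Head.var v)))))
      (rewind (Head.var v))

/-- A bound for the running time of `Fml.prog` on words of length `L`. -/
def Fml.time (L : ℕ) : Fml I V G ar → ℕ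
  | lt _ _ => lessTime L
  | sym _ _ => 2
  | rel a _ => ((List.finRange (ar a)).map fun j : Fin (ar a) => timesTime L (j : ℕ)).sum + 1 +
      (2 + ((L + 1) ^ ar a + 1) * 2)
  | neg φ => time L φ + 1
  | and φ ψ => time L φ + (time L ψ + 2)
  | ex _ φ => (L + 1) * (time L φ + 3) + (L + 1) * 2

theorem update_posOf (ρ : V → ℕ) (v : V) (n : ℕ) :
    update (posOf ρ : Head V G r → ℕ) (Head.var v) n = posOf (update ρ v n) := by
  unfold posOf Head.var
  rw [Sum.update_elim_inl, Sum.update_elim_inl]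

variable {x : List I} {W : G → List Bool}

/-- The moves of the head on the table `a` add up to the number of the tuple of arguments, as
`finFunctionFinEquiv` numbers tuples in base `|x| + 1`. -/
theorem out_timesAdv_foldr {a : G} {v : Fin (ar a) → V} (ha : ar a ≤ r) (ρ : V → ℕ)
    (hρ : ∀ v, ρ v ≤ x.length) (js : List (Fin (ar a))) (b : Bool) (c : Option (I ⊕ Bool)) (o : ℕ)
    (ho : o ≤ (W a).length) :
    Out (js.foldr (fun j p =>
        .seq (timesAdv Head.tmp (Head.tab a) Head.odo (Head.var (v j)) j) p) clear)
      (st b c (contOf x W : Head V G r → _) (update (posOf ρ) (Head.tab a) o))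
      [st b none (contOf x W) (update (posOf ρ) (Head.tab a)
        (min (o + (js.map fun j => ρ (v j) * (x.length + 1) ^ (j : ℕ)).sum) (W a).length))]
      ((js.map fun j : Fin (ar a) => timesTime x.length (j : ℕ)).sum + 1) := by
  induction js generalizing b c o with
  | nil =>
    simp only [List.foldr_nil, List.map_nil, List.sum_nil, add_zero, min_eq_left ho]
    exact out_clear
  | cons j js ih =>
    have h1 := out_timesAdv (b := b) (c := c) (cont := (contOf x W : Head V G r → _))
      (pos := update (posOf ρ) (Head.tab a) o) (T := Head.tmp) (g := Head.tab a)
      (i := Head.var (v j)) (Y := Head.odo) (L := x.length) j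
      (by simp [contOf, Head.odo]) (by simp [contOf, Head.var]) (by simp [contOf, Head.tmp])
      (by simp [Head.odo, Head.tab]) (fun j' hj' i hi => odo_ne hi (by omega))
      (by simp [Head.odo, Head.tmp]) (by simp [Head.odo, Head.var]) (by simp [Head.tab, Head.tmp])
      (by simp [Head.var, Head.tab]) (by simp [Head.var, Head.tmp])
      (by simp [Head.odo, Head.tab, posOf]) (by simp [Head.tmp, Head.tab, posOf])
      (by simp [Head.var, Head.tab, posOf, hρ]) (by simpa [contOf, Head.tab] using ho)
    have e1 : (contOf x W (Head.tab a : Head V G r)).length = (W a).length := by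
      simp [contOf, Head.tab]
    have e2 : update (posOf ρ) (Head.tab a) o (Head.var (v j) : Head V G r) = ρ (v j) := by
      simp [Head.var, Head.tab, posOf]
    rw [e1, e2, update_idem, update_self] at h1
    refine (h1.det_seq (ih b none _ (min_le_right _ _))).mono ?_ |>.congr ?_
    · simp only [List.map_cons, List.sum_cons]
      omega
    · have : ∀ m k n l : ℕ, min (min (m + k) l + n) l = min (m + (k + n)) l := by omega
      rw [List.map_cons, List.sum_cons, this]

open Classical in
/-- The program computes the truth value of the formula and returns all heads to their positions. A
quantifier moves the head of its variable from the start of the input until the formula under it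
holds or the end is reached; so the heads of the variables outside `S`, which may be bound later,
have to be at the start. -/
theorem Fml.out_prog (hr : ∀ a, ar a ≤ r) (hW : ∀ a, (W a).length = (x.length + 1) ^ ar a)
    (φ : Fml I V G ar) (S : List V) (hS : φ.WF S = true) (ρ : V → Fin (x.length + 1))
    (hρ : ∀ v ∉ S, ρ v = 0) (b : Bool) (c : Option (I ⊕ Bool)) :
    Out (φ.prog r) (st b c (contOf x W) (posOf fun v => (ρ v : ℕ)))
      [st (decide (φ.eval x (tablesOf x.length W) ρ)) none (contOf x W) (posOf fun v => (ρ v : ℕ))]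
      (φ.time x.length) := by
  induction φ generalizing S ρ b c with
  | lt i j =>
    rw [prog]
    split_ifs with hij
    · refine (out_load.mono (by rw [time, lessTime]; omega)).congr ?_
      simp [eval, hij]
    · refine (out_less (L := x.length) (by simp [contOf, Head.var]) (by simp [contOf, Head.var])
        (by simp [contOf, Head.tmp]) (by simpa [Head.var] using hij) (by simp [Head.var, Head.tmp])
        (by simp [Head.var, Head.tmp]) (by simp [Head.tmp, posOf]) ?_ ?_).congr ?_
      · simp only [Head.var, posOf, Sum.elim_inl]
        omega
      · simp only [Head.var, posOf, Sum.elim_inl]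
        omega
      · refine st_congr ?_
        rw [decide_eq_true_iff, decide_eq_true_iff]
        rfl
  | sym i a =>
    refine (Out.det_seq out_read out_load).congr ?_
    refine st_congr ?_
    rw [decide_eq_true_iff, decide_eq_true_iff, posOf_var, eval]
    change (x.map Sum.inl)[(ρ i : ℕ)]? = _ ↔ _
    rw [List.getElem?_map]
    cases x[(ρ i : ℕ)]? <;> simp
  | rel a v =>
    have h1 := out_timesAdv_foldr (W := W) (v := v) (hr a) (fun v => (ρ v : ℕ))
      (fun v => Nat.le_of_lt_succ (ρ v).2) (List.finRange (ar a)) b c 0 (by omega)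
    have e0 : update (posOf fun v => (ρ v : ℕ)) (Head.tab a : Head V G r) 0 =
        posOf fun v => (ρ v : ℕ) := update_eq_self_iff.2 rfl
    have e1 : (contOf x W (Head.tab a : Head V G r)).length = (W a).length := by
      simp [contOf, Head.tab]
    rw [e0, zero_add, ← Fin.sum_univ_def] at h1
    have e2 : ∑ j : Fin (ar a), (ρ (v j) : ℕ) * (x.length + 1) ^ (j : ℕ) =
        finFunctionFinEquiv fun j => ρ (v j) := by
      rw [finFunctionFinEquiv_apply]
    have hlt := (finFunctionFinEquiv fun j => ρ (v j)).2
    rw [e2, hW, min_eq_left hlt.le] at h1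
    rw [time, prog]
    refine (h1.det_seq (Out.det_seq out_read (Out.det_seq out_load (out_rewind ?_)))).mono ?_
      |>.congr ?_
    · rw [update_self, e1, hW]
      exact hlt.le
    · rw [e1, hW]
      omega
    · rw [update_idem, e0]
      refine st_congr ?_
      rw [decide_eq_true_iff, decide_eq_true_iff, update_self, eval]
      change ((W a).map Sum.inr)[_]? = _ ↔ (W a)[_]? = _
      rw [List.getElem?_map]
      cases (W a)[((finFunctionFinEquiv fun j => ρ (v j) : Fin _) : ℕ)]? <;> simp
  | neg φ ih =>
    refine ((ih S hS ρ hρ b c).det_seq out_load).congr (st_congr ?_)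
    rw [decide_eq_true_iff, eval]
    simp
  | and φ ψ ih ih' =>
    rw [WF, Bool.and_eq_true] at hS
    refine (ih S hS.1 ρ hρ b c).det_seq (Out.ite (fun h => ?_) fun h => ?_) |>.congr rfl
    · refine ((ih' S hS.2 ρ hρ _ none).mono (by omega)).congr ?_
      have h : φ.eval x (tablesOf x.length W) ρ := by simpa [st] using h
      simp [eval, h]
    · refine (out_clear.mono (by omega)).congr ?_
      have h : ¬ φ.eval x (tablesOf x.length W) ρ := by simpa [st] using h
      simp [eval, h]
  | ex v φ ih =>
    have hS : v ∉ S ∧ φ.WF (v :: S) = true := by simpa [WF] using hS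
    have hv := hρ v hS.1
    set P : ℕ → Prop := fun a => ∃ h : a < x.length + 1,
      φ.eval x (tablesOf x.length W) (update ρ v ⟨a, h⟩) with hP
    have hex : ∃ n, P n ∨ n = x.length := ⟨_, Or.inr rfl⟩
    set n := Nat.find hex with hn
    have hn1 : P n ∨ n = x.length := Nat.find_spec hex
    have hn2 : ∀ m < n, ¬ P m ∧ m ≠ x.length := fun m hm => by
      simpa [not_or] using Nat.find_min hex hm
    have hn3 : n ≤ x.length := Nat.find_min' hex (Or.inr rfl)
    have hiff : (ex v φ).eval x (tablesOf x.length W) ρ ↔ P n := by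
      constructor
      · rintro ⟨a, ha⟩
        rcases hn1 with h | h
        · exact h
        · by_cases han : (a : ℕ) < n
          · exact absurd ⟨a.2, ha⟩ (hn2 a han).1
          · have : (a : ℕ) = n := by omega
            exact this ▸ ⟨a.2, ha⟩
      · rintro ⟨h, ha⟩
        exact ⟨_, ha⟩
    have body : ∀ i (hi : i < x.length + 1), ∀ x', Out (φ.prog r) (x', zip (contOf x W)
        (posOf (update (fun v => (ρ v : ℕ)) v i))) [st (decide (P i)) none (contOf x W)
          (posOf (update (fun v => (ρ v : ℕ)) v i))] (φ.time x.length) := by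
      rintro i hi ⟨b, c⟩
      have := ih (v :: S) hS.2 (update ρ v ⟨i, hi⟩) (fun w hw => by
        rw [List.mem_cons, not_or] at hw
        rw [update_of_ne hw.1, hρ w hw.2]) b c
      have e : (fun w => ((update ρ v ⟨i, hi⟩) w : ℕ)) = update (fun v => (ρ v : ℕ)) v i := by
        funext w
        by_cases h : w = v
        · rw [h, update_self, update_self]
        · rw [update_of_ne h, update_of_ne h]
      rw [e] at this
      refine this.congr (st_congr ?_)
      simp only [hP, decide_eq_true_iff, hi, exists_true_left]
    have hl := out_loop (p := .seq (φ.prog r) (.ite (fun s => s.1) clear (fwd (Head.var v))))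
      (t := φ.time x.length + 2) (I := fun _ => True)
      (e := st (decide (P n)) none (contOf x W) (posOf (update (fun v => (ρ v : ℕ)) v n))) rfl n
      (fun i => zip (contOf x W) (posOf (update (fun v => (ρ v : ℕ)) v i))) ?_ ?_ (b, c) trivial
    · have e0 : update (fun v => (ρ v : ℕ)) v 0 = fun v => (ρ v : ℕ) := by
        rw [update_eq_self_iff, hv]
        rfl
      rw [e0] at hl
      rw [prog, time]
      refine (hl.det_seq (out_rewind ?_)).mono ?_ |>.congr ?_
      · rw [posOf_var, update_self, length_contOf_var]
        exact hn3
      · rw [length_contOf_var]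
        gcongr
      · rw [update_posOf, update_idem, e0]
        simp only [hiff]
    · rintro i hi x' -
      have hlt : i < (contOf x W (Head.var v : Head V G r)).length := by
        rw [length_contOf_var]
        omega
      refine ⟨(false, some (contOf x W (Head.var v : Head V G r))[i]), trivial, rfl,
        (body i (by omega) x').det_seq (Out.ite (fun h => ?_) fun _ => ?_)⟩
      · exact absurd (by simpa [st] using h) (hn2 i hi).1
      · refine (out_fwd_lt ?_).congr ?_
        · rwa [posOf_var, update_self]
        · simp only [update_posOf, update_idem, posOf_var, update_self]
          simp [st, (hn2 i hi).1]
    · rintro x' -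
      refine (body n (by omega) x').det_seq (Out.ite (fun h => out_clear) fun h => ?_)
      have hPn : ¬ P n := by simpa [st] using h
      have hnL : n = x.length := hn1.resolve_left hPn
      refine (out_fwd ?_).congr ?_
      · rw [posOf_var, update_self, length_contOf_var]
        exact hn3
      · rw [update_posOf, posOf_var, update_idem, update_self, length_contOf_var,
          List.getElem?_eq_none (by rw [length_contOf_var, hnL]), min_eq_right (by omega), hnL]

end Formulas

end LassoDensity

namespace LassoDensity

open Turing Function

/-! ### Lists of guessed words -/

section Words

/-- All lists of truth values of length `n`. -/
def words : ℕ → List (List Bool)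
  | 0 => [[]]
  | n + 1 => (words n).flatMap fun w => [w ++ [false], w ++ [true]]

/-- The words of length `m + n` are listed as concatenations, in the order in which they are
guessed. -/
theorem words_add (m n : ℕ) :
    words (m + n) = (words m).flatMap fun w => (words n).map fun w' => w ++ w' := by
  induction n with
  | zero => simp [words]
  | succ n ih =>
    rw [← add_assoc, words, ih, words]
    simp [List.flatMap_assoc, List.map_flatMap, List.flatMap_map]

theorem mem_words {n : ℕ} {w : List Bool} : w ∈ words n ↔ w.length = n := by
  induction n generalizing w with
  | zero => simp [words]
  | succ n ih =>
    simp only [words, List.mem_flatMap, ih]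
    constructor
    · rintro ⟨v, rfl, hw⟩
      simp only [List.mem_cons, List.not_mem_nil, or_false] at hw
      rcases hw with rfl | rfl <;> simp
    · intro h
      have hne : w ≠ [] := by rintro rfl; simp at h
      refine ⟨w.dropLast, by simp [h], ?_⟩
      have := List.dropLast_append_getLast hne
      cases hb : w.getLast hne <;> rw [hb] at this <;> simp [this]

theorem nodup_words (n : ℕ) : (words n).Nodup := by
  induction n with
  | zero => simp [words]
  | succ n ih =>
    rw [words, List.nodup_flatMap]
    refine ⟨fun w _ => by simp, ih.imp fun {a b} hab => ?_⟩
    simp [onFun, List.disjoint_left, hab]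

variable {G : Type} [DecidableEq G]

/-- All families of lists of truth values that agree with `W` outside the list `as` and consist of
lists of length `n a` for `a` in `as`. -/
def families (n : G → ℕ) : List G → (G → List Bool) → List (G → List Bool)
  | [], W => [W]
  | a :: as, W => (words (n a)).flatMap fun w => families n as (update W a w)

theorem mem_families {n : G → ℕ} {as : List G} (ha : as.Nodup) {W W' : G → List Bool} :
    W' ∈ families n as W ↔ (∀ a ∈ as, (W' a).length = n a) ∧ ∀ a ∉ as, W' a = W a := by
  induction as generalizing W with
  | nil => simp [families, funext_iff]
  | cons a as ih =>
    obtain ⟨h1, h2⟩ := List.nodup_cons.1 ha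
    simp only [families, List.mem_flatMap, ih h2, mem_words]
    constructor
    · rintro ⟨w, hw, h3, h4⟩
      have ha' : W' a = w := by rw [h4 a h1, update_self]
      refine ⟨?_, fun b hb => ?_⟩
      · simp only [List.mem_cons, forall_eq_or_imp]
        exact ⟨by rw [ha', hw], h3⟩
      · rw [List.mem_cons, not_or] at hb
        rw [h4 b hb.2, update_of_ne hb.1]
    · rintro ⟨h3, h4⟩
      refine ⟨W' a, h3 a (by simp), fun b hb => h3 b (by simp [hb]), fun b hb => ?_⟩
      by_cases hba : b = a
      · rw [hba, update_self]
      · rw [update_of_ne hba, h4 b (by simp [hba, hb])]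

theorem nodup_families {n : G → ℕ} {as : List G} (ha : as.Nodup) (W : G → List Bool) :
    (families n as W).Nodup := by
  induction as generalizing W with
  | nil => simp [families]
  | cons a as ih =>
    obtain ⟨h1, h2⟩ := List.nodup_cons.1 ha
    rw [families, List.nodup_flatMap]
    refine ⟨fun w _ => ih h2 _, (nodup_words _).imp fun {v w} hvw => ?_⟩
    rw [onFun, List.disjoint_left]
    intro W' h3 h4
    have e3 := ((mem_families h2).1 h3).2 a h1
    have e4 := ((mem_families h2).1 h4).2 a h1
    rw [update_self] at e3 e4
    exact hvw (e3.symm.trans e4)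

end Words

/-! ### Guessing a word of polynomial length -/

section Guessing

variable {Z : Type} [DecidableEq Z] {I : Type}

namespace HProg

/-- Append a guessed truth value to the word under the head `g`, which is at its end. -/
def guessBit (g : Z) : HProg Z (I ⊕ Bool) :=
  .act [.push (g, false) (fun _ => .inr false) (.goto fun _ => ()),
    .push (g, false) (fun _ => .inr true) (.goto fun _ => ())]

/-- Append `(L + 1) ^ k` guessed truth values to the word under the head `g`, where `L` is the length
of the words under the heads `Y 0, …, Y (k - 1)`. -/
def guess (g : Z) (Y : ℕ → Z) : ℕ → HProg Z (I ⊕ Bool)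
  | 0 => .seq (guessBit g) clear
  | k + 1 => .seq (loop (.seq (guess g Y k) (fwd (Y k)))) (rewind (Y k))

end HProg

open HProg

/-- The store in which the word `w` has been guessed under the head `g`. -/
def gst (c : Option (I ⊕ Bool)) (cont : Z → List (I ⊕ Bool)) (pos : Z → ℕ) (b : Bool) (g : Z)
    (w : List Bool) : HStore Z (I ⊕ Bool) :=
  st b c (update cont g (w.map .inr)) (update pos g w.length)

variable {b : Bool} {c : Option (I ⊕ Bool)} {cont : Z → List (I ⊕ Bool)} {pos : Z → ℕ}

/-- Pushing a letter onto the left stack of a head at the end of its word appends it to the word. -/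
theorem exec_push (g : Z) (w : List Bool) (d : Bool) :
    exec (.push (g, false) (fun _ => .inr d) (.goto fun _ => ())) (gst c cont pos b g w) =
      gst c cont pos b g (w ++ [d]) := by
  unfold exec gst
  simp only [st, TM2.stepAux]
  refine Prod.ext rfl ?_
  ext1 ⟨z, e⟩
  by_cases hz : z = g
  · subst hz
    have h1 : (w.map Sum.inr ++ [(.inr d : I ⊕ Bool)]).take (w.length + 1) =
        w.map Sum.inr ++ [.inr d] := List.take_of_length_le (by simp)
    have h2 : (w.map (Sum.inr : Bool → I ⊕ Bool)).take w.length = w.map Sum.inr :=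
      List.take_of_length_le (by simp)
    cases e
    · simp [zip, h1, h2]
    · simp [zip, List.drop_eq_nil_of_le]
  · simp [zip, hz]

theorem out_guessBit (g : Z) (w : List Bool) :
    Out (guessBit g) (gst c cont pos b g w)
      ([[false], [true]].map fun w' => gst c cont pos b g (w ++ w')) 1 := by
  have := Out.act (s := gst c cont pos b g w) (qs := [.push (g, false) (fun _ => .inr false)
    (.goto fun _ => ()), .push (g, false) (fun _ => .inr true) (.goto fun _ => ())])
    (by simp [NoHalt]) ?_
  · simp only [List.map_cons, List.map_nil, exec_push] at this
    exact this
  · simp only [List.map_cons, List.map_nil, exec_push]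
    simp only [List.nodup_cons, List.mem_singleton, List.not_mem_nil, not_false_eq_true,
      List.nodup_nil, and_true]
    intro h
    have h1 := congrFun (congrArg Prod.snd h) (g, false)
    have h3 (d : Bool) : (w.map Sum.inr ++ [(.inr d : I ⊕ Bool)]).take (w.length + 1) =
        w.map Sum.inr ++ [.inr d] := List.take_of_length_le (by simp)
    simp [gst, st, zip, h3] at h1

/-- The executions of `guess` correspond to the words of length `(L + 1) ^ k`. -/
theorem out_guess {g : Z} {Y : ℕ → Z} {L : ℕ} (k : ℕ) (hL : ∀ j < k, (cont (Y j)).length = L)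
    (hg : ∀ j < k, Y j ≠ g) (hY : ∀ j < k, ∀ i < j, Y i ≠ Y j) (b : Bool) (c : Option (I ⊕ Bool))
    (pos : Z → ℕ) (h0 : ∀ j < k, pos (Y j) = 0) (w : List Bool) :
    Out (guess g Y k) (gst c cont pos b g w)
      ((words ((L + 1) ^ k)).map fun w' => gst none cont pos b g (w ++ w')) (advTime L k) := by
  induction k generalizing b c pos w with
  | zero =>
    have := Out.seq (q := clear) (t' := 1) (H := fun w' => [gst none cont pos b g (w ++ w')])
      (out_guessBit (b := b) (c := c) (cont := cont) (pos := pos) g w) (fun w' _ => out_clear)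
    simpa [words, guess, advTime] using this
  | succ k ih =>
    have ih := ih (fun j hj => hL j (by omega)) (fun j hj => hg j (by omega))
      (fun j hj => hY j (by omega))
    have hgk := hg k (by omega)
    have hLk := hL k (by omega)
    have h0k := h0 k (by omega)
    have hYk := hY k (by omega)
    set M := (L + 1) ^ k with hM
    have body : ∀ i ≤ L, ∀ b c w, Out (.seq (guess g Y k) (fwd (Y k)))
        (gst c cont (update pos (Y k) i) b g w)
        ((words M).map fun w' => gst (cont (Y k))[i]? cont (update pos (Y k) (min (i + 1) L)) b g
          (w ++ w')) (advTime L k + 1) := by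
      intro i hi b c w
      have := Out.seq (q := fwd (Y k)) (t' := 1)
        (H := fun w' => [gst (cont (Y k))[i]? cont (update pos (Y k) (min (i + 1) L)) b g (w ++ w')])
        (ih b c (update pos (Y k) i) (fun j hj => by rw [update_of_ne (hYk j hj), h0 j (by omega)]) w)
        (fun w' _ => ?_)
      · rwa [← List.map_eq_flatMap] at this
      · refine (out_fwd ?_).congr ?_
        · simp [hgk, hLk, hi]
        · simp only [update_of_ne hgk, update_self]
          rw [update_comm hgk.symm, update_idem, hLk]
          rfl
    have main : ∀ d ≤ L, ∀ b c w, Out (loop (.seq (guess g Y k) (fwd (Y k))))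
        (gst c cont (update pos (Y k) (L - d)) b g w)
        ((words ((d + 1) * M)).map fun w' => gst none cont (update pos (Y k) L) b g (w ++ w'))
        ((d + 1) * (advTime L k + 2)) := by
      intro d
      induction d with
      | zero =>
        intro _ b c w
        have h1 := body L le_rfl b c w
        rw [min_eq_right (by omega : L ≤ L + 1), List.getElem?_eq_none hLk.le] at h1
        have := Out.rep (c := fun s => s.2.isSome) (t' := 0) (H := fun w' =>
          [gst none cont (update pos (Y k) L) b g (w ++ w')]) h1 (fun _ _ _ => rfl)
          (fun _ _ h => by cases h)
        rw [Nat.sub_zero, zero_add, one_mul, one_mul]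
        rw [← List.map_eq_flatMap] at this
        exact this
      | succ d ihd =>
        intro hd b c w
        have h1 := body (L - (d + 1)) (by omega) b c w
        have hlt : L - (d + 1) < (cont (Y k)).length := by omega
        have e : min (L - (d + 1) + 1) L = L - d := by omega
        rw [e, List.getElem?_eq_getElem hlt] at h1
        have := Out.rep (c := fun s => s.2.isSome) (t' := (d + 1) * (advTime L k + 2))
          (H := fun w' => (words ((d + 1) * M)).map fun w'' =>
            gst none cont (update pos (Y k) L) b g (w ++ w' ++ w'')) h1 (fun _ _ h => by cases h)
          (fun w' _ _ => ihd (by omega) b _ (w ++ w'))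
        refine (this.mono (by ring_nf; omega)).congr ?_
        have e' : (d + 1 + 1) * M = M + (d + 1) * M := by ring
        rw [e', words_add, List.map_flatMap]
        simp [Function.comp_def]
    have hm := main L le_rfl b c w
    rw [Nat.sub_self, ← h0k, update_eq_self] at hm
    have := Out.seq (q := rewind (Y k)) (t' := (L + 1) * 2)
        (H := fun w' => [gst none cont pos b g (w ++ w')]) hm (fun w' _ => ?_)
    · rw [← List.map_eq_flatMap] at this
      refine this.congr ?_
      rw [pow_succ']
    · refine (out_rewind ?_).mono ?_ |>.congr ?_
      · simp [hgk, hLk]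
      · simp [hgk, hLk]
      · rw [update_comm hgk.symm, update_idem, ← h0k, update_eq_self]
        rfl

end Guessing

end LassoDensity

namespace LassoDensity

open Turing Function

/-! ### Polynomial time bounds -/

section PolynomialBounds

/-- The function `f` is bounded by a polynomial. -/
def PolyBounded (f : ℕ → ℕ) : Prop := ∃ p : Polynomial ℕ, ∀ n, f n ≤ p.eval n

namespace PolyBounded

variable {f g : ℕ → ℕ}

theorem const (c : ℕ) : PolyBounded fun _ => c := ⟨.C c, by simp⟩

theorem id : PolyBounded fun n => n := ⟨.X, by simp⟩

theorem add (hf : PolyBounded f) (hg : PolyBounded g) : PolyBounded fun n => f n + g n := by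
  obtain ⟨p, hp⟩ := hf
  obtain ⟨q, hq⟩ := hg
  exact ⟨p + q, fun n => by simpa using add_le_add (hp n) (hq n)⟩

theorem mul (hf : PolyBounded f) (hg : PolyBounded g) : PolyBounded fun n => f n * g n := by
  obtain ⟨p, hp⟩ := hf
  obtain ⟨q, hq⟩ := hg
  exact ⟨p * q, fun n => by simpa using Nat.mul_le_mul (hp n) (hq n)⟩

theorem pow (hf : PolyBounded f) (k : ℕ) : PolyBounded fun n => f n ^ k := by
  obtain ⟨p, hp⟩ := hf
  exact ⟨p ^ k, fun n => by simpa using Nat.pow_le_pow_left (hp n) k⟩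

theorem succ : PolyBounded fun n => n + 1 := id.add (const 1)

theorem list_sum {α : Type} (l : List α) (f : α → ℕ → ℕ) (h : ∀ a, PolyBounded (f a)) :
    PolyBounded fun n => (l.map fun a => f a n).sum := by
  induction l with
  | nil => exact const 0
  | cons a l ih => simpa using (h a).add ih

theorem advTime (k : ℕ) : PolyBounded fun L => HProg.advTime L k := by
  induction k with
  | zero => exact const 2
  | succ k ih => exact (succ.mul (ih.add (const 2))).add (succ.mul (const 2))

theorem timesTime (k : ℕ) : PolyBounded fun L => HProg.timesTime L k :=
  (succ.mul ((advTime k).add (const 5))).add (succ.mul (const 5))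

theorem fmlTime {I V G : Type} {ar : G → ℕ} (φ : Fml I V G ar) :
    PolyBounded fun L => φ.time L := by
  induction φ with
  | lt => exact (succ.mul (const 9)).add (succ.mul (const 6))
  | sym => exact const 2
  | rel a =>
    exact ((list_sum _ (fun (j : Fin (ar a)) L => HProg.timesTime L j) fun j =>
      timesTime j).add (const 1)).add
      ((const 2).add (((succ.pow _).add (const 1)).mul (const 2)))
  | neg φ ih => exact ih.add (const 1)
  | and φ ψ ih ih' => exact ih.add (ih'.add (const 2))
  | ex v φ ih => exact (succ.mul (ih.add (const 3))).add (succ.mul (const 2))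

end PolyBounded

end PolynomialBounds

/-! ### Counting the tables that satisfy a first-order sentence -/

section Machine

variable {I V G : Type} {ar : G → ℕ} {r : ℕ}

namespace HProg

/-- The statement that appends the letter read last to the words of all heads in the list `hs`. -/
def copyStmt (hs : List (V ⊕ Fin (r + 1) ⊕ Unit)) :
    TM2.Stmt (fun _ : Head V G r × Bool => I ⊕ Bool) Unit (Bool × Option (I ⊕ Bool)) :=
  hs.foldr (fun h q => .push (.inl h, false) (fun s => s.2.getD default) q) (.goto fun _ => ())

end HProg

open HProg

theorem noHalt_copyStmt (hs : List (V ⊕ Fin (r + 1) ⊕ Unit)) :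
    NoHalt (copyStmt hs : TM2.Stmt (fun _ : Head V G r × Bool => I ⊕ Bool) Unit _) := by
  induction hs with
  | nil => trivial
  | cons h hs ih => exact ih

/-- Each family of relations is described by exactly one family of lists of the right lengths. -/
theorem tablesOf_bijOn (ar : G → ℕ) (L : ℕ) :
    Set.BijOn (tablesOf (ar := ar) L) {W | ∀ a, (W a).length = (L + 1) ^ ar a} Set.univ := by
  classical
  refine ⟨fun _ _ => trivial, ?_, ?_⟩
  · intro W hW W' hW' h
    funext a
    refine List.ext_getElem ((hW a).trans (hW' a).symm) fun i h1 h2 => ?_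
    have hi : i < (L + 1) ^ ar a := hW a ▸ h1
    have := congrFun h a
    have := Set.ext_iff.1 this (finFunctionFinEquiv.symm ⟨i, hi⟩)
    simp only [tablesOf, Set.mem_ofPred_eq, Equiv.apply_symm_apply, List.getElem?_eq_getElem h1,
      List.getElem?_eq_getElem h2, Option.some.injEq] at this
    exact Bool.eq_iff_iff.2 this
  · intro T _
    refine ⟨fun a => List.ofFn fun i => decide (finFunctionFinEquiv.symm i ∈ T a), fun a => by simp,
      ?_⟩
    funext a
    ext v
    simp only [tablesOf, Set.mem_ofPred_eq]
    rw [List.getElem?_eq_getElem (by rw [List.length_ofFn]; exact Fin.is_lt _), List.getElem_ofFn]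
    simp only [Fin.eta, Equiv.symm_apply_apply, Option.some.injEq, decide_eq_true_eq]

/-- A bound for the running time of `Fml.mainProg`. -/
noncomputable def Fml.mainTime [Fintype V] [Fintype G] (r : ℕ) (φ : Fml I V G ar) (L : ℕ) : ℕ :=
  (L + 1) * 2 + (((Finset.univ : Finset (V ⊕ Fin (r + 1) ⊕ Unit)).toList.length *
    ((L + 1) * 2) + 1) +
      ((((Finset.univ : Finset G).toList.map fun a =>
        advTime L (ar a) + ((L + 1) ^ ar a + 1) * 2).sum + 1) + φ.time L))

theorem PolyBounded.mainTime [Fintype V] [Fintype G] (φ : Fml I V G ar) :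
    PolyBounded fun L => φ.mainTime r L :=
  (succ.mul (const 2)).add ((((const _).mul (succ.mul (const 2))).add (const 1)).add
    (((list_sum _ (fun a L => HProg.advTime L (ar a) + ((L + 1) ^ ar a + 1) * 2) fun a =>
      (advTime (ar a)).add (((succ.pow _).add (const 1)).mul (const 2))).add (const 1)).add
        (fmlTime φ)))

variable [DecidableEq V] [DecidableEq G]

namespace HProg

/-- Move the whole input from the stack on which it is given to the heads in the list `hs`. -/
def copy (hs : List (V ⊕ Fin (r + 1) ⊕ Unit)) : HProg (Head V G r) (I ⊕ Bool) :=
  loop (.act [.pop (Head.tmp, true) (fun s o => (s.1, o)) (.branch (fun s => s.2.isSome)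
    (copyStmt hs) (.goto fun _ => ()))])

/-- Move the heads in the list `hs` to the start. -/
def rewindAll (hs : List (V ⊕ Fin (r + 1) ⊕ Unit)) : HProg (Head V G r) (I ⊕ Bool) :=
  hs.foldr (fun h p => .seq (rewind (.inl h)) p) clear

/-- Guess the tables in the list `as`. -/
def guessAll (ar : G → ℕ) (as : List G) : HProg (Head V G r) (I ⊕ Bool) :=
  as.foldr (fun a p => .seq (guess (Head.tab a) Head.odo (ar a)) (.seq (rewind (Head.tab a)) p)) clear

end HProg

/-- The letter read last is pushed onto the left stacks of all heads in `hs`. -/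
theorem stepAux_copyStmt (hs : List (V ⊕ Fin (r + 1) ⊕ Unit)) (hn : hs.Nodup)
    (s : Bool × Option (I ⊕ Bool)) (S : Head V G r × Bool → List (I ⊕ Bool)) :
    TM2.stepAux (copyStmt hs : TM2.Stmt (fun _ : Head V G r × Bool => I ⊕ Bool) Unit _) s S =
      ⟨some (), s, fun k => if k.2 = false ∧ ∃ h ∈ hs, k.1 = .inl h then s.2.getD default :: S k
        else S k⟩ := by
  induction hs generalizing S with
  | nil => simp [copyStmt, TM2.stepAux]
  | cons h hs ih =>
    obtain ⟨h1, h2⟩ := List.nodup_cons.1 hn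
    have := ih h2 (update S (.inl h, false) (s.2.getD default :: S (.inl h, false)))
    rw [copyStmt, List.foldr_cons, TM2.stepAux]
    refine this.trans ?_
    congr 1
    funext ⟨z, d⟩
    by_cases hz : z = .inl h
    · subst hz
      cases d <;> simp [h1]
    · simp only [Prod.mk.injEq, hz, false_and, not_false_eq_true, update_of_ne, ne_eq,
        List.mem_cons, exists_eq_or_imp, false_or]

variable {x : List I}

/-- At the beginning the input is on the right stack of the head `tmp`. While its letters are
popped, they are appended to the words of all heads on the input, `tmp` among them. -/
theorem out_copy (hs : List (V ⊕ Fin (r + 1) ⊕ Unit)) (hn : hs.Nodup) (hm : ∀ h, h ∈ hs)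
    (b : Bool) (c : Option (I ⊕ Bool)) :
    Out (copy hs) ((b, c), update (fun _ => []) ((Head.tmp : Head V G r), true) (x.map .inl))
      [st b none (contOf x fun _ => []) (Sum.elim (fun _ => x.length) fun _ => 0)]
      ((x.length + 1) * 2) := by
  set ct : ℕ → Head V G r → List (I ⊕ Bool) := fun i => Sum.elim
    (fun h => if (.inl h : Head V G r) = Head.tmp then x.map .inl else (x.map .inl).take i)
    (fun _ => []) with hct
  set ps : ℕ → Head V G r → ℕ := fun i => Sum.elim (fun _ => i) fun _ => 0 with hps
  have hl := out_loop (t := 1) (p := .act [.pop ((Head.tmp : Head V G r), true)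
      (fun s o => (s.1, o)) (.branch (fun s => s.2.isSome) (copyStmt hs) (.goto fun _ => ()))])
      (I := fun y => y.1 = b) (e := st b none (contOf x fun _ => []) (ps x.length)) rfl x.length
      (fun i => zip (ct i) (ps i)) ?_ ?_ (b, c) rfl
  · have e : update (fun _ => []) ((Head.tmp : Head V G r), true) (x.map .inl) =
        zip (ct 0) (ps 0) := by
      funext ⟨z, d⟩
      rcases z with (v | o | u) | a <;> cases d <;> simp [hct, hps, zip, Head.tmp]
    rw [e]
    exact hl
  · rintro i hi ⟨b', c⟩ rfl
    refine ⟨(b', some (.inl x[i])), rfl, rfl, Out.act_eq ⟨noHalt_copyStmt hs, trivial⟩ ?_⟩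
    unfold exec
    have e : (zip (ct i) (ps i) ((Head.tmp : Head V G r), true)).head? = some (.inl x[i]) := by
      simp [zip, hct, hps, Head.tmp, List.head?_drop, hi]
    simp only [TM2.stepAux, e, Option.isSome_some, cond_true]
    rw [stepAux_copyStmt hs hn]
    refine Prod.ext rfl ?_
    funext ⟨z, d⟩
    have h1 : ((x.map (Sum.inl : I → I ⊕ Bool)).take (i + 1)).reverse =
        .inl x[i] :: ((x.map Sum.inl).take i).reverse := by
      rw [reverse_take_succ (by simpa using hi)]
      simp
    rcases z with (v | o | u) | a <;> cases d <;>
      simp [zip, hct, hps, Head.tmp, List.take_take, h1, hm]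
  · rintro ⟨b', c⟩ rfl
    refine Out.act_eq ⟨noHalt_copyStmt hs, trivial⟩ ?_
    unfold exec
    have e : (zip (ct x.length) (ps x.length) ((Head.tmp : Head V G r), true)).head? = none := by
      simp [zip, hct, hps, Head.tmp]
    simp only [TM2.stepAux, e, Option.isSome_none, cond_false]
    refine Prod.ext rfl ?_
    funext ⟨z, d⟩
    have h1 : (x.map (Sum.inl : I → I ⊕ Bool)).take x.length = x.map Sum.inl :=
      List.take_of_length_le (by simp)
    rcases z with (v | o | u) | a <;> cases d <;> simp [zip, hct, hps, Head.tmp, h1, st, contOf]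

theorem out_rewindAll (hs : List (V ⊕ Fin (r + 1) ⊕ Unit)) (b : Bool) (c : Option (I ⊕ Bool))
    (q : V ⊕ Fin (r + 1) ⊕ Unit → ℕ) (hq : ∀ h, q h ≤ x.length) (hq' : ∀ h ∉ hs, q h = 0) :
    Out (rewindAll hs) (st b c (contOf x fun _ => []) (Sum.elim q fun _ : G => 0))
      [st b none (contOf x fun _ => []) (posOf fun _ => 0)]
      (hs.length * ((x.length + 1) * 2) + 1) := by
  induction hs generalizing c q with
  | nil =>
    have : (Sum.elim q fun _ : G => 0) = posOf fun _ => 0 := by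
      funext z
      rcases z with (v | h) | a
      · exact hq' _ (by simp)
      · exact hq' _ (by simp)
      · rfl
    rw [this]
    simpa [rewindAll] using out_clear
  | cons h hs ih =>
    have h1 := out_rewind (b := b) (c := c) (cont := (contOf x fun _ : G => []))
      (pos := Sum.elim q fun _ : G => 0) (z := .inl h) (by simpa [contOf] using hq h)
    rw [Sum.update_elim_inl, contOf_inl, List.length_map] at h1
    refine (h1.det_seq (ih none (update q h 0) (fun h' => ?_) fun h' hh' => ?_)).mono ?_
    · by_cases e : h' = h
      · simp [e]
      · rw [update_of_ne e]
        exact hq _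
    · by_cases e : h' = h
      · simp [e]
      · rw [update_of_ne e]
        exact hq' _ (by simp [e, hh'])
    · rw [List.length_cons]
      ring_nf
      omega

/-- The executions of `guessAll` correspond to the families of tables. -/
theorem out_guessAll (hr : ∀ a, ar a ≤ r) (as : List G) (ha : as.Nodup) (b : Bool)
    (c : Option (I ⊕ Bool)) (W : G → List Bool) (hW : ∀ a ∈ as, W a = []) :
    Out (guessAll ar as) (st b c (contOf x W : Head V G r → _) (posOf fun _ => 0))
      ((families (fun a => (x.length + 1) ^ ar a) as W).map fun W' =>
        st b none (contOf x W') (posOf fun _ => 0))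
      ((as.map fun a => advTime x.length (ar a) + ((x.length + 1) ^ ar a + 1) * 2).sum + 1) := by
  induction as generalizing c W with
  | nil => simpa [guessAll, families] using out_clear
  | cons a as ih =>
    obtain ⟨h1, h2⟩ := List.nodup_cons.1 ha
    have e (w : List Bool) : update (contOf x W : Head V G r → List (I ⊕ Bool)) (Head.tab a)
        (w.map .inr) = contOf x (update W a w) := by
      rw [contOf, contOf, Head.tab, Sum.update_elim_inr]
      congr 1
      funext a'
      by_cases h : a' = a
      · subst h
        simp
      · simp [h]
    have e0 : update (posOf fun _ => 0 : Head V G r → ℕ) (Head.tab a) 0 = posOf fun _ => 0 :=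
      update_eq_self_iff.2 rfl
    have hg := out_guess (cont := (contOf x W : Head V G r → List (I ⊕ Bool))) (g := Head.tab a)
      (Y := Head.odo) (L := x.length) (ar a) (by simp [contOf, Head.odo])
      (by simp [Head.odo, Head.tab])
      (fun j' hj' i hi => odo_ne hi (by have := hr a; omega)) b c (posOf fun _ => 0)
      (by simp [Head.odo, posOf]) []
    have es : gst c (contOf x W : Head V G r → List (I ⊕ Bool)) (posOf fun _ => 0) b (Head.tab a) []
        = st b c (contOf x W) (posOf fun _ => 0) := by
      rw [gst, e, ← hW a (by simp), update_eq_self, hW a (by simp), List.length_nil, e0]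
    rw [es] at hg
    have := Out.seq (q := .seq (rewind (Head.tab a)) (guessAll ar as))
      (t' := ((x.length + 1) ^ ar a + 1) * 2 +
        ((as.map fun a => advTime x.length (ar a) + ((x.length + 1) ^ ar a + 1) * 2).sum + 1))
      (H := fun w => (families (fun a => (x.length + 1) ^ ar a) as (update W a w)).map fun W' =>
        st b none (contOf x W') (posOf fun _ => 0)) hg fun w hw => ?_
    · refine (this.mono ?_).congr ?_
      · simp only [List.map_cons, List.sum_cons]
        omega
      · rw [families, List.map_flatMap]
    · rw [List.nil_append, gst, e]
      have hr := out_rewind (b := b) (c := none) (cont := (contOf x (update W a w) : Head V G r → _))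
        (pos := update (posOf fun _ => 0) (Head.tab a) w.length) (z := Head.tab a)
        (by rw [length_contOf_tab]; simp)
      rw [length_contOf_tab, update_idem, e0, update_self, mem_words.1 hw] at hr
      rw [mem_words.1 hw]
      refine hr.det_seq (ih h2 none (update W a w) fun a' ha' => ?_)
      rw [update_of_ne (ne_of_mem_of_not_mem ha' h1), hW a' (by simp [ha'])]

variable [Fintype V] [Fintype G]

/-- The program of the machine that guesses tables and evaluates a formula. -/
noncomputable def Fml.mainProg (r : ℕ) (φ : Fml I V G ar) : HProg (Head V G r) (I ⊕ Bool) :=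
  .seq (copy Finset.univ.toList) (.seq (rewindAll Finset.univ.toList)
    (.seq (guessAll ar Finset.univ.toList) (φ.prog r)))

open Classical in
/-- The executions of the main program correspond to the families of tables, and the truth value at
the end is that of the formula for these tables. -/
theorem Fml.out_mainProg (hr : ∀ a, ar a ≤ r) (φ : Fml I V G ar) (hφ : φ.WF [] = true) (b : Bool)
    (c : Option (I ⊕ Bool)) :
    Out (φ.mainProg r) ((b, c), update (fun _ => []) (Head.tmp, true) (x.map .inl))
      ((families (fun a => (x.length + 1) ^ ar a) Finset.univ.toList fun _ => []).map fun W =>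
        st (decide (φ.eval x (tablesOf x.length W) fun _ => 0)) none (contOf x W)
          (posOf fun _ => 0)) (φ.mainTime r x.length) := by
  refine (out_copy _ (Finset.nodup_toList _) (by simp) b c).det_seq
    ((out_rewindAll _ b none _ (fun _ => le_rfl) (by simp)).det_seq ?_)
  have := Out.seq (q := φ.prog r) (t' := φ.time x.length) (H := fun W =>
    [st (decide (φ.eval x (tablesOf x.length W) fun _ => 0)) none (contOf x W)
      (posOf fun _ => 0)])
    (out_guessAll (x := x) (V := V) (r := r) hr _ (Finset.nodup_toList Finset.univ) b none
      (fun _ => []) (by simp)) fun W hW => ?_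
  · rwa [← List.map_eq_flatMap] at this
  · exact φ.out_prog hr (fun a => ((mem_families (Finset.nodup_toList _)).1 hW).1 a (by simp)) []
      hφ (fun _ => 0) (fun _ _ => rfl) b none

/-- The machine that guesses tables and evaluates a formula. -/
noncomputable def Fml.machine [Finite I] (r : ℕ) (φ : Fml I V G ar) : NTM I where
  K := Head V G r × Bool
  Γ := fun _ => I ⊕ Bool
  Λ := Option (φ.mainProg r).Lbl
  finΛ := by
    have := (φ.mainProg r).finite_lbl
    infer_instance
  σ := Bool × Option (I ⊕ Bool)
  inputStack := (Head.tmp, true)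
  inputLetter := .inl
  main := some (φ.mainProg r).entry
  initialState := (false, none)
  choices := fun l => match l with
    | none => [.halt]
    | some l => (φ.mainProg r).code some none l
  accept := {s | s.1 = true}

open Classical in
/-- The number of accepting runs is the number of families of tables that satisfy the formula. -/
theorem Fml.cnt_machine [Finite I] (hr : ∀ a, ar a ≤ r) (φ : Fml I V G ar) (hφ : φ.WF [] = true)
    (x : List I) :
    Cnt (φ.machine r).choices (φ.machine r).accept ((φ.machine r).initCfg x)
      (1 + φ.mainTime r x.length)
      ((families (fun a => (x.length + 1) ^ ar a) Finset.univ.toList fun _ => []).map fun W =>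
        if φ.eval x (tablesOf x.length W) fun _ => 0 then 1 else 0).sum := by
  refine cnt_index (ex := none) (T := 1)
    (φ.out_mainProg (x := x) hr hφ false none _ (φ.machine r).choices (φ.machine r).accept some none
      (fun _ => rfl) 1) fun W _ => ?_
  have := Cnt.step (ch := (φ.machine r).choices) (acc := (φ.machine r).accept) (l := none)
    (v := (decide (φ.eval x (tablesOf x.length W) fun _ => 0), none))
    (S := zip (contOf x W) (posOf fun _ => 0)) (T := 0)
    (m := fun c => if c.var ∈ (φ.machine r).accept then 1 else 0) (by simp [machine]) ?_
  · have e : (decide (φ.eval x (tablesOf x.length W) fun _ => 0), (none : Option (I ⊕ Bool))) ∈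
        (φ.machine r).accept ↔ φ.eval x (tablesOf x.length W) fun _ => 0 := decide_eq_true_iff
    simp only [machine, List.map_cons, List.map_nil, TM2.stepAux, List.sum_cons, List.sum_nil,
      add_zero, zero_add] at this
    rw [if_congr e.symm rfl rfl]
    exact this
  · intro c' hc'
    obtain rfl := List.mem_singleton.1 hc'
    exact Cnt.halted rfl

/-- Counting the tables that satisfy a fixed first-order sentence is in #P: the machine guesses the
tables and evaluates the sentence. The initial value `0` of the variables stands for the start of the
word, which serves as a constant. -/
theorem card_tables_mem_sharpP [Finite I] (φ : Fml I V G ar) (hφ : φ.WF [] = true) :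
    (fun x : List I => {T : Tables G ar x.length | φ.eval x T fun _ => 0}.ncard) ∈ SharpP I := by
  classical
  obtain ⟨r, hr⟩ : ∃ r, ∀ a, ar a ≤ r :=
    ⟨∑ a, ar a, fun a => Finset.single_le_sum (fun _ _ => Nat.zero_le _) (Finset.mem_univ a)⟩
  refine ⟨φ.machine r, ?_, fun x => ?_⟩
  · obtain ⟨p, hp⟩ := (PolyBounded.const 1).add (PolyBounded.mainTime (r := r) φ)
    exact ⟨p, fun x ρ h => ((φ.cnt_machine hr hφ x).1 ρ h.1 h.2).trans
      (Nat.add_le_add_right (hp _) 1)⟩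
  · refine (φ.cnt_machine hr hφ x).2.trans ?_
    rw [Nat.cast_inj]
    set F := families (fun a => (x.length + 1) ^ ar a) (Finset.univ : Finset G).toList fun _ => []
      with hF
    have hmem : ∀ W, W ∈ F ↔ ∀ a, (W a).length = (x.length + 1) ^ ar a := fun W => by
      rw [hF, mem_families (Finset.nodup_toList _)]
      simp
    rw [← List.sum_toFinset _ (nodup_families (Finset.nodup_toList _) _), Finset.sum_boole,
      Nat.cast_id, ← Set.ncard_coe_finset]
    have hb := tablesOf_bijOn ar x.length
    refine Set.ncard_congr (fun W _ => tablesOf x.length W) ?_ ?_ ?_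
    · intro W hW
      simpa using (Finset.mem_filter.1 hW).2
    · intro W W' hW hW' h
      refine hb.2.1 ?_ ?_ h
      · exact (hmem W).1 (by simpa using (Finset.mem_filter.1 hW).1)
      · exact (hmem W').1 (by simpa using (Finset.mem_filter.1 hW').1)
    · intro T hT
      obtain ⟨W, hW, rfl⟩ := hb.2.2 (Set.mem_univ T)
      exact ⟨W, Finset.mem_coe.2 (Finset.mem_filter.2 ⟨List.mem_toFinset.2 ((hmem W).2 hW), hT⟩), rfl⟩

end Machine

end LassoDensity

namespace LassoDensity

open Function

/-! ### Lassos of a given length -/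

section LassoCounting

variable {α : Type} {n : ℕ}

/-- The successor of a position in a lasso of length `n` whose loop starts at position `l`. -/
def nxt (l t : Fin n) : Fin n := if h : (t : ℕ) + 1 < n then ⟨t + 1, h⟩ else l

/-- The position of the lasso that is visited at time `i`. -/
def idx (l : Fin n) (i : ℕ) : Fin n := (nxt l)^[i] ⟨0, l.pos⟩

/-- The infinite word induced by a lasso, given by the start of the loop and the letters. -/
def lword (l : Fin n) (w : Fin n → α) (i : ℕ) : α := w (idx l i)

theorem idx_zero (l : Fin n) : (idx l 0 : ℕ) = 0 := rfl

theorem idx_succ (l : Fin n) (i : ℕ) : idx l (i + 1) = nxt l (idx l i) :=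
  iterate_succ_apply' _ _ _

/-- The position visited at time `i` in the form that is used in the definition of the word of a
lasso. -/
theorem idx_eq (l : Fin n) (i : ℕ) :
    (idx l i : ℕ) = if i < l then i else l + (i - l) % (n - l) := by
  have hl := l.2
  induction i with
  | zero =>
    rw [idx_zero]
    split_ifs with h
    · rfl
    · simp only [not_lt, Nat.le_zero] at h
      simp [h]
  | succ i ih =>
    have hlt := (idx l i).2
    rw [idx_succ, nxt]
    by_cases h1 : i + 1 < l
    · rw [if_pos (by omega)] at ih
      rw [if_pos h1, dif_pos (by omega)]
      simp [ih]
    · rw [if_neg h1]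
      by_cases h2 : i < l
      · rw [if_pos h2] at ih
        have h3 : i + 1 = l := by omega
        rw [dif_pos (by omega)]
        simp [ih, h3]
      · rw [if_neg h2] at ih
        have h4 : i + 1 - l = (i - l) + 1 := by omega
        rw [h4, ← Nat.mod_add_mod]
        have h5 : (i - l) % (n - l) < n - l := Nat.mod_lt _ (by omega)
        split_ifs with h6
        · rw [Nat.mod_eq_of_lt (by omega)]
          simp only
          omega
        · have h7 : (i - l) % (n - l) + 1 = n - l := by omega
          rw [h7, Nat.mod_self]
          rfl

/-- The lasso with the letters `w` whose loop starts at position `l`. -/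
def toLasso (p : Fin n × (Fin n → α)) : Lasso α where
  stem := (List.ofFn p.2).take p.1
  loop := (List.ofFn p.2).drop p.1
  loop_ne := by
    have := p.1.2
    rw [← List.length_pos_iff_ne_nil, List.length_drop, List.length_ofFn]
    omega

theorem length_toLasso (p : Fin n × (Fin n → α)) : (toLasso p).length = n := by
  have := p.1.2
  simp only [Lasso.length, toLasso, List.length_take, List.length_drop, List.length_ofFn]
  omega

theorem word_toLasso (p : Fin n × (Fin n → α)) : (toLasso p).word = lword p.1 p.2 := by
  funext i
  have h0 := p.1.2
  have e := idx_eq p.1 i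
  rw [Lasso.word, lword]
  simp only [toLasso, List.getElem_take, List.getElem_drop, List.getElem_ofFn, List.length_take,
    List.length_drop, List.length_ofFn, min_eq_left h0.le]
  split_ifs with h
  · exact congrArg p.2 (Fin.ext (by rw [e, if_pos h]))
  · exact congrArg p.2 (Fin.ext (by rw [e, if_neg h]))

theorem toLasso_injective : Injective (toLasso : Fin n × (Fin n → α) → Lasso α) := by
  rintro ⟨l, w⟩ ⟨l', w'⟩ h
  have h1 := congrArg Lasso.stem h
  have h2 := congrArg Lasso.loop h
  have h3 := congrArg List.length h1
  simp only [toLasso, List.length_take, List.length_ofFn] at h1 h2 h3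
  have hl : l = l' := by
    rw [Fin.ext_iff]
    omega
  subst hl
  have h4 := List.take_append_drop l (List.ofFn w)
  rw [h1, h2, List.take_append_drop] at h4
  rw [List.ofFn_injective h4]

theorem exists_toLasso (l : Lasso α) (hl : l.length = n) :
    ∃ p : Fin n × (Fin n → α), toLasso p = l := by
  obtain ⟨u, v, hv⟩ := l
  have hv' := List.length_pos_iff_ne_nil.2 hv
  simp only [Lasso.length] at hl
  subst hl
  have e : (List.ofFn fun i : Fin (u.length + v.length) =>
      (u ++ v)[(i : ℕ)]'(by simp)) = u ++ v := by
    apply List.ext_getElem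
    · simp
    · simp
  refine ⟨(⟨u.length, by omega⟩, fun i => (u ++ v)[(i : ℕ)]'(by simp)), ?_⟩
  simp [toLasso, e]

/-- The lassos of length `n` correspond to the pairs of a start of the loop and a word of length
`n`. -/
theorem numModels_eq (P : Set (ℕ → α)) (n : ℕ) :
    numModels P n = {p : Fin n × (Fin n → α) | lword p.1 p.2 ∈ P}.ncard := by
  symm
  refine Set.ncard_congr (fun p _ => toLasso p) ?_ ?_ ?_
  · intro p hp
    exact ⟨length_toLasso p, by rw [word_toLasso]; exact hp⟩
  · intro p q _ _ h
    exact toLasso_injective h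
  · rintro l ⟨hl, hP⟩
    obtain ⟨p, rfl⟩ := exists_toLasso l hl
    exact ⟨p, by rwa [word_toLasso] at hP, rfl⟩

theorem ncard_lassos [Finite α] (n : ℕ) : (lassos α n).ncard = n * Nat.card α ^ n := by
  have h := numModels_eq (Set.univ : Set (ℕ → α)) n
  have e : models (Set.univ : Set (ℕ → α)) n = lassos α n := by
    ext l
    simp [models, lassos]
  rw [numModels, e] at h
  rw [h]
  simp only [Set.mem_univ, Set.ofPred_true, Set.ncard_univ]
  rw [Nat.card_prod, Nat.card_fun, Nat.card_fin]

theorem density_eq [Finite α] (P : Set (ℕ → α)) (n : ℕ) :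
    density P n = (numModels P n : ℚ) / ((n : ℚ) * (Nat.card α : ℚ) ^ n) := by
  rw [density, ncard_lassos]
  push_cast
  rfl

end LassoCounting

/-! ### Relations defined by recursion -/

section Recursion

/-- A definition by recursion on the first argument has exactly one solution. -/
theorem existsUnique_rec {N : ℕ} {β : Type} [Inhabited β] (F : (Fin N → β) → Fin N → β)
    (hF : ∀ p r r', (∀ q < p, r q = r' q) → F r p = F r' p) : ∃! r, ∀ p, r p = F r p := by
  classical
  have wf : WellFounded ((· < ·) : Fin N → Fin N → Prop) := wellFounded_lt
  refine ⟨wf.fix fun p ih => F (fun q => if h : q < p then ih q h else default) p, fun p => ?_, ?_⟩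
  · rw [wf.fix_eq]
    refine hF p _ _ fun q hq => ?_
    rw [dif_pos hq]
  · intro r hr
    funext p
    induction p using wf.induction with
    | _ p ih =>
      rw [hr p, wf.fix_eq]
      refine hF p _ _ fun q hq => ?_
      rw [dif_pos hq, ih q hq]

end Recursion

/-! ### First-order formulas for common notions -/

namespace Fml

variable {I G V : Type} {ar : G → ℕ}

/-- Disjunction. -/
def or (φ ψ : Fml I V G ar) : Fml I V G ar := neg (and (neg φ) (neg ψ))

/-- Implication. -/
def imp (φ ψ : Fml I V G ar) : Fml I V G ar := neg (and φ (neg ψ))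

/-- Equivalence. -/
def iff (φ ψ : Fml I V G ar) : Fml I V G ar := and (imp φ ψ) (imp ψ φ)

/-- Universal quantification. -/
def all (v : V) (φ : Fml I V G ar) : Fml I V G ar := neg (ex v (neg φ))

/-- Equality of positions. -/
def eq (i j : V) : Fml I V G ar := and (neg (lt i j)) (neg (lt j i))

/-- The position `j` is the successor of the position `i`; the variable `z` is auxiliary. -/
def succ (z i j : V) : Fml I V G ar := and (lt i j) (neg (ex z (and (lt i z) (lt z j))))

variable [DecidableEq V] {x : List I} {T : Tables G ar x.length} {ρ : V → Fin (x.length + 1)}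
  {φ ψ : Fml I V G ar}

theorem eval_lt {i j : V} : (lt i j : Fml I V G ar).eval x T ρ ↔ ρ i < ρ j := Iff.rfl

theorem eval_sym {i : V} {a : I} :
    (sym i a : Fml I V G ar).eval x T ρ ↔ x[(ρ i : ℕ)]? = some a := Iff.rfl

theorem eval_neg : (neg φ).eval x T ρ ↔ ¬ φ.eval x T ρ := Iff.rfl

theorem eval_and : (and φ ψ).eval x T ρ ↔ φ.eval x T ρ ∧ ψ.eval x T ρ := Iff.rfl

theorem eval_ex {v : V} : (ex v φ).eval x T ρ ↔ ∃ a, φ.eval x T (update ρ v a) := Iff.rfl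

theorem eval_or : (or φ ψ).eval x T ρ ↔ φ.eval x T ρ ∨ ψ.eval x T ρ := by
  simp only [or, eval]
  tauto

theorem eval_imp : (imp φ ψ).eval x T ρ ↔ (φ.eval x T ρ → ψ.eval x T ρ) := by
  simp only [imp, eval]
  tauto

theorem eval_iff : (iff φ ψ).eval x T ρ ↔ (φ.eval x T ρ ↔ ψ.eval x T ρ) := by
  simp only [iff, eval_and, eval_imp]
  tauto

theorem eval_all {v : V} : (all v φ).eval x T ρ ↔ ∀ a, φ.eval x T (update ρ v a) := by
  simp only [all, eval, not_exists, not_not]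

theorem eval_eq {i j : V} : (eq i j : Fml I V G ar).eval x T ρ ↔ ρ i = ρ j := by
  simp only [eq, eval]
  omega

theorem eval_succ {z i j : V} (hi : i ≠ z) (hj : j ≠ z) :
    (succ z i j : Fml I V G ar).eval x T ρ ↔ (ρ j : ℕ) = ρ i + 1 := by
  simp only [succ, eval, update_self, update_of_ne hi, update_of_ne hj]
  constructor
  · rintro ⟨h1, h2⟩
    by_contra h
    refine h2 ⟨⟨ρ i + 1, by omega⟩, ?_, ?_⟩
    · rw [Fin.lt_def]
      simp
    · rw [Fin.lt_def]
      simp only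
      omega
  · intro h
    refine ⟨by omega, ?_⟩
    rintro ⟨a, h1, h2⟩
    omega

end Fml

end LassoDensity

namespace LassoDensity

open Function

/-! ### The semantics of LTL on lassos -/

section LTLSemantics

variable {AP : Type}

/-- The truth of a formula depends only on the suffix of the word. -/
theorem LTL.sat_congr (φ : LTL AP) {w w' : ℕ → Set AP} {i i' : ℕ}
    (h : ∀ j, w (i + j) = w' (i' + j)) : LTL.Sat w i φ ↔ LTL.Sat w' i' φ := by
  induction φ generalizing i i' with
  | tt => exact Iff.rfl
  | atom p =>
    have := h 0
    simp only [add_zero] at this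
    simp only [LTL.Sat, this]
  | neg φ ih => exact not_congr (ih h)
  | conj φ ψ ih ih' => exact and_congr (ih h) (ih' h)
  | next φ ih => exact ih fun j => by rw [add_assoc, add_assoc]; exact h (1 + j)
  | untl φ ψ ih ih' =>
    have h1 : ∀ k, LTL.Sat w (i + k) φ ↔ LTL.Sat w' (i' + k) φ := fun k =>
      ih fun j => by rw [add_assoc, add_assoc]; exact h (k + j)
    have h2 : ∀ k, LTL.Sat w (i + k) ψ ↔ LTL.Sat w' (i' + k) ψ := fun k =>
      ih' fun j => by rw [add_assoc, add_assoc]; exact h (k + j)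
    constructor
    · rintro ⟨j, hj, h3, h4⟩
      obtain ⟨k, rfl⟩ := Nat.exists_eq_add_of_le hj
      refine ⟨i' + k, by omega, (h2 k).1 h3, fun m hm hm' => ?_⟩
      obtain ⟨k', rfl⟩ := Nat.exists_eq_add_of_le hm
      exact (h1 k').1 (h4 _ (by omega) (by omega))
    · rintro ⟨j, hj, h3, h4⟩
      obtain ⟨k, rfl⟩ := Nat.exists_eq_add_of_le hj
      refine ⟨i + k, by omega, (h2 k).2 h3, fun m hm hm' => ?_⟩
      obtain ⟨k', rfl⟩ := Nat.exists_eq_add_of_le hm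
      exact (h1 k').2 (h4 _ (by omega) (by omega))

variable {α : Type} {n : ℕ}

theorem idx_of_lt (l : Fin n) {i : ℕ} (hi : i < n) : (idx l i : ℕ) = i := by
  rw [idx_eq]
  split_ifs with h
  · rfl
  · rw [Nat.mod_eq_of_lt (by omega)]
    omega

/-- After `n` letters the lasso is again at the start of its loop. -/
theorem idx_add_loop (l : Fin n) (j : ℕ) : idx l (n + j) = idx l (l + j) := by
  induction j with
  | zero =>
    have hl := l.2
    have h1 : idx l n = idx l ((n - 1) + 1) := congrArg (idx l) (by omega)
    rw [add_zero, add_zero, h1, idx_succ, nxt, dif_neg]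
    · rw [Fin.ext_iff, idx_of_lt l hl]
    · rw [idx_of_lt l (by omega)]
      omega
  | succ j ih => rw [← add_assoc, ← add_assoc, idx_succ, idx_succ, ih]

theorem sat_lword_loop (l : Fin n) (w : Fin n → Set AP) (φ : LTL AP) (j : ℕ) :
    LTL.Sat (lword l w) (n + j) φ ↔ LTL.Sat (lword l w) (l + j) φ :=
  φ.sat_congr fun k => by rw [lword, lword, add_assoc, idx_add_loop, add_assoc]

/-- On a lasso, an until formula is satisfied at the position `t` if it is fulfilled before the end
of the lasso or in the part of the loop that is reached after a jump to its start. -/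
theorem sat_untl_lword (l : Fin n) (w : Fin n → Set AP) (φ ψ : LTL AP) {t : ℕ} :
    LTL.Sat (lword l w) t (.untl φ ψ) ∧ t < n ↔ t < n ∧
      ((∃ t', t ≤ t' ∧ t' < n ∧ LTL.Sat (lword l w) t' ψ ∧
        ∀ m, t ≤ m → m < t' → LTL.Sat (lword l w) m φ) ∨
      ((∀ m, t ≤ m → m < n → LTL.Sat (lword l w) m φ) ∧
        ∃ t' : ℕ, (l : ℕ) ≤ t' ∧ t' < n ∧ LTL.Sat (lword l w) t' ψ ∧
          ∀ m : ℕ, (l : ℕ) ≤ m → m < t' → LTL.Sat (lword l w) m φ)) := by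
  have hl := l.2
  rw [and_comm]
  refine and_congr_right fun ht => ?_
  constructor
  · rintro ⟨j, hj, h1, h2⟩
    induction j using Nat.strong_induction_on generalizing t with
    | _ j ih =>
      by_cases hjn : j < n
      · exact Or.inl ⟨j, hj, hjn, h1, h2⟩
      obtain ⟨k, rfl⟩ := Nat.exists_eq_add_of_le (not_lt.1 hjn)
      have h3 := ih (l + k) (by omega) hl (by omega) ((sat_lword_loop l w ψ k).1 h1)
        fun m hm hm' => by
          obtain ⟨k', rfl⟩ := Nat.exists_eq_add_of_le hm
          exact (sat_lword_loop l w φ k').1 (h2 _ (by omega) (by omega))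
      refine Or.inr ⟨fun m hm hm' => h2 m hm (by omega), ?_⟩
      rcases h3 with h3 | h3
      · exact h3
      · exact h3.2
  · rintro (⟨t', h1, h2, h3, h4⟩ | ⟨h0, t', h1, h2, h3, h4⟩)
    · exact ⟨t', h1, h3, h4⟩
    · obtain ⟨k, rfl⟩ := Nat.exists_eq_add_of_le h1
      refine ⟨n + k, by omega, (sat_lword_loop l w ψ k).2 h3, fun m hm hm' => ?_⟩
      by_cases hmn : m < n
      · exact h0 m hm hmn
      · obtain ⟨k', rfl⟩ := Nat.exists_eq_add_of_le (not_lt.1 hmn)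
        exact (sat_lword_loop l w φ k').2 (h4 _ (by omega) (by omega))

end LTLSemantics

/-! ### Recursive description of the truth of an LTL formula -/

section LTLRelations

instance : Finite LTLSymbol :=
  Finite.of_surjective
    (![.tick, .sep, .tt, .atom, .neg, .conj, .next, .untl] : Fin 8 → LTLSymbol) <| by
    rintro (_ | _ | _ | _ | _ | _ | _ | _)
    exacts [⟨0, rfl⟩, ⟨1, rfl⟩, ⟨2, rfl⟩, ⟨3, rfl⟩, ⟨4, rfl⟩, ⟨5, rfl⟩, ⟨6, rfl⟩, ⟨7, rfl⟩]

/-- The relations that are guessed for an LTL formula and a lasso: the letters and the start of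
the loop of the lasso, the lengths of the blocks of ticks in the input, the end of the text before a
subformula, and the truth values of the subformulas at the positions of the lasso. A subformula is
represented by the position of its last symbol. -/
inductive LRel : Type
  | word | loop | ticks | prev | val
  deriving DecidableEq

instance : Fintype LRel := ⟨{.word, .loop, .ticks, .prev, .val}, by rintro (_ | _) <;> decide⟩

/-- The arities of the relations. -/
def LRel.ar : LRel → ℕ
  | word => 2
  | loop => 1
  | ticks => 2
  | prev => 2
  | val => 2

variable {N : ℕ}

/-- A binary relation of a family of tables. -/
def rel2 {L : ℕ} (S : Set (Fin 2 → Fin (L + 1))) (p q : Fin (L + 1)) : Prop := ![p, q] ∈ S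

/-- A unary relation of a family of tables. -/
def rel1 {L : ℕ} (S : Set (Fin 1 → Fin (L + 1))) (p : Fin (L + 1)) : Prop := ![p] ∈ S

theorem rel1_inj {L : ℕ} {S S' : Set (Fin 1 → Fin (L + 1))} (h : rel1 S = rel1 S') : S = S' := by
  ext v
  have := congrFun h (v 0)
  have e : v = ![v 0] := by
    funext i
    fin_cases i
    rfl
  rw [e]
  exact iff_of_eq this

theorem rel2_inj {L : ℕ} {S S' : Set (Fin 2 → Fin (L + 1))} (h : rel2 S = rel2 S') : S = S' := by
  ext v
  have := congrFun (congrFun h (v 0)) (v 1)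
  have e : v = ![v 0, v 1] := by
    funext i
    fin_cases i <;> rfl
  rw [e]
  exact iff_of_eq this

/-- The defining equation of the relation `ticks`: `i` is the number of ticks directly before `p`. -/
def ticksRec (x : List LTLSymbol) (r : Fin N → Fin N → Prop) (p i : Fin N) : Prop :=
  (∃ d : Fin N, (p : ℕ) = d + 1 ∧ x[(d : ℕ)]? = some .tick ∧ ∃ j : Fin N, (i : ℕ) = j + 1 ∧ r d j) ∨
    ((i : ℕ) = 0 ∧ ¬ ∃ d : Fin N, (p : ℕ) = d + 1 ∧ x[(d : ℕ)]? = some .tick)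

/-- The defining equation of the relation `prev`: the symbol at `q` is the last one before the
subformula that ends at `p`. -/
def prevRec (x : List LTLSymbol) (r : Fin N → Fin N → Prop) (p q : Fin N) : Prop :=
  (x[(p : ℕ)]? = some .tt ∧ (p : ℕ) = q + 1) ∨
  (x[(p : ℕ)]? = some .atom ∧ q < p ∧ x[(q : ℕ)]? ≠ some .tick ∧
    ∀ m : Fin N, q < m → m < p → x[(m : ℕ)]? = some .tick) ∨
  ∃ d : Fin N, (p : ℕ) = d + 1 ∧
    (((x[(p : ℕ)]? = some .neg ∨ x[(p : ℕ)]? = some .next) ∧ r d q) ∨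
    ((x[(p : ℕ)]? = some .conj ∨ x[(p : ℕ)]? = some .untl) ∧ ∃ m : Fin N, m < p ∧ r d m ∧ r m q))

/-- The condition for the truth of an until formula at the position `t` of a lasso, where `a` and `b`
are the truth values of its operands. -/
def untlCond (s l : Fin N) (a b : Fin N → Prop) (t : Fin N) : Prop :=
  (∃ t', t ≤ t' ∧ t' < s ∧ b t' ∧ ∀ m, t ≤ m → m < t' → a m) ∨
    ((∀ m, t ≤ m → m < s → a m) ∧ ∃ t', l ≤ t' ∧ t' < s ∧ b t' ∧ ∀ m, l ≤ m → m < t' → a m)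

/-- The position `t'` of a lasso of length `s` with loop start `l` is the successor of `t`. -/
def nxtCond (s l t t' : Fin N) : Prop :=
  ((t' : ℕ) = t + 1 ∧ t' < s) ∨ ((s : ℕ) = t + 1 ∧ t' = l)

/-- The defining equation of the relation `val`: the subformula that ends at `p` holds at the
position `t` of the lasso. -/
def valRec (x : List LTLSymbol) (s l : Fin N) (word ticks prev : Fin N → Fin N → Prop)
    (r : Fin N → Fin N → Prop) (p t : Fin N) : Prop :=
  t < s ∧ (x[(p : ℕ)]? = some .tt ∨ (x[(p : ℕ)]? = some .atom ∧ ∃ i, ticks p i ∧ word t i) ∨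
    ∃ d : Fin N, (p : ℕ) = d + 1 ∧ ((x[(p : ℕ)]? = some .neg ∧ ¬ r d t) ∨
      (x[(p : ℕ)]? = some .next ∧ ∃ t', nxtCond s l t t' ∧ r d t') ∨
      ∃ m : Fin N, m < p ∧ prev d m ∧ ((x[(p : ℕ)]? = some .conj ∧ r d t ∧ r m t) ∨
        (x[(p : ℕ)]? = some .untl ∧ untlCond s l (r m) (r d) t))))

/-- The value of the right-hand side at `p` depends only on the relation below `p`, so that the
equation has exactly one solution by `existsUnique_rec`. -/
theorem ticksRec_local (x : List LTLSymbol) (p : Fin N) (r r' : Fin N → Fin N → Prop)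
    (h : ∀ q < p, r q = r' q) : ticksRec x r p = ticksRec x r' p := by
  funext i
  unfold ticksRec
  refine congrArg₂ _ (propext (exists_congr fun d => and_congr_right fun hd => ?_)) rfl
  rw [h d (by omega)]

theorem prevRec_local (x : List LTLSymbol) (p : Fin N) (r r' : Fin N → Fin N → Prop)
    (h : ∀ q < p, r q = r' q) : prevRec x r p = prevRec x r' p := by
  funext i
  unfold prevRec
  refine propext (or_congr Iff.rfl (or_congr Iff.rfl (exists_congr fun d =>
    and_congr_right fun hd => ?_)))
  rw [h d (by omega)]
  refine or_congr Iff.rfl (and_congr_right fun _ => exists_congr fun m =>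
    and_congr_right fun hm => ?_)
  rw [h m hm]

theorem valRec_local (x : List LTLSymbol) (s l : Fin N) (word ticks prev : Fin N → Fin N → Prop)
    (p : Fin N) (r r' : Fin N → Fin N → Prop) (h : ∀ q < p, r q = r' q) :
    valRec x s l word ticks prev r p = valRec x s l word ticks prev r' p := by
  funext i
  unfold valRec
  refine propext (and_congr_right fun _ => or_congr Iff.rfl (or_congr Iff.rfl (exists_congr fun d =>
    and_congr_right fun hd => ?_)))
  rw [h d (by omega)]
  refine or_congr Iff.rfl (or_congr Iff.rfl (exists_congr fun m => and_congr_right fun hm => ?_))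
  rw [h m hm]

end LTLRelations

/-! ### First-order sentence for LTL formulas -/

section LTLFormula

open Fml

/-- The type of first-order formulas that describe the evaluation of an LTL formula on a lasso. -/
abbrev LFml : Type := Fml LTLSymbol (Fin 20) LRel LRel.ar

namespace LFml

/-- Atomic formula for the relation `word`. -/
def word (i j : Fin 20) : LFml := .rel .word ![i, j]

/-- Atomic formula for the relation `loop`. -/
def loop (i : Fin 20) : LFml := .rel .loop ![i]

/-- Atomic formula for the relation `ticks`. -/
def ticks (i j : Fin 20) : LFml := .rel .ticks ![i, j]

/-- Atomic formula for the relation `prev`. -/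
def prev (i j : Fin 20) : LFml := .rel .prev ![i, j]

/-- Atomic formula for the relation `val`. -/
def val (i j : Fin 20) : LFml := .rel .val ![i, j]

/-- The formula for `ticksRec` with the variables `6` and `7`. The variable `19` is never bound and
has the value `0`. -/
def ticksDef : LFml :=
  or (ex 8 (and (succ 0 8 6) (and (sym 8 .tick) (ex 9 (and (succ 0 9 7) (ticks 8 9))))))
    (and (eq 7 19) (neg (ex 8 (and (succ 0 8 6) (sym 8 .tick)))))

/-- The formula for `prevRec` with the variables `6` and `7`. -/
def prevDef : LFml :=
  or (and (sym 6 .tt) (succ 0 7 6))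
    (or (and (sym 6 .atom) (and (lt 7 6) (and (neg (sym 7 .tick))
      (all 8 (imp (lt 7 8) (imp (lt 8 6) (sym 8 .tick)))))))
      (ex 8 (and (succ 0 8 6) (or (and (or (sym 6 .neg) (sym 6 .next)) (prev 8 7))
        (and (or (sym 6 .conj) (sym 6 .untl)) (ex 9 (and (lt 9 6) (and (prev 8 9) (prev 9 7)))))))))

/-- The formula for `nxtCond` with the variables `11` and `12`; the length of the lasso and the start
of the loop are the values of the variables `1` and `4`. -/
def nxtDef : LFml :=
  or (and (succ 0 11 12) (lt 12 1)) (and (succ 0 11 1) (eq 12 4))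

/-- The formula for `untlCond` with the operands that end at the variables `9` and `8`. -/
def untlDef : LFml :=
  or (ex 12 (and (neg (lt 12 11)) (and (lt 12 1) (and (val 8 12)
      (all 13 (imp (neg (lt 13 11)) (imp (lt 13 12) (val 9 13))))))))
    (and (all 13 (imp (neg (lt 13 11)) (imp (lt 13 1) (val 9 13))))
      (ex 12 (and (neg (lt 12 4)) (and (lt 12 1) (and (val 8 12)
        (all 13 (imp (neg (lt 13 4)) (imp (lt 13 12) (val 9 13)))))))))

/-- The formula for `valRec` with the variables `6` and `11`. -/
def valDef : LFml :=
  and (lt 11 1) (or (sym 6 .tt) (or (and (sym 6 .atom) (ex 7 (and (ticks 6 7) (word 11 7))))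
    (ex 8 (and (succ 0 8 6) (or (and (sym 6 .neg) (neg (val 8 11)))
      (or (and (sym 6 .next) (ex 12 (and nxtDef (val 8 12))))
        (ex 9 (and (lt 9 6) (and (prev 8 9) (or (and (sym 6 .conj) (and (val 8 11) (val 9 11)))
          (and (sym 6 .untl) untlDef)))))))))))

/-- The formula that is satisfied by the tables for the models of an LTL formula. The variables
`1`, …, `5` stand for the bound, the second separator, the number of propositions, the start
of the loop, and the last position of the input. -/
def main : LFml :=
  ex 1 (ex 2 (ex 3 (ex 4 (ex 5
    (and (sym 1 .sep) (and (sym 2 .sep) (and (lt 1 2) (and (ticks 2 3) (and (lt 4 1)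
    (and (all 11 (all 12 (imp (word 11 12) (and (lt 11 1) (lt 12 3)))))
    (and (all 11 (iff (loop 11) (eq 11 4)))
    (and (all 6 (all 7 (iff (ticks 6 7) ticksDef)))
    (and (all 6 (all 7 (iff (prev 6 7) prevDef)))
    (and (all 6 (all 11 (iff (val 6 11) valDef)))
    (and (ex 6 (and (succ 0 5 6) (neg (ex 7 (lt 6 7))))) (val 5 19))))))))))))))))

theorem wf_main : main.WF [] = true := by decide

variable {x : List LTLSymbol} {T : Tables LRel LRel.ar x.length} {ρ : Fin 20 → Fin (x.length + 1)}

theorem eval_word {i j : Fin 20} : (word i j).eval x T ρ ↔ rel2 (T .word) (ρ i) (ρ j) := by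
  have : (fun k => ρ (![i, j] k)) = ![ρ i, ρ j] := by funext k; fin_cases k <;> rfl
  exact iff_of_eq (congrArg (· ∈ _) this)

theorem eval_loop {i : Fin 20} : (loop i).eval x T ρ ↔ rel1 (T .loop) (ρ i) := by
  have : (fun k => ρ (![i] k)) = ![ρ i] := by funext k; fin_cases k; rfl
  exact iff_of_eq (congrArg (· ∈ _) this)

theorem eval_ticks {i j : Fin 20} : (ticks i j).eval x T ρ ↔ rel2 (T .ticks) (ρ i) (ρ j) := by
  have : (fun k => ρ (![i, j] k)) = ![ρ i, ρ j] := by funext k; fin_cases k <;> rfl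
  exact iff_of_eq (congrArg (· ∈ _) this)

theorem eval_prev {i j : Fin 20} : (prev i j).eval x T ρ ↔ rel2 (T .prev) (ρ i) (ρ j) := by
  have : (fun k => ρ (![i, j] k)) = ![ρ i, ρ j] := by funext k; fin_cases k <;> rfl
  exact iff_of_eq (congrArg (· ∈ _) this)

theorem eval_val {i j : Fin 20} : (val i j).eval x T ρ ↔ rel2 (T .val) (ρ i) (ρ j) := by
  have : (fun k => ρ (![i, j] k)) = ![ρ i, ρ j] := by funext k; fin_cases k <;> rfl
  exact iff_of_eq (congrArg (· ∈ _) this)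

theorem eval_ticksDef (h : ρ 19 = 0) :
    ticksDef.eval x T ρ ↔ ticksRec x (rel2 (T .ticks)) (ρ 6) (ρ 7) := by
  simp [ticksDef, ticksRec, eval_or, eval_ex, eval_and, eval_succ, eval_sym, eval_neg, eval_eq,
    eval_ticks, h]

theorem eval_prevDef :
    prevDef.eval x T ρ ↔ prevRec x (rel2 (T .prev)) (ρ 6) (ρ 7) := by
  simp [prevDef, prevRec, eval_or, eval_ex, eval_and, eval_succ, eval_sym, eval_neg, eval_all,
    eval_imp, eval_lt, eval_prev]

theorem eval_nxtDef :
    nxtDef.eval x T ρ ↔ nxtCond (ρ 1) (ρ 4) (ρ 11) (ρ 12) := by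
  simp [nxtDef, nxtCond, eval_or, eval_and, eval_succ, eval_lt, eval_eq]

theorem eval_untlDef :
    untlDef.eval x T ρ ↔
      untlCond (ρ 1) (ρ 4) (rel2 (T .val) (ρ 9)) (rel2 (T .val) (ρ 8)) (ρ 11) := by
  simp [untlDef, untlCond, eval_or, eval_ex, eval_and, eval_neg, eval_all, eval_imp, eval_lt,
    eval_val]

theorem eval_valDef :
    valDef.eval x T ρ ↔ valRec x (ρ 1) (ρ 4) (rel2 (T .word)) (rel2 (T .ticks)) (rel2 (T .prev))
      (rel2 (T .val)) (ρ 6) (ρ 11) := by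
  simp [valDef, valRec, eval_or, eval_ex, eval_and, eval_succ, eval_neg, eval_lt, eval_sym,
    eval_ticks, eval_word, eval_prev, eval_val, eval_nxtDef, eval_untlDef]

/-- The numbers `s`, `s'`, `k`, `l`, `e` are the positions of the two separators, the number of
propositions, the start of the loop, and the position of the last symbol, which represents the whole
formula. -/
theorem eval_main :
    main.eval x T (fun _ => 0) ↔ ∃ s s' k l e : Fin (x.length + 1),
      x[(s : ℕ)]? = some .sep ∧ x[(s' : ℕ)]? = some .sep ∧ s < s' ∧ rel2 (T .ticks) s' k ∧ l < s ∧
      (∀ t i, rel2 (T .word) t i → t < s ∧ i < k) ∧ (∀ t, rel1 (T .loop) t ↔ t = l) ∧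
      (∀ p, rel2 (T .ticks) p = ticksRec x (rel2 (T .ticks)) p) ∧
      (∀ p, rel2 (T .prev) p = prevRec x (rel2 (T .prev)) p) ∧
      (∀ p, rel2 (T .val) p = valRec x s l (rel2 (T .word)) (rel2 (T .ticks)) (rel2 (T .prev))
        (rel2 (T .val)) p) ∧
      (e : ℕ) + 1 = x.length ∧ rel2 (T .val) e 0 := by
  have key : ∀ e : Fin (x.length + 1), (∃ a : Fin (x.length + 1), (a : ℕ) = e + 1 ∧
      ∀ b : Fin (x.length + 1), b ≤ a) ↔ (e : ℕ) + 1 = x.length := by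
    intro e
    constructor
    · rintro ⟨a, h1, h2⟩
      have := h2 (Fin.last _)
      rw [Fin.le_def, Fin.val_last] at this
      omega
    · intro h
      exact ⟨Fin.last _, by simp [h], Fin.le_last⟩
  simp [main, eval_ex, eval_and, eval_sym, eval_lt, eval_ticks, eval_all, eval_imp, eval_word,
    eval_iff, eval_loop, eval_eq, eval_prev, eval_val, eval_succ, eval_neg, eval_ticksDef,
    eval_prevDef, eval_valDef, funext_iff, key]

end LFml

end LTLFormula

end LassoDensity

namespace LassoDensity

open Function

theorem getElem?_mid {α : Type} {x a b : List α} {c : α} {p : ℕ} (h : x = a ++ c :: b)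
    (hp : p = a.length) : x[p]? = some c := by
  subst h hp
  simp

/-- Two sets are equinumerous if a relation assigns to each element of the first one exactly one
element of the second one, and conversely. -/
theorem ncard_eq_of_existsUnique {A B : Type} (S : A → B → Prop) (P : A → Prop) (Q : B → Prop)
    (h1 : ∀ a, ∃! b, S a b) (h2 : ∀ a a' b, S a b → S a' b → a = a')
    (h3 : ∀ b, Q b ↔ ∃ a, S a b ∧ P a) : {b | Q b}.ncard = {a | P a}.ncard := by
  choose f hf hf' using h1
  symm
  refine Set.ncard_congr (fun a _ => f a) (fun a ha => (h3 _).2 ⟨a, hf a, ha⟩) ?_ ?_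
  · intro a a' _ _ h
    exact h2 a a' (f a) (hf a) (h ▸ hf a')
  · intro b hb
    obtain ⟨a, ha, hP⟩ := (h3 b).1 hb
    exact ⟨a, hP, (hf' a b ha).symm⟩

/-! ### The encoding of LTL formulas -/

section LTLCode

variable {k : ℕ}

/-- A formula does not end with a tick; so the ticks before the symbol of a proposition are exactly
those of its index. -/
theorem LTL.exists_code_eq (φ : LTL (Fin k)) : ∃ u c, φ.code = u ++ [c] ∧ c ≠ .tick := by
  cases φ with
  | tt => exact ⟨[], _, rfl, by simp⟩
  | _ => exact ⟨_, _, rfl, by simp⟩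

theorem LTL.sep_notMem_code (φ : LTL (Fin k)) : LTLSymbol.sep ∉ φ.code := by
  induction φ with
  | _ => simp_all [LTL.code]

theorem encodeLTL_sep (φ : LTL (Fin k)) (n p : ℕ) :
    (encodeLTL φ n)[p]? = some .sep ↔ p = n ∨ p = n + 1 + k := by
  constructor
  · intro h
    have h1 := h
    simp only [encodeLTL, List.getElem?_append, List.length_append, List.length_replicate,
      List.length_cons, List.length_nil] at h
    split_ifs at h with h2 h3 h4 h5
    · simp [List.getElem?_replicate] at h
    · omega
    · simp [List.getElem?_replicate] at h
    · omega
    · exact absurd (List.mem_of_getElem? h) φ.sep_notMem_code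
  · rintro (rfl | rfl)
    · exact getElem?_mid (a := List.replicate p .tick)
        (b := List.replicate k .tick ++ [.sep] ++ φ.code) (by simp [encodeLTL]) (by simp)
    · exact getElem?_mid (a := List.replicate n .tick ++ [.sep] ++ List.replicate k .tick)
        (b := φ.code) (by simp [encodeLTL]) (by simp; omega)

theorem length_encodeLTL (φ : LTL (Fin k)) (n : ℕ) :
    (encodeLTL φ n).length = n + 1 + k + 1 + φ.code.length := by
  simp [encodeLTL]
  omega

end LTLCode

/-! ### Correctness of the recursion for LTL formulas -/

section LTLCorrect

variable {x : List LTLSymbol} {N : ℕ}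

/-- Within a block of ticks that begins at the position `a`, the relation `ticks` gives the offset
from `a`. -/
theorem ticksRec_iff {r : Fin N → Fin N → Prop} (hr : ∀ p, r p = ticksRec x r p)
    (a i : ℕ) (h0 : ∀ d, a = d + 1 → x[d]? ≠ some .tick)
    (h1 : ∀ j < i, x[a + j]? = some .tick) (p : Fin N) (hp : (p : ℕ) = a + i) (j : Fin N) :
    r p j ↔ (j : ℕ) = i := by
  induction i generalizing p j with
  | zero =>
    rw [hr p]
    have h2 : ¬ ∃ d : Fin N, (p : ℕ) = d + 1 ∧ x[(d : ℕ)]? = some .tick := by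
      rintro ⟨d, h3, h4⟩
      exact h0 d (by omega) h4
    constructor
    · rintro (⟨d, h3, h4, _⟩ | h)
      · exact absurd ⟨d, h3, h4⟩ h2
      · exact h.1
    · exact fun h => Or.inr ⟨h, h2⟩
  | succ i ih =>
    rw [hr p]
    have h2 : x[a + i]? = some .tick := h1 i (by omega)
    constructor
    · rintro (⟨d, h3, h4, j', h5, h6⟩ | ⟨_, h⟩)
      · have := (ih (fun j hj => h1 j (by omega)) d (by omega) j').1 h6
        omega
      · exact absurd ⟨⟨a + i, by omega⟩, by simp only; omega, h2⟩ h
    · intro h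
      refine Or.inl ⟨⟨a + i, by omega⟩, by simp only; omega, h2, ⟨i, by omega⟩,
        by simp only; omega, ?_⟩
      exact (ih (fun j hj => h1 j (by omega)) _ rfl _).2 rfl

variable {k n : ℕ}

/-- The defining equation of the relation `val` expresses the semantics of LTL on the lasso. -/
theorem valRec_iff {word ticks prev val : Fin (x.length + 1) → Fin (x.length + 1) → Prop}
    (s l : Fin (x.length + 1)) (hs : (s : ℕ) = n) (l' : Fin n) (hl : (l : ℕ) = l')
    (w : Fin n → Set (Fin k))
    (hword : ∀ t i, word t i ↔ ∃ (ht : (t : ℕ) < n) (hi : (i : ℕ) < k),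
      (⟨i, hi⟩ : Fin k) ∈ w ⟨t, ht⟩)
    (hticks : ∀ p, ticks p = ticksRec x ticks p) (hprev : ∀ p, prev p = prevRec x prev p)
    (hval : ∀ p, val p = valRec x s l word ticks prev val p)
    (ψ : LTL (Fin k)) (pre post : List LTLSymbol) (c : LTLSymbol) (hc : c ≠ .tick)
    (hx : x = pre ++ c :: (ψ.code ++ post)) (p : Fin (x.length + 1))
    (hp : (p : ℕ) = pre.length + ψ.code.length) :
    (∀ q, prev p q ↔ (q : ℕ) = pre.length) ∧
      ∀ t, val p t ↔ (t : ℕ) < n ∧ LTL.Sat (lword l' w) t ψ := by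
  have hN : x.length + 1 = pre.length + ψ.code.length + post.length + 2 := by
    conv_lhs => rw [hx]
    simp
    omega
  induction ψ generalizing pre post c p with
  | tt =>
    have h1 : x[(p : ℕ)]? = some .tt :=
      getElem?_mid (a := pre ++ [c]) (b := post) (by simp [hx, LTL.code]) (by simp [hp, LTL.code])
    simp only [LTL.code, List.length_singleton] at hp
    refine ⟨fun q => ?_, fun t => ?_⟩
    · rw [hprev p]
      simp only [prevRec, h1, Option.some.injEq, reduceCtorEq, false_and, or_self, and_false,
        exists_false, or_false, true_and]
      omega
    · rw [hval p]
      simp only [valRec, h1, LTL.Sat, true_or, and_true, Fin.lt_def, hs]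
  | atom a =>
    have h1 : x[(p : ℕ)]? = some .atom :=
      getElem?_mid (a := pre ++ c :: List.replicate a .tick) (b := post) (by simp [hx, LTL.code])
        (by simp [hp, LTL.code])
    simp only [LTL.code, List.length_append, List.length_replicate, List.length_singleton] at hp hN
    have h2 : ∀ j < (a : ℕ), x[pre.length + 1 + j]? = some .tick := by
      intro j hj
      subst hx
      simp only [LTL.code]
      rw [List.getElem?_append_right (by omega)]
      have : pre.length + 1 + j - pre.length = j + 1 := by omega
      rw [this, List.getElem?_cons_succ, List.append_assoc, List.getElem?_append_left (by simpa),
        List.getElem?_replicate, if_pos hj]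
    have h3 : x[pre.length]? = some c := getElem?_mid hx rfl
    refine ⟨fun q => ?_, fun t => ?_⟩
    · rw [hprev p]
      simp only [prevRec, h1, Option.some.injEq, reduceCtorEq, false_and, or_self, and_false,
        exists_false, or_false, true_and, false_or]
      constructor
      · rintro ⟨h4, h5, h6⟩
        by_contra h7
        rcases Nat.lt_or_gt_of_ne h7 with h8 | h8
        · have := h6 ⟨pre.length, by omega⟩ h8 (by rw [Fin.lt_def]; simp only; omega)
          simp only [h3, Option.some.injEq] at this
          exact hc this
        · have h9 := h2 (q - (pre.length + 1)) (by omega)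
          rw [show pre.length + 1 + (q - (pre.length + 1)) = (q : ℕ) by omega] at h9
          exact h5 h9
      · intro h4
        refine ⟨by omega, by rw [h4, h3]; simpa using hc, fun m hm hm' => ?_⟩
        have h9 := h2 (m - (pre.length + 1)) (by omega)
        rwa [show pre.length + 1 + (m - (pre.length + 1)) = (m : ℕ) by omega] at h9
    · have h5 := ticksRec_iff hticks (pre.length + 1) a
        (fun d hd => by
          obtain rfl : pre.length = d := by omega
          rw [h3]
          simpa using hc) h2 p (by omega)
      rw [hval p]
      simp only [valRec, h1, LTL.Sat, Option.some.injEq, reduceCtorEq, false_and, or_self, and_false,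
        exists_false, or_false, true_and, false_or, Fin.lt_def, hs, h5, hword]
      refine and_congr_right fun ht => ?_
      rw [lword, show idx l' t = ⟨t, ht⟩ from Fin.ext (idx_of_lt l' ht)]
      constructor
      · rintro ⟨i, hi, _, _, h6⟩
        convert h6 using 1
        exact Fin.ext hi.symm
      · intro h6
        exact ⟨⟨a, by omega⟩, rfl, ht, a.2, h6⟩
  | neg ψ ih =>
    have h1 : x[(p : ℕ)]? = some .neg :=
      getElem?_mid (a := pre ++ c :: ψ.code) (b := post) (by simp [hx, LTL.code])
        (by simp only [hp, LTL.code, List.length_append, List.length_cons, List.length_nil])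
    simp only [LTL.code, List.length_append, List.length_singleton] at hp hN
    obtain ⟨ih1, ih2⟩ := ih pre ([.neg] ++ post) c hc (by simp [hx, LTL.code])
      ⟨pre.length + ψ.code.length, by omega⟩ rfl
      (by simp only [List.length_append, List.length_singleton]; omega)
    have hd : ∀ d : Fin (x.length + 1), (p : ℕ) = d + 1 ↔
        d = ⟨pre.length + ψ.code.length, by omega⟩ := by
      intro d
      rw [Fin.ext_iff]
      simp only
      omega
    refine ⟨fun q => ?_, fun t => ?_⟩
    · rw [hprev p]
      simp only [prevRec, h1, Option.some.injEq, reduceCtorEq, false_and, or_self,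
        or_false, true_and, false_or, hd, exists_eq_left, ih1]
    · rw [hval p]
      simp only [valRec, h1, LTL.Sat, Option.some.injEq, reduceCtorEq, false_and, or_self, and_false,
        exists_false, or_false, true_and, false_or, hd, exists_eq_left, ih2, Fin.lt_def, hs]
      tauto
  | next ψ ih =>
    have h1 : x[(p : ℕ)]? = some .next :=
      getElem?_mid (a := pre ++ c :: ψ.code) (b := post) (by simp [hx, LTL.code])
        (by simp only [hp, LTL.code, List.length_append, List.length_cons, List.length_nil])
    simp only [LTL.code, List.length_append, List.length_singleton] at hp hN
    obtain ⟨ih1, ih2⟩ := ih pre ([.next] ++ post) c hc (by simp [hx, LTL.code])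
      ⟨pre.length + ψ.code.length, by omega⟩ rfl
      (by simp only [List.length_append, List.length_singleton]; omega)
    have hd : ∀ d : Fin (x.length + 1), (p : ℕ) = d + 1 ↔
        d = ⟨pre.length + ψ.code.length, by omega⟩ := by
      intro d
      rw [Fin.ext_iff]
      simp only
      omega
    refine ⟨fun q => ?_, fun t => ?_⟩
    · rw [hprev p]
      simp only [prevRec, h1, Option.some.injEq, reduceCtorEq, false_and, or_self,
        or_false, true_and, false_or, hd, exists_eq_left, ih1]
    · rw [hval p]
      simp only [valRec, h1, LTL.Sat, Option.some.injEq, reduceCtorEq, false_and, or_self, and_false,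
        exists_false, or_false, true_and, false_or, hd, exists_eq_left, ih2, Fin.lt_def, hs]
      refine and_congr_right fun ht => ?_
      have hl' := l'.2
      have e := sat_lword_loop l' w ψ 0
      simp only [add_zero] at e
      constructor
      · rintro ⟨t', (⟨h2, h3⟩ | ⟨h2, h3⟩), h4, h5⟩
        · rwa [h2] at h5
        · rw [h3, hl, ← e] at h5
          rwa [← h2, hs]
      · intro h2
        by_cases h3 : (t : ℕ) + 1 < n
        · exact ⟨⟨t + 1, by omega⟩, Or.inl ⟨rfl, by rw [Fin.lt_def]; simp only; omega⟩, h3, h2⟩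
        · have h4 : (t : ℕ) + 1 = n := by omega
          rw [h4, e] at h2
          exact ⟨l, Or.inr ⟨by omega, rfl⟩, by omega, by rwa [hl]⟩
  | conj φ ψ ihφ ihψ =>
    have h1 : x[(p : ℕ)]? = some .conj :=
      getElem?_mid (a := pre ++ c :: (φ.code ++ ψ.code)) (b := post) (by simp [hx, LTL.code])
        (by simp only [hp, LTL.code, List.length_append, List.length_cons, List.length_nil])
    simp only [LTL.code, List.length_append, List.length_singleton] at hp hN
    obtain ⟨u, c', hu, hc'⟩ := φ.exists_code_eq
    have hul : φ.code.length = u.length + 1 := by simp [hu]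
    obtain ⟨ih1, ih2⟩ := ihφ pre (ψ.code ++ [.conj] ++ post) c hc (by simp [hx, LTL.code])
      ⟨pre.length + φ.code.length, by omega⟩ rfl
      (by simp only [List.length_append, List.length_singleton]; omega)
    obtain ⟨ih3, ih4⟩ := ihψ (pre ++ c :: u) ([.conj] ++ post) c' hc'
      (by simp [hx, LTL.code, hu])
      ⟨pre.length + φ.code.length + ψ.code.length, by omega⟩ (by simp; omega)
      (by simp only [List.length_append, List.length_cons, List.length_nil]; omega)
    have hd : ∀ d : Fin (x.length + 1), (p : ℕ) = d + 1 ↔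
        d = ⟨pre.length + φ.code.length + ψ.code.length, by omega⟩ := by
      intro d
      rw [Fin.ext_iff]
      simp only
      omega
    have hm : ∀ m : Fin (x.length + 1), (m : ℕ) = (pre ++ c :: u).length ↔
        m = ⟨pre.length + φ.code.length, by omega⟩ := by
      intro d
      rw [Fin.ext_iff]
      simp
      omega
    have hmp : (⟨pre.length + φ.code.length, by omega⟩ : Fin (x.length + 1)) < p := by
      rw [Fin.lt_def]
      simp only
      omega
    have hex : ∀ R : Fin (x.length + 1) → Prop, (∃ m, m < p ∧
        m = ⟨pre.length + φ.code.length, by omega⟩ ∧ R m) ↔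
        R ⟨pre.length + φ.code.length, by omega⟩ := fun R =>
      ⟨fun ⟨m, _, h2, h3⟩ => h2 ▸ h3, fun h2 => ⟨_, hmp, rfl, h2⟩⟩
    refine ⟨fun q => ?_, fun t => ?_⟩
    · rw [hprev p]
      simp only [prevRec, h1, Option.some.injEq, reduceCtorEq, false_and, or_self,
        or_false, true_and, false_or, hd, exists_eq_left, ih3, hm, hex, ih1]
    · rw [hval p]
      simp only [valRec, h1, LTL.Sat, Option.some.injEq, reduceCtorEq, false_and,
        or_false, true_and, false_or, hd, exists_eq_left, ih3, hm, hex, ih2, ih4]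
      simp only [Fin.lt_def, hs]
      tauto
  | untl φ ψ ihφ ihψ =>
    have h1 : x[(p : ℕ)]? = some .untl :=
      getElem?_mid (a := pre ++ c :: (φ.code ++ ψ.code)) (b := post) (by simp [hx, LTL.code])
        (by simp only [hp, LTL.code, List.length_append, List.length_cons, List.length_nil])
    simp only [LTL.code, List.length_append, List.length_singleton] at hp hN
    obtain ⟨u, c', hu, hc'⟩ := φ.exists_code_eq
    have hul : φ.code.length = u.length + 1 := by simp [hu]
    obtain ⟨ih1, ih2⟩ := ihφ pre (ψ.code ++ [.untl] ++ post) c hc (by simp [hx, LTL.code])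
      ⟨pre.length + φ.code.length, by omega⟩ rfl
      (by simp only [List.length_append, List.length_singleton]; omega)
    obtain ⟨ih3, ih4⟩ := ihψ (pre ++ c :: u) ([.untl] ++ post) c' hc'
      (by simp [hx, LTL.code, hu])
      ⟨pre.length + φ.code.length + ψ.code.length, by omega⟩ (by simp; omega)
      (by simp only [List.length_append, List.length_cons, List.length_nil]; omega)
    have hd : ∀ d : Fin (x.length + 1), (p : ℕ) = d + 1 ↔
        d = ⟨pre.length + φ.code.length + ψ.code.length, by omega⟩ := by
      intro d
      rw [Fin.ext_iff]
      simp only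
      omega
    have hm : ∀ m : Fin (x.length + 1), (m : ℕ) = (pre ++ c :: u).length ↔
        m = ⟨pre.length + φ.code.length, by omega⟩ := by
      intro d
      rw [Fin.ext_iff]
      simp
      omega
    have hmp : (⟨pre.length + φ.code.length, by omega⟩ : Fin (x.length + 1)) < p := by
      rw [Fin.lt_def]
      simp only
      omega
    have hex : ∀ R : Fin (x.length + 1) → Prop, (∃ m, m < p ∧
        m = ⟨pre.length + φ.code.length, by omega⟩ ∧ R m) ↔
        R ⟨pre.length + φ.code.length, by omega⟩ := fun R =>
      ⟨fun ⟨m, _, h2, h3⟩ => h2 ▸ h3, fun h2 => ⟨_, hmp, rfl, h2⟩⟩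
    refine ⟨fun q => ?_, fun t => ?_⟩
    · rw [hprev p]
      simp only [prevRec, h1, Option.some.injEq, reduceCtorEq, false_and, or_self,
        true_and, false_or, hd, exists_eq_left, ih3, hm, hex, ih1]
    · rw [hval p, and_comm (a := (t : ℕ) < n), sat_untl_lword]
      simp only [valRec, h1, Option.some.injEq, reduceCtorEq, false_and,
        true_and, false_or, hd, exists_eq_left, ih3, hm, hex]
      simp only [Fin.lt_def, hs, untlCond, Fin.le_def, ih2, ih4, hl]
      have hl' := l'.2
      refine and_congr_right fun ht => or_congr ?_ (and_congr ?_ ?_)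
      · constructor
        · rintro ⟨t', h2, h3, ⟨h4, h5⟩, h6⟩
          exact ⟨t', by omega, h3, h5, fun m hm hm' => (h6 ⟨m, by omega⟩ hm hm').2⟩
        · rintro ⟨t', h2, h3, h4, h5⟩
          exact ⟨⟨t', by omega⟩, by omega, h3, ⟨h3, h4⟩, fun m hm hm' =>
            ⟨by simp only at hm'; omega, h5 m hm hm'⟩⟩
      · constructor
        · intro h2 m hm hm'
          exact (h2 ⟨m, by omega⟩ hm hm').2
        · intro h2 m hm hm'
          exact ⟨hm', h2 m hm hm'⟩
      · constructor
        · rintro ⟨t', h2, h3, ⟨h4, h5⟩, h6⟩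
          exact ⟨t', by omega, h3, h5, fun m hm hm' => (h6 ⟨m, by omega⟩ hm hm').2⟩
        · rintro ⟨t', h2, h3, h4, h5⟩
          exact ⟨⟨t', by omega⟩, by omega, h3, ⟨h3, h4⟩, fun m hm hm' =>
            ⟨by simp only at hm'; omega, h5 m hm hm'⟩⟩

end LTLCorrect

end LassoDensity

namespace LassoDensity

open Function

/-! ### Counting the models of LTL formulas -/

section LTLCounting

variable {k n : ℕ}

/-- The tables `T` describe the lasso with the letters `w` and the start `l` of the loop, and the
evaluation of the formula in the input `x` on this lasso. -/
def IsLTLTables (x : List LTLSymbol) (a : Fin n × (Fin n → Set (Fin k)))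
    (T : Tables LRel LRel.ar x.length) : Prop :=
  (∀ t i, rel2 (T .word) t i ↔ ∃ (ht : (t : ℕ) < n) (hi : (i : ℕ) < k),
    (⟨i, hi⟩ : Fin k) ∈ a.2 ⟨t, ht⟩) ∧ (∀ t, rel1 (T .loop) t ↔ (t : ℕ) = a.1) ∧
  (∀ p, rel2 (T .ticks) p = ticksRec x (rel2 (T .ticks)) p) ∧
  (∀ p, rel2 (T .prev) p = prevRec x (rel2 (T .prev)) p) ∧
  ∃ s l : Fin (x.length + 1), (s : ℕ) = n ∧ (l : ℕ) = a.1 ∧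
    ∀ p, rel2 (T .val) p = valRec x s l (rel2 (T .word)) (rel2 (T .ticks)) (rel2 (T .prev))
        (rel2 (T .val)) p

/-- The table of a unary relation. -/
def tab1 {L : ℕ} (r : Fin (L + 1) → Prop) : Set (Fin 1 → Fin (L + 1)) := {v | r (v 0)}

/-- The table of a binary relation. -/
def tab2 {L : ℕ} (r : Fin (L + 1) → Fin (L + 1) → Prop) : Set (Fin 2 → Fin (L + 1)) :=
  {v | r (v 0) (v 1)}

theorem rel1_tab1 {L : ℕ} (r : Fin (L + 1) → Prop) : rel1 (tab1 r) = r := rfl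

theorem rel2_tab2 {L : ℕ} (r : Fin (L + 1) → Fin (L + 1) → Prop) : rel2 (tab2 r) = r := rfl

/-- The tables are determined by the lasso: the letters and the start of the loop directly, and the
other relations by recursion on the first argument. -/
theorem existsUnique_isLTLTables {x : List LTLSymbol} (hx : n ≤ x.length)
    (a : Fin n × (Fin n → Set (Fin k))) : ∃! T, IsLTLTables x a T := by
  have ha := a.1.2
  have hn : n < x.length + 1 := by omega
  have hl₀ : (a.1 : ℕ) < x.length + 1 := by omega
  obtain ⟨tk, htk, htk'⟩ := existsUnique_rec (ticksRec (N := x.length + 1) x) (ticksRec_local x)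
  obtain ⟨pv, hpv, hpv'⟩ := existsUnique_rec (prevRec (N := x.length + 1) x) (prevRec_local x)
  let wd : Fin (x.length + 1) → Fin (x.length + 1) → Prop := fun t i =>
    ∃ (ht : (t : ℕ) < n) (hi : (i : ℕ) < k), (⟨i, hi⟩ : Fin k) ∈ a.2 ⟨t, ht⟩
  let lp : Fin (x.length + 1) → Prop := fun t => (t : ℕ) = a.1
  obtain ⟨vl, hvl, hvl'⟩ := existsUnique_rec
    (valRec x ⟨n, hn⟩ ⟨a.1, hl₀⟩ wd tk pv) (valRec_local x _ _ wd tk pv)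
  let T₀ : Tables LRel LRel.ar x.length := fun
    | .word => tab2 wd
    | .loop => tab1 lp
    | .ticks => tab2 tk
    | .prev => tab2 pv
    | .val => tab2 vl
  refine ⟨T₀, ⟨fun t i => Iff.rfl, fun t => Iff.rfl, htk, hpv, _, _, rfl, rfl, hvl⟩, ?_⟩
  rintro T ⟨h1, h2, h3, h4, s, l, hs, hl, h5⟩
  obtain rfl : s = ⟨n, hn⟩ := Fin.ext hs
  obtain rfl : l = ⟨a.1, hl₀⟩ := Fin.ext hl
  have e1 : rel2 (T .word) = wd := by
    funext t i
    exact propext (h1 t i)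
  have e2 : rel1 (T .loop) = lp := by
    funext t
    exact propext (h2 t)
  have e3 := htk' _ h3
  have e4 := hpv' _ h4
  rw [e1, e3, e4] at h5
  have e5 := hvl' _ h5
  funext g
  cases g with
  | word => exact rel2_inj (by rw [e1, rel2_tab2])
  | loop => exact rel1_inj (by rw [e2, rel1_tab1])
  | ticks => exact rel2_inj (by rw [e3, rel2_tab2])
  | prev => exact rel2_inj (by rw [e4, rel2_tab2])
  | val => exact rel2_inj (by rw [e5, rel2_tab2])

theorem isLTLTables_inj {x : List LTLSymbol} (hx : n ≤ x.length) (hk : k ≤ x.length)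
    {a a' : Fin n × (Fin n → Set (Fin k))} {T : Tables LRel LRel.ar x.length}
    (h : IsLTLTables x a T) (h' : IsLTLTables x a' T) : a = a' := by
  obtain ⟨h1, h2, -⟩ := h
  obtain ⟨h1', h2', -⟩ := h'
  have ha := a.1.2
  refine Prod.ext (Fin.ext ?_) (funext fun t => Set.ext fun i => ?_)
  · exact (h2' ⟨a.1, by omega⟩).1 ((h2 ⟨a.1, by omega⟩).2 rfl)
  · have e := (h1 ⟨t, by omega⟩ ⟨i, by omega⟩).symm.trans (h1' ⟨t, by omega⟩ ⟨i, by omega⟩)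
    simpa using e

/-- The first-order sentence holds for the tables that describe the models of the formula. -/
theorem eval_main_encodeLTL (φ : LTL (Fin k)) (T : Tables LRel LRel.ar (encodeLTL φ n).length) :
    LFml.main.eval (encodeLTL φ n) T (fun _ => 0) ↔
      ∃ a : Fin n × (Fin n → Set (Fin k)), IsLTLTables (encodeLTL φ n) a T ∧
        lword a.1 a.2 ∈ φ.language := by
  have hlen := length_encodeLTL φ n
  obtain ⟨u, c, hu, -⟩ := φ.exists_code_eq
  have hul : φ.code.length = u.length + 1 := by simp [hu]
  have hx : encodeLTL φ n = (List.replicate n LTLSymbol.tick ++ [.sep] ++ List.replicate k .tick) ++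
      LTLSymbol.sep :: (φ.code ++ []) := by simp [encodeLTL]
  have hpre :
      (List.replicate n LTLSymbol.tick ++ [LTLSymbol.sep] ++
      List.replicate k LTLSymbol.tick).length =
      n + 1 + k := by simp; omega
  -- the number of propositions is the length of the block of ticks before the second separator
  have hk : ∀ {r : Fin ((encodeLTL φ n).length + 1) → Fin ((encodeLTL φ n).length + 1) → Prop},
      (∀ p, r p = ticksRec (encodeLTL φ n) r p) →
        ∀ s' j : Fin ((encodeLTL φ n).length + 1), (s' : ℕ) = n + 1 + k →
        (r s' j ↔ (j : ℕ) = k) := by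
    intro r hr s' j hs'
    refine ticksRec_iff hr (n + 1) k ?_ ?_ s' hs' j
    · intro d hd
      obtain rfl : n = d := by omega
      rw [(encodeLTL_sep φ n n).2 (Or.inl rfl)]
      simp
    · intro j hj
      rw [hx, List.getElem?_append_left (by omega), List.getElem?_append_right (by simp)]
      simp [hj]
  rw [LFml.eval_main]
  constructor
  · rintro ⟨s, s', k', l, e, h1, h2, h3, h4, h5, h6, h7, h8, h9, h10, h11, h12⟩
    rw [encodeLTL_sep] at h1 h2
    have hs : (s : ℕ) = n := by omega
    have hs' : (s' : ℕ) = n + 1 + k := by omega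
    have hk' := (hk h8 s' k' hs').1 h4
    have hl : (l : ℕ) < n := by omega
    let w : Fin n → Set (Fin k) := fun t =>
      {i | rel2 (T .word) ⟨t, by omega⟩ ⟨i, by omega⟩}
    have hw : ∀ t i, rel2 (T .word) t i ↔ ∃ (ht : (t : ℕ) < n) (hi : (i : ℕ) < k),
        (⟨i, hi⟩ : Fin k) ∈ w ⟨t, ht⟩ := by
      intro t i
      constructor
      · intro h
        have := h6 t i h
        exact ⟨by omega, by omega, h⟩
      · rintro ⟨_, _, h⟩
        exact h
    have h13 := (valRec_iff s l hs ⟨l, hl⟩ rfl w hw h8 h9 h10 φ _ [] .sep (by simp) hx e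
      (by rw [hpre]; omega)).2 0
    refine ⟨⟨⟨l, hl⟩, w⟩, ⟨hw, fun t => ?_, h8, h9, s, l, hs, rfl, h10⟩, (h13.1 h12).2⟩
    rw [h7, Fin.ext_iff]
  · rintro ⟨a, ⟨h1, h2, h3, h4, s, l, hs, hl, h5⟩, h6⟩
    have ha := a.1.2
    have h13 := (valRec_iff s l hs a.1 hl a.2 h1 h3 h4 h5 φ _ [] .sep (by simp) hx
      ⟨n + 1 + k + φ.code.length, by omega⟩ (by rw [hpre])).2 0
    refine ⟨s, ⟨n + 1 + k, by omega⟩, ⟨k, by omega⟩, l, ⟨n + 1 + k + φ.code.length, by omega⟩,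
      ?_, ?_, ?_, ?_, ?_, ?_, ?_, h3, h4, h5, ?_, ?_⟩
    · rw [encodeLTL_sep]
      exact Or.inl hs
    · rw [encodeLTL_sep]
      exact Or.inr rfl
    · rw [Fin.lt_def]
      simp only
      omega
    · exact (hk h3 _ _ rfl).2 rfl
    · omega
    · intro t i h
      obtain ⟨ht, hi, -⟩ := (h1 t i).1 h
      rw [Fin.lt_def, Fin.lt_def]
      exact ⟨by omega, hi⟩
    · intro t
      rw [h2, Fin.ext_iff, hl]
    · simp only
      omega
    · exact h13.2 ⟨by rw [Fin.val_zero]; omega, h6⟩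

/-- Counting the models of LTL formulas is in #P. -/
theorem exists_sharpP_LTL : ∃ f ∈ SharpP LTLSymbol, ∀ (k : ℕ) (φ : LTL (Fin k)) (n : ℕ),
    f (encodeLTL φ n) = numModels φ.language n := by
  refine ⟨_, card_tables_mem_sharpP LFml.main LFml.wf_main, fun k φ n => ?_⟩
  have hlen := length_encodeLTL φ n
  rw [numModels_eq]
  exact ncard_eq_of_existsUnique (IsLTLTables (encodeLTL φ n)) _ _
    (existsUnique_isLTLTables (by omega))
    (fun _ _ _ => isLTLTables_inj (by omega) (by omega)) (eval_main_encodeLTL φ)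

end LTLCounting

end LassoDensity

namespace LassoDensity

open Function Relation

/-! ### Reachability by bounded paths -/

section Reachability

variable {X : Type} (R : X → X → Prop)

/-- Reachability by paths with at most `k` edges. -/
def Within : ℕ → X → X → Prop
  | 0, u, v => u = v
  | k + 1, u, v => Within k u v ∨ ∃ w, Within k u w ∧ R w v

theorem within_add (a b : ℕ) (u v : X) :
    Within R (a + b) u v ↔ ∃ w, Within R a u w ∧ Within R b w v := by
  induction b generalizing v with
  | zero => simp [Within]
  | succ b ih =>
    rw [← add_assoc]
    simp only [Within, ih]
    constructor
    · rintro (⟨w, h1, h2⟩ | ⟨w, ⟨w', h1, h2⟩, h3⟩)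
      · exact ⟨w, h1, Or.inl h2⟩
      · exact ⟨w', h1, Or.inr ⟨w, h2, h3⟩⟩
    · rintro ⟨w', h1, (h2 | ⟨w, h2, h3⟩)⟩
      · exact Or.inl ⟨w', h1, h2⟩
      · exact Or.inr ⟨w, ⟨w', h1, h2⟩, h3⟩

theorem Within.reflTransGen {k : ℕ} {u v : X} (h : Within R k u v) : ReflTransGen R u v := by
  induction k generalizing v with
  | zero => exact h ▸ .refl
  | succ k ih =>
    rcases h with h | ⟨w, h1, h2⟩
    · exact ih h
    · exact (ih h1).tail h2

/-- As long as longer paths reach more vertices, each step adds a vertex. -/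
theorem lt_ncard_within_or [Finite X] (u : X) (k : ℕ) :
    k < {v | Within R k u v}.ncard ∨ ∀ v w, Within R k u v → R v w → Within R k u w := by
  induction k with
  | zero => simp [Within]
  | succ k ih =>
    by_cases h : ∀ v, Within R (k + 1) u v → Within R k u v
    · right
      intro v w hv hw
      exact Or.inl (h w (Or.inr ⟨v, h v hv, hw⟩))
    · left
      rcases ih with ih | ih
      · refine lt_of_le_of_lt (Nat.succ_le_of_lt ih) (Set.ncard_lt_ncard ⟨fun v hv => Or.inl hv, ?_⟩)
        exact fun h' => h fun v hv => h' hv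
      · refine absurd (fun v hv => ?_) h
        rcases hv with hv | ⟨w, h1, h2⟩
        · exact hv
        · exact ih w v h1 h2

/-- Paths with at most as many edges as there are vertices suffice for reachability. -/
theorem within_iff_reflTransGen [Finite X] {k : ℕ} (hk : Nat.card X ≤ k) (u v : X) :
    Within R k u v ↔ ReflTransGen R u v := by
  refine ⟨Within.reflTransGen R, fun h => ?_⟩
  have h1 : ∀ v w, Within R k u v → R v w → Within R k u w := by
    refine (lt_ncard_within_or R u k).resolve_left fun h1 => ?_
    have := Set.ncard_le_card {v | Within R k u v}
    omega
  induction h with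
  | refl =>
    clear h1 hk
    induction k with
    | zero => rfl
    | succ k ih => exact Or.inl ih
  | tail _ h2 ih => exact h1 _ _ ih h2

theorem exists_path {R : X → X → Prop} {u v : X} (h : ReflTransGen R u v) :
    ∃ (k : ℕ) (p : ℕ → X), p 0 = u ∧ p k = v ∧ ∀ i < k, R (p i) (p (i + 1)) := by
  induction h with
  | refl => exact ⟨0, fun _ => u, rfl, rfl, by simp⟩
  | @tail v w _ h2 ih =>
    obtain ⟨k, p, h3, h4, h5⟩ := ih
    refine ⟨k + 1, fun i => if i ≤ k then p i else w, by simp [h3], by simp, fun i hi => ?_⟩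
    by_cases h6 : i = k
    · subst h6
      simpa [h4] using h2
    · simp only
      rw [if_pos (by omega), if_pos (by omega)]
      exact h5 i (by omega)

theorem reflTransGen_of_path {R : X → X → Prop} {p : ℕ → X} {i j : ℕ} (hij : i ≤ j)
    (h : ∀ k, i ≤ k → k < j → R (p k) (p (k + 1))) : ReflTransGen R (p i) (p j) := by
  induction j, hij using Nat.le_induction with
  | base => exact .refl
  | succ j hij ih =>
    exact (ih fun k hk hk' => h k hk (by omega)).tail (h j hij (by omega))

end Reachability

/-! ### Acceptance of lassos by parity automata -/

namespace ParityAutomaton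

variable {α Q : Type} (A : ParityAutomaton α Q) {n : ℕ} (l : Fin n) (w : Fin n → α)

/-- The edges of the product of an automaton and a lasso. -/
def Edge (u v : Q × Fin n) : Prop := v.1 ∈ A.trans u.1 (w u.2) ∧ v.2 = nxt l u.2

/-- The edges of the product of an automaton and a lasso between vertices whose color is at most the
color of `f`. -/
def EdgeLE (f : Q) (u v : Q × Fin n) : Prop :=
  (A.color u.1 ≤ A.color f ∧ A.color v.1 ≤ A.color f) ∧ A.Edge l w u v

/-- A lasso is accepted if and only if the product of the automaton and the lasso has a reachable
cycle on which the maximal color is even. -/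
theorem lword_mem_language [Finite Q] : lword l w ∈ A.language ↔
    ∃ q₀ ∈ A.init, ∃ f t, ReflTransGen (A.Edge l w) (q₀, ⟨0, l.pos⟩) (f, t) ∧ Even (A.color f) ∧
      TransGen (A.EdgeLE l w f) (f, t) (f, t) := by
  constructor
  · rintro ⟨r, ⟨h0, h1⟩, c, ⟨⟨f, hf, rfl⟩, h2⟩, h3⟩
    have hE : ∀ i, A.Edge l w (r i, idx l i) (r (i + 1), idx l (i + 1)) :=
      fun i => ⟨h1 i, idx_succ l i⟩
    -- from some time on, the run visits only states that it visits infinitely often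
    obtain ⟨I, hI⟩ : ∃ I, ∀ j, I < j → r j ∈ infStates r := by
      have : ∀ q, ∃ i, q ∉ infStates r → ∀ j, i < j → r j ≠ q := by
        intro q
        by_cases hq : q ∈ infStates r
        · exact ⟨0, fun h => absurd hq h⟩
        · simp only [infStates, Set.mem_ofPred_eq, not_forall, not_exists, not_and] at hq
          obtain ⟨i, hi⟩ := hq
          exact ⟨i, fun _ => hi⟩
      choose b hb using this
      obtain ⟨I, hI⟩ := (Set.finite_range b).bddAbove
      refine ⟨I, fun j hj => ?_⟩
      by_contra h
      exact hb _ h j (lt_of_le_of_lt (hI ⟨r j, rfl⟩) hj) rfl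
    have hinf : {j | I < j ∧ r j = f}.Infinite := by
      rw [Set.infinite_iff_exists_gt]
      intro a
      obtain ⟨j, hj, hj'⟩ := hf (max a I)
      exact ⟨j, ⟨by omega, hj'⟩, by omega⟩
    obtain ⟨i, j, hij, ⟨hi, hi'⟩, ⟨hj, hj'⟩, he⟩ : ∃ i j, i < j ∧ (I < i ∧ r i = f) ∧
        (I < j ∧ r j = f) ∧ idx l i = idx l j := by
      obtain ⟨i, hi, j, hj, hij, he⟩ := hinf.exists_ne_map_eq_of_mapsTo
        (f := idx l) (t := Set.univ) (fun _ _ => Set.mem_univ _) Set.finite_univ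
      rcases Nat.lt_or_gt_of_ne hij with h | h
      · exact ⟨i, j, h, hi, hj, he⟩
      · exact ⟨j, i, h, hj, hi, he.symm⟩
    have hc : ∀ k, I < k → A.color (r k) ≤ A.color f := fun k hk =>
      h2 ⟨r k, hI k hk, rfl⟩
    have hE' : ∀ k, I < k → A.EdgeLE l w f (r k, idx l k) (r (k + 1), idx l (k + 1)) :=
      fun k hk => ⟨⟨hc k hk, hc _ (by omega)⟩, hE k⟩
    have p1 := reflTransGen_of_path (R := A.Edge l w) (p := fun i => (r i, idx l i))
      (Nat.zero_le i) fun k _ _ => hE k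
    have p2 := reflTransGen_of_path (R := A.EdgeLE l w f) (p := fun i => (r i, idx l i))
      (Nat.succ_le_of_lt hij) fun k hk _ => hE' k (by omega)
    have p3 := TransGen.head' (hE' i hi) p2
    refine ⟨r 0, h0, f, idx l i, ?_, h3, ?_⟩
    · rw [← hi']
      exact p1
    · simp only [hj', ← he, hi'] at p3
      exact p3
  · rintro ⟨q₀, hq₀, f, t, h1, h2, h3⟩
    obtain ⟨k, p, hp0, hpk, hp⟩ := exists_path h1
    obtain ⟨v, h4, h5⟩ := TransGen.head'_iff.1 h3
    obtain ⟨k', p', hp0', hpk', hp'⟩ := exists_path h5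
    -- the cycle, as a sequence of period `k' + 1`
    let c : ℕ → Q × Fin n := fun i => if i = 0 then (f, t) else p' (i - 1)
    have hc : ∀ i, i < k' + 1 → A.EdgeLE l w f (c i) (c ((i + 1) % (k' + 1))) := by
      intro i hi
      have hstep : A.EdgeLE l w f (c i) (c (i + 1)) := by
        rcases Nat.eq_zero_or_pos i with rfl | h6
        · simpa [c, hp0'] using h4
        · simp only [c, if_neg h6.ne', Nat.add_sub_cancel, Nat.add_eq_zero_iff, one_ne_zero,
            and_false, if_false]
          have := hp' (i - 1) (by omega)
          rwa [Nat.sub_add_cancel h6] at this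
      by_cases h6 : i = k'
      · subst h6
        rw [Nat.mod_self]
        simpa [c, hpk'] using hstep
      · rwa [Nat.mod_eq_of_lt (by omega)]
    let g : ℕ → Q × Fin n := fun i => if i < k then p i else c ((i - k) % (k' + 1))
    have hgc : ∀ i, k ≤ i → A.EdgeLE l w f (g i) (g (i + 1)) := by
      intro i hi
      simp only [g]
      rw [if_neg (by omega), if_neg (by omega), show i + 1 - k = i - k + 1 by omega,
        ← Nat.mod_add_mod]
      exact hc _ (Nat.mod_lt _ (by omega))
    have hg0 : g 0 = (q₀, ⟨0, l.pos⟩) := by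
      simp only [g]
      split_ifs with h
      · exact hp0
      · obtain rfl : k = 0 := by omega
        simp only [Nat.sub_self, Nat.zero_mod, c, if_true]
        rw [← hpk, hp0]
    have hg : ∀ i, A.Edge l w (g i) (g (i + 1)) := by
      intro i
      by_cases hi : k ≤ i
      · exact (hgc i hi).2
      · have h6 := hp i (by omega)
        simp only [g]
        rw [if_pos (by omega)]
        split_ifs with h7
        · exact h6
        · have h8 : i + 1 = k := by omega
          rw [h8, Nat.sub_self, Nat.zero_mod]
          rw [h8, hpk] at h6
          exact h6
    have hidx : ∀ i, (g i).2 = idx l i := by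
      intro i
      induction i with
      | zero =>
        rw [hg0]
        rfl
      | succ i ih => rw [(hg i).2, ih, idx_succ]
    have hgf : ∀ i, g (k + (k' + 1) * i) = (f, t) := by
      intro i
      simp only [g]
      rw [if_neg (by omega), Nat.add_sub_cancel_left, Nat.mul_mod_right]
      rfl
    refine ⟨fun i => (g i).1, ⟨?_, fun i => ?_⟩, A.color f, ⟨⟨f, fun i => ?_, rfl⟩, ?_⟩, h2⟩
    · simp only [hg0]
      exact hq₀
    · have := (hg i).1
      rwa [hidx] at this
    · refine ⟨k + (k' + 1) * (i + 1), ?_, congrArg Prod.fst (hgf (i + 1))⟩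
      nlinarith
    · rintro _ ⟨q, hq, rfl⟩
      obtain ⟨j, hj, rfl⟩ := hq k
      exact (hgc j hj.le).1.1

end ParityAutomaton

end LassoDensity

namespace LassoDensity

open Function Relation

/-! ### Comparison of binary numbers -/

section BinaryNumbers

/-- The most significant digit in which two numbers differ decides their order. -/
theorem exists_testBit_of_lt {a b : ℕ} (h : a < b) :
    ∃ i, a.testBit i = false ∧ b.testBit i = true ∧ ∀ j, i < j → a.testBit j = b.testBit j := by
  obtain ⟨i, h1, h2⟩ := Nat.exists_most_significant_bit (n := a ^^^ b) (by
    rw [Ne, Nat.xor_eq_zero_iff]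
    exact h.ne)
  rw [Nat.testBit_xor] at h1
  have h3 : ∀ j, i < j → a.testBit j = b.testBit j := by
    intro j hj
    have := h2 j hj
    rw [Nat.testBit_xor] at this
    simpa using this
  refine ⟨i, ?_, ?_, h3⟩
  all_goals
    by_contra h4
    simp only [Bool.not_eq_true, Bool.not_eq_false] at h4
    simp only [h4, Bool.xor_false, Bool.true_xor,
      Bool.not_eq_eq_eq_not, Bool.not_true] at h1
    have := Nat.lt_of_testBit i (n := b) (m := a) (by assumption) (by assumption)
      fun j hj => (h3 j hj).symm
    omega

/-- Comparison of numbers by their binary digits. -/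
theorem le_iff_testBit {a b : ℕ} : a ≤ b ↔ ∀ j, a.testBit j = true → ¬ b.testBit j = true →
    ∃ i, j < i ∧ ¬ a.testBit i = true ∧ b.testBit i = true := by
  constructor
  · intro h j h1 h2
    rcases h.lt_or_eq with h | rfl
    · obtain ⟨i, h3, h4, h5⟩ := exists_testBit_of_lt h
      refine ⟨i, ?_, by simp [h3], h4⟩
      by_contra h6
      rcases Nat.lt_or_eq_of_le (not_lt.1 h6) with h7 | rfl
      · exact h2 (h5 j h7 ▸ h1)
      · exact h2 h4
    · exact absurd h1 h2
  · intro h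
    by_contra h1
    obtain ⟨i, h3, h4, h5⟩ := exists_testBit_of_lt (not_le.1 h1)
    obtain ⟨j, h6, h7, h8⟩ := h i h4 (by simp [h3])
    rw [← h5 j h6] at h7
    exact h7 h8

theorem testBit_eq_getElem?_bits (a j : ℕ) : a.testBit j = true ↔ a.bits[j]? = some true := by
  rw [Nat.testBit_eq_inth, List.getI_eq_getElem?_getD]
  cases h : a.bits[j]? <;> simp [show (default : Bool) = false from rfl]

end BinaryNumbers

/-! ### Recursive description of addition and multiplication -/

section Arithmetic

variable {N : ℕ}

/-- The defining equation of addition, as a ternary relation. -/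
def plusRec (r : Fin N → Fin N → Fin N → Prop) (p q z : Fin N) : Prop :=
  ((p : ℕ) = 0 ∧ z = q) ∨ ∃ p' z' : Fin N, (p : ℕ) = p' + 1 ∧ (z : ℕ) = z' + 1 ∧ r p' q z'

/-- The defining equation of multiplication, as a ternary relation. -/
def timesRec (plus r : Fin N → Fin N → Fin N → Prop) (p q z : Fin N) : Prop :=
  ((p : ℕ) = 0 ∧ (z : ℕ) = 0) ∨ ∃ p' z' : Fin N, (p : ℕ) = p' + 1 ∧ r p' q z' ∧ plus z' q z

theorem plusRec_local (p : Fin N) (r r' : Fin N → Fin N → Fin N → Prop)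
    (h : ∀ q < p, r q = r' q) : plusRec r p = plusRec r' p := by
  funext q z
  unfold plusRec
  refine propext (or_congr Iff.rfl (exists_congr fun p' => exists_congr fun z' =>
    and_congr_right fun hp => ?_))
  rw [h p' (by omega)]

theorem timesRec_local (plus : Fin N → Fin N → Fin N → Prop) (p : Fin N)
    (r r' : Fin N → Fin N → Fin N → Prop) (h : ∀ q < p, r q = r' q) :
    timesRec plus r p = timesRec plus r' p := by
  funext q z
  unfold timesRec
  refine propext (or_congr Iff.rfl (exists_congr fun p' => exists_congr fun z' =>
    and_congr_right fun hp => ?_))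
  rw [h p' (by omega)]

theorem plusRec_iff {r : Fin N → Fin N → Fin N → Prop} (hr : ∀ p, r p = plusRec r p)
    (p q z : Fin N) : r p q z ↔ (p : ℕ) + q = z := by
  obtain ⟨k, hk⟩ : ∃ k, (p : ℕ) = k := ⟨_, rfl⟩
  induction k generalizing p z with
  | zero =>
    rw [hr]
    simp only [plusRec, Fin.ext_iff]
    constructor
    · rintro (h | ⟨p', z', h1, h2, h3⟩) <;> omega
    · intro h
      left
      omega
  | succ k ih =>
    rw [hr]
    constructor
    · rintro (⟨h, -⟩ | ⟨p', z', h1, h2, h3⟩)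
      · omega
      · have := (ih p' z' (by omega)).1 h3
        omega
    · intro h
      refine Or.inr ⟨⟨k, by omega⟩, ⟨z - 1, by omega⟩, hk, ?_, (ih _ _ rfl).2 ?_⟩
      · simp only
        omega
      · simp only
        omega

theorem timesRec_iff {plus r : Fin N → Fin N → Fin N → Prop} (hp : ∀ p, plus p = plusRec plus p)
    (hr : ∀ p, r p = timesRec plus r p) (p q z : Fin N) : r p q z ↔ (p : ℕ) * q = z := by
  obtain ⟨k, hk⟩ : ∃ k, (p : ℕ) = k := ⟨_, rfl⟩
  induction k generalizing p z with
  | zero =>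
    rw [hr]
    simp only [timesRec, hk, zero_mul]
    constructor
    · rintro (h | ⟨p', z', h1, h2, h3⟩) <;> omega
    · intro h
      exact Or.inl ⟨trivial, h.symm⟩
  | succ k ih =>
    rw [hr]
    constructor
    · rintro (⟨h, -⟩ | ⟨p', z', h1, h2, h3⟩)
      · omega
      · have h4 := (ih p' z' (by omega)).1 h2
        rw [plusRec_iff hp] at h3
        rw [h1, Nat.add_mul, one_mul]
        omega
    · intro h
      rw [hk, Nat.add_mul, one_mul] at h
      exact Or.inr ⟨⟨k, by omega⟩, ⟨k * q, by omega⟩, hk, (ih _ _ rfl).2 rfl,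
        (plusRec_iff hp _ _ _).2 h⟩

end Arithmetic

/-! ### Recursive description of the encoding of colors -/

section ColorSegments

variable {N : ℕ}

/-- The defining equation of the relation `col`: the position `y` of the input has the offset `j` in
the segment number `q`. The segments begin at `c`, and each one ends with a separator. -/
def colRec (x : List AutSymbol) (c : Fin N) (r : Fin N → Fin N → Fin N → Prop) (y q j : Fin N) :
    Prop :=
  (y = c ∧ (q : ℕ) = 0 ∧ (j : ℕ) = 0) ∨ (c < y ∧ ∃ y' : Fin N, (y : ℕ) = y' + 1 ∧
    ((x[(y' : ℕ)]? ≠ some .sep ∧ ∃ j' : Fin N, (j : ℕ) = j' + 1 ∧ r y' q j') ∨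
    (x[(y' : ℕ)]? = some .sep ∧ (j : ℕ) = 0 ∧ ∃ q' j' : Fin N, (q : ℕ) = q' + 1 ∧ r y' q' j')))

theorem colRec_local (x : List AutSymbol) (c p : Fin N) (r r' : Fin N → Fin N → Fin N → Prop)
    (h : ∀ q < p, r q = r' q) : colRec x c r p = colRec x c r' p := by
  funext q z
  unfold colRec
  refine propext (or_congr Iff.rfl (and_congr_right fun _ => exists_congr fun y' =>
    and_congr_right fun hp => ?_))
  rw [h y' (by omega)]

/-- The number of the segment and the offset in it after a symbol. -/
def colStep (a : ℕ × ℕ) : AutSymbol → ℕ × ℕ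
  | .sep => (a.1 + 1, 0)
  | .bit _ => (a.1, a.2 + 1)

theorem snd_foldl_colStep_le (L : List AutSymbol) (a : ℕ × ℕ) :
    (L.foldl colStep a).2 ≤ a.2 + L.length := by
  induction L generalizing a with
  | nil => simp
  | cons b L ih =>
    refine (ih _).trans ?_
    cases b <;> simp [colStep] <;> omega

theorem le_fst_foldl_colStep (L : List AutSymbol) (a : ℕ × ℕ) : a.1 ≤ (L.foldl colStep a).1 := by
  induction L generalizing a with
  | nil => simp
  | cons b L ih =>
    refine le_trans ?_ (ih _)
    cases b <;> simp [colStep]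

theorem foldl_colStep_bits (L : List Bool) (a : ℕ × ℕ) :
    (L.map AutSymbol.bit).foldl colStep a = (a.1, a.2 + L.length) := by
  induction L generalizing a with
  | nil => simp
  | cons b L ih =>
    rw [List.map_cons, List.foldl_cons, ih]
    simp [colStep]
    omega

/-- The segment of the input for a list of bits. -/
def segCode (b : List Bool) : List AutSymbol := b.map .bit ++ [.sep]

/-- The bits of a segment are found at the corresponding offsets. -/
theorem exists_colStep_iff (segs : List (List Bool)) (tbl : List AutSymbol) (a q j : ℕ)
    (hq : q < segs.length) :
    (∃ d, (segs.flatMap segCode ++ tbl)[d]? = some (.bit true) ∧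
      ((segs.flatMap segCode ++ tbl).take d).foldl colStep (a, 0) =
        (a + q, j)) ↔ segs[q][j]? = some true := by
  induction segs generalizing a q with
  | nil => simp at hq
  | cons b segs ih =>
    rw [List.flatMap_cons, segCode]
    simp only [List.append_assoc]
    generalize hL : segs.flatMap segCode ++ tbl = L at ih
    -- the symbols up to the end of the first segment, and those behind it
    have h1 : ∀ d, d ≤ b.length → ((b.map AutSymbol.bit ++ ([AutSymbol.sep] ++ L)).take d).foldl colStep
        (a, 0) = (a, d) := by
      intro d hd
      rw [List.take_append_of_le_length (by simpa using hd), ← List.map_take, foldl_colStep_bits]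
      simp [hd]
    have h2 : ∀ d, ((b.map AutSymbol.bit ++ ([AutSymbol.sep] ++ L)).take (b.length + 1 + d)).foldl colStep
        (a, 0) = (L.take d).foldl colStep (a + 1, 0) := by
      intro d
      rw [List.take_append, List.take_of_length_le (by simp; omega), List.foldl_append,
        foldl_colStep_bits, List.length_map, show b.length + 1 + d - b.length = d + 1 by omega]
      simp [colStep]
    have h3 : ∀ d, (b.map AutSymbol.bit ++ ([AutSymbol.sep] ++ L))[b.length + 1 + d]? = L[d]? := by
      intro d
      rw [List.getElem?_append_right (by simp; omega), List.length_map,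
        show b.length + 1 + d - b.length = d + 1 by omega]
      simp
    have h4 : ∀ d, d < b.length → (b.map AutSymbol.bit ++ ([AutSymbol.sep] ++ L))[d]? =
        b[d]?.map AutSymbol.bit := by
      intro d hd
      rw [List.getElem?_append_left (by simpa using hd), List.getElem?_map]
    have h5 : (b.map AutSymbol.bit ++ ([AutSymbol.sep] ++ L))[b.length]? = some .sep := by
      rw [List.getElem?_append_right (by simp)]
      simp
    cases q with
    | zero =>
      simp only [add_zero, List.getElem_cons_zero]
      constructor
      · rintro ⟨d, h6, h7⟩
        rcases Nat.lt_trichotomy d b.length with h8 | rfl | h8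
        · rw [h1 d h8.le, Prod.mk.injEq] at h7
          rw [h4 d h8] at h6
          rw [← h7.2]
          simpa using h6
        · rw [h5] at h6
          simp at h6
        · obtain ⟨d, rfl⟩ := Nat.exists_eq_add_of_le (Nat.succ_le_of_lt h8)
          rw [Nat.succ_eq_add_one, h2] at h7
          have := le_fst_foldl_colStep (L.take d) (a + 1, 0)
          rw [h7] at this
          simp only at this
          omega
      · intro h6
        have h7 : j < b.length := (List.getElem?_eq_some_iff.1 h6).1
        exact ⟨j, by rw [h4 j h7, h6]; rfl, h1 j h7.le⟩
    | succ q =>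
      simp only [List.getElem_cons_succ]
      rw [← ih (a + 1) q (by simpa using hq)]
      constructor
      · rintro ⟨d, h6, h7⟩
        by_cases h8 : d ≤ b.length
        · rw [h1 d h8, Prod.mk.injEq] at h7
          omega
        · obtain ⟨d, rfl⟩ := Nat.exists_eq_add_of_lt (not_le.1 h8)
          rw [show b.length + d + 1 = b.length + 1 + d by omega] at h6 h7
          rw [h3] at h6
          rw [h2] at h7
          exact ⟨d, h6, by rw [h7]; congr 1; omega⟩
      · rintro ⟨d, h6, h7⟩
        exact ⟨b.length + 1 + d, by rw [h3, h6], by rw [h2, h7]; congr 1; omega⟩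

/-- The relation `col` computes the number of the segment and the offset that are reached after the
first `d` symbols behind the beginning of the segments. -/
theorem colRec_iff {x A L : List AutSymbol} (hx : x = A ++ L) {c : Fin (x.length + 1)}
    (hc : (c : ℕ) = A.length)
    {r : Fin (x.length + 1) → Fin (x.length + 1) → Fin (x.length + 1) → Prop}
    (hr : ∀ p, r p = colRec x c r p) (d : ℕ) (y q j : Fin (x.length + 1))
    (hy : (y : ℕ) = A.length + d) :
    r y q j ↔ (L.take d).foldl colStep (0, 0) = ((q : ℕ), (j : ℕ)) := by
  have hlen : x.length = A.length + L.length := by simp [hx]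
  induction d generalizing y q j with
  | zero =>
    rw [hr]
    simp only [colRec, Fin.ext_iff, List.take_zero, List.foldl_nil, Prod.mk.injEq, Fin.lt_def]
    constructor
    · rintro (h | h) <;> omega
    · intro h
      left
      omega
  | succ d ih =>
    have hd : d < L.length := by omega
    have hL : x[A.length + d]? = some L[d] := by
      simp only [hx]
      rw [List.getElem?_append_right (by omega), Nat.add_sub_cancel_left, List.getElem?_eq_getElem]
    have hy' : ∀ y' : Fin (x.length + 1), (y : ℕ) = y' + 1 → (y' : ℕ) = A.length + d := by omega
    have h2 := snd_foldl_colStep_le (L.take d) (0, 0)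
    rw [List.length_take_of_le hd.le] at h2
    rw [hr, List.take_add_one, List.getElem?_eq_getElem hd, Option.toList_some, List.foldl_append,
      List.foldl_cons, List.foldl_nil]
    generalize ha : (L.take d).foldl colStep (0, 0) = a at h2
    obtain ⟨a1, a2⟩ := a
    constructor
    · rintro (⟨h, -⟩ | ⟨-, y', h1, h⟩)
      · rw [Fin.ext_iff] at h
        omega
      · rw [hy' y' h1, hL] at h
        rcases h with ⟨h3, j', h4, h5⟩ | ⟨h3, h4, q', j', h5, h6⟩
        · have h5 := (ih y' q j' (hy' y' h1)).1 h5
          rw [ha, Prod.mk.injEq] at h5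
          cases h7 : L[d] with
          | sep => simp [h7] at h3
          | bit b =>
            simp only [colStep, Prod.mk.injEq]
            omega
        · have h6 := (ih y' q' j' (hy' y' h1)).1 h6
          rw [ha, Prod.mk.injEq] at h6
          rw [Option.some.injEq] at h3
          rw [h3]
          simp only [colStep, Prod.mk.injEq]
          omega
    · intro h
      refine Or.inr ⟨by rw [Fin.lt_def]; omega, ⟨A.length + d, by omega⟩, by simp only; omega, ?_⟩
      simp only [hL]
      cases h7 : L[d] with
      | sep =>
        rw [h7] at h
        simp only [colStep, Prod.mk.injEq] at h
        refine Or.inr ⟨rfl, by omega, ⟨a1, by omega⟩, ⟨a2, ?_⟩, by simp only; omega,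
          (ih _ _ _ rfl).2 ha⟩
        simp only at h2
        omega
      | bit b =>
        rw [h7] at h
        simp only [colStep, Prod.mk.injEq] at h
        refine Or.inl ⟨by simp, ⟨a2, by omega⟩, by simp only; omega, (ih _ _ _ rfl).2 ?_⟩
        exact ha.trans (congrArg (·, a2) h.1)

theorem le_of_colRec {x : List AutSymbol} {c : Fin N}
    {r : Fin N → Fin N → Fin N → Prop}
    (hr : ∀ p, r p = colRec x c r p) {y q j : Fin N} (h : r y q j) : c ≤ y := by
  rw [hr] at h
  rcases h with ⟨rfl, -⟩ | ⟨h, -⟩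
  · exact le_rfl
  · exact h.le

end ColorSegments

/-! ### Concatenations of rows of equal length -/

section Tables

variable {α β : Type}

theorem length_flatMap_const {f : α → List β} {c : ℕ} (hf : ∀ a, (f a).length = c) (l : List α) :
    (l.flatMap f).length = l.length * c := by
  induction l with
  | nil => simp
  | cons a l ih => rw [List.flatMap_cons, List.length_append, ih, hf, List.length_cons]; ring

/-- The entries of a concatenation of rows of equal length. -/
theorem getElem?_flatMap_const {f : α → List β} {c : ℕ} (hf : ∀ a, (f a).length = c) (l : List α)
    {i j : ℕ} (hi : i < l.length) (hj : j < c) : (l.flatMap f)[i * c + j]? = (f l[i])[j]? := by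
  induction l generalizing i with
  | nil => simp at hi
  | cons a l ih =>
    rw [List.flatMap_cons]
    cases i with
    | zero =>
      rw [List.getElem?_append_left (by rw [hf]; omega)]
      simp
    | succ i =>
      rw [List.getElem?_append_right (by rw [hf, Nat.add_mul]; omega), hf,
        show (i + 1) * c + j - c = i * c + j by rw [Nat.add_mul]; omega,
        ih (by simpa using hi)]
      simp

end Tables

end LassoDensity

namespace LassoDensity

open Function Relation

/-! ### The encoding of automata -/

section AutomatonCode

variable {s m : ℕ} (A : ParityAutomaton (Fin s) (Fin m)) (n : ℕ)

/-- The part of an encoded automaton before the colors. -/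
def autHead : List AutSymbol :=
  List.replicate n (.bit true) ++ [.sep] ++ List.replicate s (.bit true) ++ [.sep] ++
    List.replicate m (.bit true) ++ [.sep] ++
    (List.finRange m).map (fun q => .bit (decide (q ∈ A.init)))

/-- The binary digits of the colors. -/
def autColors : List (List Bool) := (List.finRange m).map fun q => (A.color q).bits

/-- The table of the transition relation. -/
def autTable : List AutSymbol :=
  (List.finRange m).flatMap (fun q => (List.finRange s).flatMap (fun a =>
    (List.finRange m).map (fun q' => .bit (decide (q' ∈ A.trans q a)))))

theorem encodeAutomaton_eq :
    encodeAutomaton A n = autHead A n ++ ((autColors A).flatMap segCode ++ autTable A) := by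
  simp [encodeAutomaton, autHead, autColors, autTable, List.flatMap_map, segCode]

theorem length_autHead : (autHead A n).length = n + 1 + s + 1 + m + 1 + m := by
  simp [autHead]
  omega

theorem length_autColors : (autColors A).length = m := by simp [autColors]

theorem length_autTable : (autTable A).length = m * s * m := by
  rw [autTable, length_flatMap_const (c := s * m), List.length_finRange, mul_assoc]
  intro q
  rw [length_flatMap_const (c := m), List.length_finRange]
  simp

/-- The entry of the transition table for `q`, `a` and `q'`. -/
theorem getElem?_autTable (q q' : Fin m) (a : Fin s) :
    (autTable A)[((q : ℕ) * s + a) * m + q']? = some (.bit (decide (q' ∈ A.trans q a))) := by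
  have h1 : (a : ℕ) * m + q' < s * m := by
    have := Nat.mul_le_mul_right m (Nat.succ_le_of_lt a.2)
    rw [Nat.succ_mul] at this
    omega
  have e : ((q : ℕ) * s + a) * m + q' = q * (s * m) + (a * m + q') := by ring
  have hl : ∀ (q : Fin m) (a : Fin s), ((List.finRange m).map fun q' =>
      AutSymbol.bit (decide (q' ∈ A.trans q a))).length = m := by simp
  rw [e, autTable, getElem?_flatMap_const (c := s * m) _ _ (by simp) h1,
    getElem?_flatMap_const (c := m) (hl _) _ (by simp) q'.2]
  · simp
  · intro q
    rw [length_flatMap_const (c := m) (hl _), List.length_finRange]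

/-- The length of the part of an encoded automaton before the transition table. -/
def tableStart : ℕ := n + 1 + s + 1 + m + 1 + m + ((autColors A).flatMap segCode).length

theorem le_tableStart : n + 1 + s + 1 + m + 1 + m ≤ tableStart A n := Nat.le_add_right _ _

theorem length_encodeAutomaton :
    (encodeAutomaton A n).length = tableStart A n + m * s * m := by
  rw [encodeAutomaton_eq, List.length_append, List.length_append, length_autHead, length_autTable,
    tableStart]
  omega

theorem getElem?_encodeAutomaton_table (q q' : Fin m) (a : Fin s) :
    (encodeAutomaton A n)[tableStart A n + (((q : ℕ) * s + a) * m + q')]? =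
      some (.bit (decide (q' ∈ A.trans q a))) := by
  rw [encodeAutomaton_eq, ← List.append_assoc, List.getElem?_append_right
    (by rw [List.length_append, length_autHead, tableStart]; omega), ← getElem?_autTable,
    List.length_append, length_autHead, tableStart, Nat.add_sub_cancel_left]

theorem getElem?_encodeAutomaton_init (q : Fin m) :
    (encodeAutomaton A n)[n + 1 + s + 1 + m + 1 + (q : ℕ)]? =
      some (.bit (decide (q ∈ A.init))) := by
  rw [encodeAutomaton_eq, List.getElem?_append_left (by rw [length_autHead]; omega), autHead,
    List.getElem?_append_right (by simp; omega)]
  have : n + 1 + s + 1 + m + 1 + (q : ℕ) - (List.replicate n (AutSymbol.bit true) ++ [AutSymbol.sep] ++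
      List.replicate s (AutSymbol.bit true) ++ [AutSymbol.sep] ++
      List.replicate m (AutSymbol.bit true) ++ [AutSymbol.sep]).length =
      q := by
    simp
    omega
  rw [this]
  simp

/-- The separators in the first part of the input. Those behind the colors come later. -/
theorem encodeAutomaton_sep {p : ℕ} (hp : p ≤ n + 1 + s + 1 + m) :
    (encodeAutomaton A n)[p]? = some .sep ↔ p = n ∨ p = n + 1 + s ∨ p = n + 1 + s + 1 + m := by
  rw [encodeAutomaton_eq, List.getElem?_append_left (by rw [length_autHead]; omega), autHead]
  constructor
  · intro h
    simp only [List.getElem?_append, List.length_append, List.length_replicate,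
      List.length_cons, List.length_nil] at h
    split_ifs at h <;> first | omega | simp [List.getElem?_replicate] at h
  · rintro (rfl | rfl | rfl)
    · exact getElem?_mid (a := List.replicate p (.bit true)) (by simp; rfl) (by simp)
    · exact getElem?_mid (a := List.replicate n (.bit true) ++ [.sep] ++
        List.replicate s (.bit true)) (by simp; rfl) (by simp; omega)
    · exact getElem?_mid (a := List.replicate n (.bit true) ++ [.sep] ++
        List.replicate s (.bit true) ++ [.sep] ++ List.replicate m (.bit true)) (by simp; rfl)
        (by simp; omega)

end AutomatonCode

/-! ### Recursive description of the product of an automaton and a lasso -/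

section AutomatonRelations

/-- The numbers that are used to describe an encoded automaton and a lasso: the length `n` of the
lasso, the numbers `s` and `m` of letters and states, the positions of the first symbols of the
initial states, the colors, and the transition table, and the start `l` of the loop. -/
structure AutPar (N : ℕ) where
  n : Fin N
  s : Fin N
  m : Fin N
  ini : Fin N
  col : Fin N
  tbl : Fin N
  l : Fin N

/-- The relations of the product of an automaton and a lasso. -/
structure AutRels (N : ℕ) where
  word : Fin N → Fin N → Prop
  plus : Fin N → Fin N → Fin N → Prop
  times : Fin N → Fin N → Fin N → Prop
  col : Fin N → Fin N → Fin N → Prop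

variable {N : ℕ} (x : List AutSymbol) (P : AutPar N) (R : AutRels N)

/-- The bit number `j` of the color of the state `q` is set. -/
def colorBit (q j : Fin N) : Prop := ∃ y, R.col y q j ∧ x[(y : ℕ)]? = some (.bit true)

/-- The color of `q` is at most the color of `f`. -/
def colorLE (q f : Fin N) : Prop :=
  ∀ j, colorBit x R q j → ¬ colorBit x R f j → ∃ i, j < i ∧ ¬ colorBit x R q i ∧ colorBit x R f i

/-- There is a transition from `q` to `q'` with the letter `a`. -/
def transBit (q a q' : Fin N) : Prop :=
  ∃ z₁, R.times q P.s z₁ ∧ ∃ z₂, R.plus z₁ a z₂ ∧ ∃ z₃, R.times z₂ P.m z₃ ∧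
    ∃ z₄, R.plus z₃ q' z₄ ∧ ∃ y, R.plus P.tbl z₄ y ∧ x[(y : ℕ)]? = some (.bit true)

/-- There is an edge from `(q, t)` to `(q', t')` in the product of the automaton and the lasso,
and if `f` is a state, the colors of `q` and `q'` are at most the color of `f`. -/
def edgeCond (f q t q' t' : Fin N) : Prop :=
  (P.m ≤ f ∨ (colorLE x R q f ∧ colorLE x R q' f)) ∧ nxtCond P.n P.l t t' ∧
    ∃ a, R.word t a ∧ transBit x P R q a q'

/-- The defining equation of reachability by paths with at most `2 ^ i` edges. -/
def reachRec (r : Fin N → Fin N → Fin N → Fin N → Fin N → Fin N → Prop)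
    (i f q t q' t' : Fin N) : Prop :=
  ((i : ℕ) = 0 ∧ q < P.m ∧ t < P.n ∧ q' < P.m ∧ t' < P.n ∧
    ((q = q' ∧ t = t') ∨ edgeCond x P R f q t q' t')) ∨
  ∃ i' : Fin N, (i : ℕ) = i' + 1 ∧ ∃ p u, r i' f q t p u ∧ r i' f p u q' t'

/-- There is an accepting run on the lasso. Here `e` is a bound for the recursion in `reachRec`. -/
def acceptCond (r : Fin N → Fin N → Fin N → Fin N → Fin N → Fin N → Prop) (o e : Fin N) : Prop :=
  ∃ q₀, (∃ y, R.plus P.ini q₀ y ∧ x[(y : ℕ)]? = some (.bit true)) ∧ ∃ f t, r e P.m q₀ o f t ∧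
    ¬ colorBit x R f o ∧ ∃ q' t', edgeCond x P R f f t q' t' ∧ r e f q' t' f t

theorem reachRec_local (p : Fin N) (r r' : Fin N → Fin N → Fin N → Fin N → Fin N → Fin N → Prop)
    (h : ∀ q < p, r q = r' q) : reachRec x P R r p = reachRec x P R r' p := by
  funext f q t q' t'
  unfold reachRec
  refine propext (or_congr Iff.rfl (exists_congr fun i' => and_congr_right fun hi => ?_))
  rw [h i' (by omega)]

end AutomatonRelations

/-! ### Correctness of the recursion for automata -/

section AutomatonCorrect

variable {s m n : ℕ} {A : ParityAutomaton (Fin s) (Fin m)}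

/-- The numbers that belong to an automaton and a lasso. -/
def autPar (A : ParityAutomaton (Fin s) (Fin m)) (l : Fin n) :
    AutPar ((encodeAutomaton A n).length + 1) :=
  have h := length_encodeAutomaton A n
  have h' := le_tableStart A n
  { n := ⟨n, by omega⟩
    s := ⟨s, by omega⟩
    m := ⟨m, by omega⟩
    ini := ⟨n + 1 + s + 1 + m + 1, by omega⟩
    col := ⟨n + 1 + s + 1 + m + 1 + m, by omega⟩
    tbl := ⟨tableStart A n, by omega⟩
    l := ⟨l, by omega⟩ }

variable {R : AutRels ((encodeAutomaton A n).length + 1)}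

/-- The relation `col` locates the binary digits of the colors. -/
theorem colorBit_iff (c : Fin ((encodeAutomaton A n).length + 1))
    (hc : (c : ℕ) = n + 1 + s + 1 + m + 1 + m)
    (hR : ∀ p, R.col p = colRec (encodeAutomaton A n) c R.col p)
    (q j : Fin ((encodeAutomaton A n).length + 1)) (hq : (q : ℕ) < m) :
    colorBit (encodeAutomaton A n) R q j ↔ (A.color ⟨q, hq⟩).testBit j = true := by
  have hx := encodeAutomaton_eq A n
  have hH := length_autHead A n
  rw [testBit_eq_getElem?_bits]
  have h1 := exists_colStep_iff (autColors A) (autTable A) 0 q j (by rwa [length_autColors])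
  have h2 : (autColors A)[(q : ℕ)]'(by rwa [length_autColors]) = (A.color ⟨q, hq⟩).bits := by
    simp [autColors]
  rw [h2, zero_add] at h1
  rw [← h1]
  have hget : ∀ d, (encodeAutomaton A n)[(autHead A n).length + d]? =
      ((autColors A).flatMap segCode ++ autTable A)[d]? := by
    intro d
    rw [hx, List.getElem?_append_right (by omega), Nat.add_sub_cancel_left]
  constructor
  · rintro ⟨y, h3, h4⟩
    have h5 := le_of_colRec hR h3
    obtain ⟨d, hd⟩ := Nat.exists_eq_add_of_le (show (autHead A n).length ≤ y by omega)
    refine ⟨d, ?_, (colRec_iff hx (by omega) hR d y q j hd).1 h3⟩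
    rw [← hget, ← hd, h4]
  · rintro ⟨d, h3, h4⟩
    rw [← hget] at h3
    have h5 := (List.getElem?_eq_some_iff.1 h3).1
    exact ⟨⟨(autHead A n).length + d, by omega⟩,
      (colRec_iff hx (by omega) hR d _ q j rfl).2 h4, h3⟩

/-- The digits of the colors are part of the input; so their numbers are in the range of the
variables. -/
theorem length_bits_color_le (q : Fin m) :
    (A.color q).bits.length ≤ (encodeAutomaton A n).length := by
  have h1 : (segCode (A.color q).bits).length ≤ ((autColors A).flatMap segCode).length := by
    have : (A.color q).bits ∈ autColors A := by simp [autColors]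
    obtain ⟨l₁, l₂, h⟩ := List.append_of_mem this
    rw [h]
    simp only [List.flatMap_append, List.flatMap_cons, List.length_append]
    omega
  rw [length_encodeAutomaton, tableStart]
  simp only [segCode, List.length_append, List.length_map, List.length_cons, List.length_nil] at h1
  omega

theorem colorLE_iff (c : Fin ((encodeAutomaton A n).length + 1))
    (hc : (c : ℕ) = n + 1 + s + 1 + m + 1 + m)
    (hR : ∀ p, R.col p = colRec (encodeAutomaton A n) c R.col p)
    (q f : Fin ((encodeAutomaton A n).length + 1)) (hq : (q : ℕ) < m) (hf : (f : ℕ) < m) :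
    colorLE (encodeAutomaton A n) R q f ↔ A.color ⟨q, hq⟩ ≤ A.color ⟨f, hf⟩ := by
  have key : ∀ (q : Fin m) j, (A.color q).testBit j = true →
      j < (encodeAutomaton A n).length + 1 := by
    intro q j h
    rw [testBit_eq_getElem?_bits] at h
    have h1 := (List.getElem?_eq_some_iff.1 h).1
    have h2 := length_bits_color_le (n := n) (A := A) q
    omega
  rw [le_iff_testBit]
  simp only [colorLE, colorBit_iff c hc hR q _ hq, colorBit_iff c hc hR f _ hf]
  constructor
  · intro h j h1 h2
    obtain ⟨i, h3, h4, h5⟩ := h ⟨j, key _ j h1⟩ h1 h2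
    exact ⟨i, h3, h4, h5⟩
  · intro h j h1 h2
    obtain ⟨i, h3, h4, h5⟩ := h j h1 h2
    exact ⟨⟨i, key _ i h5⟩, h3, h4, h5⟩

variable {l : Fin n} {w : Fin n → Fin s}

theorem transBit_iff (hp : ∀ p, R.plus p = plusRec R.plus p)
    (ht : ∀ p, R.times p = timesRec R.plus R.times p)
    (q a q' : Fin ((encodeAutomaton A n).length + 1)) (hq : (q : ℕ) < m) (ha : (a : ℕ) < s)
    (hq' : (q' : ℕ) < m) :
    transBit (encodeAutomaton A n) (autPar A l) R q a q' ↔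
      (⟨q', hq'⟩ : Fin m) ∈ A.trans ⟨q, hq⟩ ⟨a, ha⟩ := by
  have h1 := getElem?_encodeAutomaton_table A n ⟨q, hq⟩ ⟨q', hq'⟩ ⟨a, ha⟩
  simp only at h1
  simp only [transBit, plusRec_iff hp, timesRec_iff hp ht, autPar]
  constructor
  · rintro ⟨z₁, h2, z₂, h3, z₃, h4, z₄, h5, y, h6, h7⟩
    rw [← h6, ← h5, ← h4, ← h3, ← h2, h1] at h7
    simpa using h7
  · intro h
    have h2 := (List.getElem?_eq_some_iff.1 h1).1
    have h3 : (q : ℕ) * s + a ≤ ((q : ℕ) * s + a) * m := Nat.le_mul_of_pos_right _ (by omega)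
    refine ⟨⟨q * s, by omega⟩, rfl, ⟨q * s + a, by omega⟩, rfl, ⟨(q * s + a) * m, by omega⟩, rfl,
      ⟨(q * s + a) * m + q', by omega⟩, rfl, ⟨_, Nat.lt_succ_of_lt h2⟩, rfl, ?_⟩
    rw [h1]
    simpa using h

theorem nxtCond_iff {N : ℕ} (k l' t t' : Fin N) (hk : (k : ℕ) = n) (hl : (l' : ℕ) = l)
    (ht : (t : ℕ) < n) (ht' : (t' : ℕ) < n) :
    nxtCond k l' t t' ↔ (⟨t', ht'⟩ : Fin n) = nxt l ⟨t, ht⟩ := by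
  simp only [nxtCond, nxt, Fin.lt_def, Fin.ext_iff]
  split_ifs with h
  · simp only
    omega
  · omega

/-- The relations have the intended meaning for the lasso with the letters `w`. -/
structure AutRels.Correct (R : AutRels ((encodeAutomaton A n).length + 1)) (l : Fin n)
    (w : Fin n → Fin s) : Prop where
  word : ∀ t a, R.word t a ↔ ∃ ht : (t : ℕ) < n, (a : ℕ) = w ⟨t, ht⟩
  plus : ∀ p, R.plus p = plusRec R.plus p
  times : ∀ p, R.times p = timesRec R.plus R.times p
  col : ∀ p, R.col p = colRec (encodeAutomaton A n) (autPar A l).col R.col p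

theorem edgeCond_iff (hR : R.Correct l w)
    (f q t q' t' : Fin ((encodeAutomaton A n).length + 1)) (hq : (q : ℕ) < m)
    (hq' : (q' : ℕ) < m) (ht : (t : ℕ) < n) (ht' : (t' : ℕ) < n) :
    edgeCond (encodeAutomaton A n) (autPar A l) R f q t q' t' ↔
      (∀ hf : (f : ℕ) < m, A.color ⟨q, hq⟩ ≤ A.color ⟨f, hf⟩ ∧
        A.color ⟨q', hq'⟩ ≤ A.color ⟨f, hf⟩) ∧
      A.Edge l w (⟨q, hq⟩, ⟨t, ht⟩) (⟨q', hq'⟩, ⟨t', ht'⟩) := by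
  refine and_congr ?_ ?_
  · rw [Fin.le_def]
    by_cases hf : (f : ℕ) < m
    · rw [colorLE_iff _ rfl hR.col q f hq hf, colorLE_iff _ rfl hR.col q' f hq' hf]
      simp only [autPar, not_le.2 hf, false_or, hf, forall_true_left]
    · simp only [autPar, not_lt.1 hf, hf, true_or, IsEmpty.forall_iff]
  · rw [nxtCond_iff _ _ t t' rfl rfl ht ht', and_comm]
    refine and_congr_left fun _ => ?_
    constructor
    · rintro ⟨a, h1, h2⟩
      obtain ⟨_, h3⟩ := (hR.word t a).1 h1
      have ha : (a : ℕ) < s := by omega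
      have := (transBit_iff hR.plus hR.times q a q' hq ha hq').1 h2
      rwa [show (⟨a, ha⟩ : Fin s) = w ⟨t, ht⟩ from Fin.ext h3] at this
    · intro h1
      have h := length_encodeAutomaton A n
      have h' := le_tableStart A n
      have ha := (w ⟨t, ht⟩).2
      exact ⟨⟨w ⟨t, ht⟩, by omega⟩, (hR.word _ _).2 ⟨ht, rfl⟩,
        (transBit_iff hR.plus hR.times q _ q' hq ha hq').2 h1⟩

/-- Repeated squaring: the relation `E` of edges is restricted to colors up to that of `f` if `f` is
a state, and is not restricted otherwise. -/
theorem reachRec_iff (hR : R.Correct l w)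
    {r : Fin ((encodeAutomaton A n).length + 1) → Fin ((encodeAutomaton A n).length + 1) →
      Fin ((encodeAutomaton A n).length + 1) → Fin ((encodeAutomaton A n).length + 1) →
      Fin ((encodeAutomaton A n).length + 1) → Fin ((encodeAutomaton A n).length + 1) → Prop}
    (hr : ∀ p, r p = reachRec (encodeAutomaton A n) (autPar A l) R r p)
    (i f : Fin ((encodeAutomaton A n).length + 1)) (E : Fin m × Fin n → Fin m × Fin n → Prop)
    (hE : ∀ u v : Fin m × Fin n, E u v ↔ (∀ hf : (f : ℕ) < m, A.color u.1 ≤ A.color ⟨f, hf⟩ ∧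
        A.color v.1 ≤ A.color ⟨f, hf⟩) ∧ A.Edge l w u v)
    (q t q' t' : Fin ((encodeAutomaton A n).length + 1)) :
    r i f q t q' t' ↔ ∃ (hq : (q : ℕ) < m) (ht : (t : ℕ) < n) (hq' : (q' : ℕ) < m)
      (ht' : (t' : ℕ) < n), Within E (2 ^ (i : ℕ)) (⟨q, hq⟩, ⟨t, ht⟩) (⟨q', hq'⟩, ⟨t', ht'⟩) := by
  have h := length_encodeAutomaton A n
  have h' := le_tableStart A n
  obtain ⟨k, hk⟩ : ∃ k, (i : ℕ) = k := ⟨_, rfl⟩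
  induction k generalizing i q t q' t' with
  | zero =>
    rw [hr]
    simp only [reachRec, hk, true_and, Fin.lt_def, autPar]
    constructor
    · rintro (⟨h1, h2, h3, h4, h5⟩ | ⟨i', h1, -⟩)
      · refine ⟨h1, h2, h3, h4, ?_⟩
        rcases h5 with ⟨rfl, rfl⟩ | h5
        · exact Or.inl rfl
        · exact Or.inr ⟨_, rfl, (hE _ _).2 ((edgeCond_iff hR f q t q' t' h1 h3 h2 h4).1 h5)⟩
      · omega
    · rintro ⟨h1, h2, h3, h4, h5⟩
      refine Or.inl ⟨h1, h2, h3, h4, ?_⟩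
      rcases h5 with h5 | ⟨v, h5, h6⟩
      · simp only [Within, Prod.mk.injEq, Fin.mk.injEq, ← Fin.ext_iff] at h5
        exact Or.inl h5
      · obtain rfl := h5
        exact Or.inr ((edgeCond_iff hR f q t q' t' h1 h3 h2 h4).2 ((hE _ _).1 h6))
  | succ k ih =>
    rw [hr, hk, pow_succ, mul_two]
    simp only [reachRec, hk, within_add]
    constructor
    · rintro (⟨h1, -⟩ | ⟨i', h1, p, u, h2, h3⟩)
      · omega
      · obtain ⟨a1, a2, a3, a4, a5⟩ := (ih i' q t p u (by omega)).1 h2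
        obtain ⟨b1, b2, b3, b4, b5⟩ := (ih i' p u q' t' (by omega)).1 h3
        have h4 : (i' : ℕ) = k := by omega
        rw [h4] at a5 b5
        exact ⟨a1, a2, b3, b4, _, a5, b5⟩
    · rintro ⟨h1, h2, h3, h4, ⟨⟨p, hp⟩, ⟨u, hu⟩⟩, h5, h6⟩
      refine Or.inr ⟨⟨k, by omega⟩, rfl, ⟨p, by omega⟩, ⟨u, by omega⟩, ?_, ?_⟩
      · exact (ih _ _ _ _ _ rfl).2 ⟨h1, h2, hp, hu, h5⟩
      · exact (ih _ _ _ _ _ rfl).2 ⟨hp, hu, h3, h4, h6⟩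

/-- The number of vertices of the product is at most `2 ^ |x|`; so the recursion for reachability is
complete at the last position. -/
theorem acceptCond_iff (hR : R.Correct l w)
    {r : Fin ((encodeAutomaton A n).length + 1) → Fin ((encodeAutomaton A n).length + 1) →
      Fin ((encodeAutomaton A n).length + 1) → Fin ((encodeAutomaton A n).length + 1) →
      Fin ((encodeAutomaton A n).length + 1) → Fin ((encodeAutomaton A n).length + 1) → Prop}
    (hr : ∀ p, r p = reachRec (encodeAutomaton A n) (autPar A l) R r p) :
    acceptCond (encodeAutomaton A n) (autPar A l) R r 0 (Fin.last _) ↔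
      lword l w ∈ A.language := by
  have h := length_encodeAutomaton A n
  have h' := le_tableStart A n
  have hcard : Nat.card (Fin m × Fin n) ≤ 2 ^ ((Fin.last (encodeAutomaton A n).length) : ℕ) := by
    rw [Nat.card_prod, Nat.card_fin, Nat.card_fin, Fin.val_last]
    calc m * n ≤ 2 ^ m * 2 ^ n := Nat.mul_le_mul Nat.lt_two_pow_self.le Nat.lt_two_pow_self.le
      _ = 2 ^ (m + n) := (pow_add 2 m n).symm
      _ ≤ _ := Nat.pow_le_pow_right (by omega) (by omega)
  -- the threshold `m` is not a state, so it does not restrict the colors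
  have h1 := fun q t q' t' => reachRec_iff hR hr (Fin.last _) (autPar A l).m (A.Edge l w)
    (fun u v => by simp [autPar]) q t q' t'
  have h2 := fun (f : Fin ((encodeAutomaton A n).length + 1)) (hf : (f : ℕ) < m)
    q t q' t' => reachRec_iff hR hr (Fin.last _) f
    (A.EdgeLE l w ⟨f, hf⟩) (fun u v => by simp [ParityAutomaton.EdgeLE, hf]) q t q' t'
  simp only [within_iff_reflTransGen _ hcard] at h1 h2
  have hev : ∀ (f : Fin ((encodeAutomaton A n).length + 1)) (hf : (f : ℕ) < m),
      ¬ colorBit (encodeAutomaton A n) R f 0 ↔ Even (A.color ⟨f, hf⟩) := by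
    intro f hf
    rw [colorBit_iff _ rfl hR.col f 0 hf, Fin.val_zero, Nat.testBit_zero, Nat.even_iff]
    simp
  rw [ParityAutomaton.lword_mem_language]
  simp only [TransGen.head'_iff]
  constructor
  · rintro ⟨q₀, ⟨y, h3, h4⟩, f, t, h5, h6, q', t', h7, h8⟩
    obtain ⟨a1, a2, a3, a4, a5⟩ := (h1 _ _ _ _).1 h5
    obtain ⟨b1, b2, b3, b4, b5⟩ := (h2 f a3 _ _ _ _).1 h8
    have h9 := (edgeCond_iff hR f f t q' t' a3 b1 a4 b2).1 h7
    rw [plusRec_iff hR.plus] at h3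
    rw [← h3] at h4
    have h10 := getElem?_encodeAutomaton_init A n ⟨q₀, a1⟩
    simp only [autPar] at h4
    rw [h4] at h10
    refine ⟨⟨q₀, a1⟩, by simpa using h10, ⟨f, a3⟩, ⟨t, a4⟩, a5, (hev f a3).1 h6, _,
      ⟨h9.1 a3, h9.2⟩, b5⟩
  · rintro ⟨⟨q₀, hq₀⟩, h3, ⟨f, hf⟩, ⟨t, ht⟩, h4, h5, ⟨⟨q', hq'⟩, ⟨t', ht'⟩⟩, h6, h7⟩
    have hn := l.pos
    have h10 := getElem?_encodeAutomaton_init A n ⟨q₀, hq₀⟩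
    refine ⟨⟨q₀, by omega⟩, ⟨⟨n + 1 + s + 1 + m + 1 + q₀, by omega⟩, ?_, ?_⟩, ⟨f, by omega⟩,
      ⟨t, by omega⟩, (h1 _ _ _ _).2 ⟨hq₀, hn, hf, ht, h4⟩, (hev _ hf).2 h5, ⟨q', by omega⟩,
      ⟨t', by omega⟩, ?_, (h2 _ hf _ _ _ _).2 ⟨hq', ht', hf, ht, h7⟩⟩
    · rw [plusRec_iff hR.plus]
      rfl
    · simp only at h10 ⊢
      rw [h10]
      simpa using h3
    · exact (edgeCond_iff hR _ _ _ _ _ hf hq' ht ht').2 ⟨fun _ => h6.1, h6.2⟩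

end AutomatonCorrect

end LassoDensity

namespace LassoDensity

open Function

/-! ### First-order sentence for automata -/

section AutomatonFormula

open Fml

instance : Finite AutSymbol :=
  Finite.of_surjective (![.sep, .bit false, .bit true] : Fin 3 → AutSymbol) <| by
    rintro (_ | (_ | _))
    exacts [⟨0, rfl⟩, ⟨1, rfl⟩, ⟨2, rfl⟩]

/-- The relations that are guessed for an automaton and a lasso: the letters and the start of the
loop of the lasso, addition, multiplication, the positions of the digits of the colors, and
reachability in the product of the automaton and the lasso. -/
inductive ARel : Type
  | word | loop | plus | times | col | reach
  deriving DecidableEq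

instance : Fintype ARel :=
  ⟨{.word, .loop, .plus, .times, .col, .reach}, by rintro (_ | _) <;> decide⟩

/-- The arities of the relations. -/
def ARel.ar : ARel → ℕ
  | word => 2
  | loop => 1
  | plus => 3
  | times => 3
  | col => 3
  | reach => 6

/-- A ternary relation of a family of tables. -/
def rel3 {L : ℕ} (S : Set (Fin 3 → Fin (L + 1))) (p q r : Fin (L + 1)) : Prop := ![p, q, r] ∈ S

/-- A relation of arity six of a family of tables. -/
def rel6 {L : ℕ} (S : Set (Fin 6 → Fin (L + 1))) (i f q t q' t' : Fin (L + 1)) : Prop :=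
  ![i, f, q, t, q', t'] ∈ S

theorem rel3_inj {L : ℕ} {S S' : Set (Fin 3 → Fin (L + 1))} (h : rel3 S = rel3 S') : S = S' := by
  ext v
  have := congrFun (congrFun (congrFun h (v 0)) (v 1)) (v 2)
  have e : v = ![v 0, v 1, v 2] := by
    funext i
    fin_cases i <;> rfl
  rw [e]
  exact iff_of_eq this

theorem rel6_inj {L : ℕ} {S S' : Set (Fin 6 → Fin (L + 1))} (h : rel6 S = rel6 S') : S = S' := by
  ext v
  have := congrFun (congrFun (congrFun (congrFun (congrFun (congrFun h
    (v 0)) (v 1)) (v 2)) (v 3)) (v 4)) (v 5)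
  have e : v = ![v 0, v 1, v 2, v 3, v 4, v 5] := by
    funext i
    fin_cases i <;> rfl
  rw [e]
  exact iff_of_eq this

/-- The table of a ternary relation. -/
def tab3 {L : ℕ} (r : Fin (L + 1) → Fin (L + 1) → Fin (L + 1) → Prop) :
    Set (Fin 3 → Fin (L + 1)) := {v | r (v 0) (v 1) (v 2)}

/-- The table of a relation of arity six. -/
def tab6 {L : ℕ} (r : Fin (L + 1) → Fin (L + 1) → Fin (L + 1) → Fin (L + 1) → Fin (L + 1) →
    Fin (L + 1) → Prop) : Set (Fin 6 → Fin (L + 1)) :=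
  {v | r (v 0) (v 1) (v 2) (v 3) (v 4) (v 5)}

theorem rel3_tab3 {L : ℕ} (r : Fin (L + 1) → Fin (L + 1) → Fin (L + 1) → Prop) :
    rel3 (tab3 r) = r := rfl

theorem rel6_tab6 {L : ℕ} (r : Fin (L + 1) → Fin (L + 1) → Fin (L + 1) → Fin (L + 1) →
    Fin (L + 1) → Fin (L + 1) → Prop) : rel6 (tab6 r) = r := rfl

/-- The numbers in `P` belong to the automaton in the input `x`: the first three separators are at
the positions `P.n`, `b` and `c`, and the transition table is at the end of the input. -/
def headerCond {N : ℕ} (x : List AutSymbol) (P : AutPar N) (R : AutRels N) (e : Fin N) : Prop :=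
  x[(P.n : ℕ)]? = some .sep ∧ P.l < P.n ∧ ∃ b : Fin N, x[(b : ℕ)]? = some .sep ∧ P.n < b ∧
    ∃ c : Fin N, x[(c : ℕ)]? = some .sep ∧ b < c ∧
      (∀ p : Fin N, p < c → x[(p : ℕ)]? = some .sep → p = P.n ∨ p = b) ∧
      (∃ b' : Fin N, (b' : ℕ) = P.n + 1 ∧ R.plus b' P.s b) ∧
      (∃ c' : Fin N, (c' : ℕ) = b + 1 ∧ R.plus c' P.m c) ∧
      (P.ini : ℕ) = c + 1 ∧ R.plus P.ini P.m P.col ∧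
      ∃ z, R.times P.m P.s z ∧ ∃ z', R.times z P.m z' ∧ R.plus P.tbl z' e

/-- The type of first-order formulas that describe the product of an automaton and a lasso. -/
abbrev AFml : Type := Fml AutSymbol (Fin 64) ARel ARel.ar

namespace AFml

/-- Atomic formula for the relation `word`. -/
def word (i j : Fin 64) : AFml := .rel .word ![i, j]

/-- Atomic formula for the relation `loop`. -/
def loop (i : Fin 64) : AFml := .rel .loop ![i]

/-- Atomic formula for the relation `plus`. -/
def plus (i j k : Fin 64) : AFml := .rel .plus ![i, j, k]

/-- Atomic formula for the relation `times`. -/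
def times (i j k : Fin 64) : AFml := .rel .times ![i, j, k]

/-- Atomic formula for the relation `col`. -/
def col (i j k : Fin 64) : AFml := .rel .col ![i, j, k]

/-- Atomic formula for the relation `reach`. -/
def reach (i f q t q' t' : Fin 64) : AFml := .rel .reach ![i, f, q, t, q', t']

/-- There is a set bit at a position. -/
def one (i : Fin 64) : AFml := sym i (.bit true)

/-- The formula for `headerCond`. The variables `1`, …, `7` stand for the components of `AutPar`, and
`14` for the length of the input. -/
def headerDef : AFml :=
  and (sym 1 .sep) (and (lt 7 1) (ex 8 (and (sym 8 .sep) (and (lt 1 8)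
    (ex 9 (and (sym 9 .sep) (and (lt 8 9)
      (and (all 10 (imp (lt 10 9) (imp (sym 10 .sep) (or (eq 10 1) (eq 10 8)))))
      (and (ex 10 (and (succ 0 1 10) (plus 10 2 8))) (and (ex 10 (and (succ 0 8 10) (plus 10 3 9)))
      (and (succ 0 9 4) (and (plus 4 3 5)
      (ex 12 (and (times 3 2 12) (ex 13 (and (times 12 3 13) (plus 6 13 14)))))))))))))))))

/-- The formula for `plusRec`. The variable `63` is never bound and has the value `0`. -/
def plusDef : AFml :=
  or (and (eq 20 63) (eq 22 21))
    (ex 23 (ex 24 (and (succ 0 23 20) (and (succ 0 24 22) (plus 23 21 24)))))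

/-- The formula for `timesRec`. -/
def timesDef : AFml :=
  or (and (eq 20 63) (eq 22 63))
    (ex 23 (ex 24 (and (succ 0 23 20) (and (times 23 21 24) (plus 24 21 22)))))

/-- The formula for `colRec`. -/
def colDef : AFml :=
  or (and (eq 20 5) (and (eq 21 63) (eq 22 63))) (and (lt 5 20) (ex 23 (and (succ 0 23 20)
    (or (and (neg (sym 23 .sep)) (ex 25 (and (succ 0 25 22) (col 23 21 25))))
      (and (sym 23 .sep) (and (eq 22 63) (ex 24 (ex 25 (and (succ 0 24 21) (col 23 24 25))))))))))

/-- The formula for `colorBit`. -/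
def bitDef (q j : Fin 64) : AFml := ex 30 (and (col 30 q j) (one 30))

/-- The formula for `colorLE`. -/
def leDef (q f : Fin 64) : AFml :=
  all 31 (imp (bitDef q 31) (imp (neg (bitDef f 31))
    (ex 32 (and (lt 31 32) (and (neg (bitDef q 32)) (bitDef f 32))))))

/-- The formula for `transBit`. -/
def transDef (q a q' : Fin 64) : AFml :=
  ex 33 (and (times q 2 33) (ex 34 (and (plus 33 a 34) (ex 35 (and (times 34 3 35)
    (ex 36 (and (plus 35 q' 36) (ex 37 (and (plus 6 36 37) (one 37))))))))))

/-- The formula for `edgeCond`. -/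
def edgeDef (f q t q' t' : Fin 64) : AFml :=
  and (or (neg (lt f 3)) (and (leDef q f) (leDef q' f)))
    (and (or (and (succ 0 t t') (lt t' 1)) (and (succ 0 t 1) (eq t' 7)))
      (ex 38 (and (word t 38) (transDef q 38 q'))))

/-- The formula for `reachRec`. -/
def reachDef : AFml :=
  or (and (eq 40 63) (and (lt 42 3) (and (lt 43 1) (and (lt 44 3) (and (lt 45 1)
      (or (and (eq 42 44) (eq 43 45)) (edgeDef 41 42 43 44 45)))))))
    (ex 46 (and (succ 0 46 40) (ex 47 (ex 48 (and (reach 46 41 42 43 47 48)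
      (reach 46 41 47 48 44 45))))))

/-- The formula for `acceptCond`. -/
def acceptDef : AFml :=
  ex 50 (and (ex 51 (and (plus 4 50 51) (one 51))) (ex 52 (ex 53 (and (reach 14 3 50 63 52 53)
    (and (neg (bitDef 52 63)) (ex 54 (ex 55 (and (edgeDef 52 52 53 54 55)
      (reach 14 52 54 55 52 53)))))))))

/-- The formula that is satisfied by the tables for the models of an automaton. -/
def main : AFml :=
  ex 1 (ex 2 (ex 3 (ex 4 (ex 5 (ex 6 (ex 7 (ex 14 (and (neg (ex 15 (lt 14 15))) (and headerDef
    (and (all 20 (all 21 (imp (word 20 21) (lt 20 1))))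
    (and (all 20 (imp (lt 20 1) (ex 21 (and (lt 21 2) (all 22 (iff (word 20 22) (eq 22 21)))))))
    (and (all 20 (iff (loop 20) (eq 20 7)))
    (and (all 20 (all 21 (all 22 (iff (plus 20 21 22) plusDef))))
    (and (all 20 (all 21 (all 22 (iff (times 20 21 22) timesDef))))
    (and (all 20 (all 21 (all 22 (iff (col 20 21 22) colDef))))
    (and (all 40 (all 41 (all 42 (all 43 (all 44 (all 45
      (iff (reach 40 41 42 43 44 45) reachDef))))))) acceptDef))))))))))))))))

theorem wf_main : main.WF [] = true := by decide

variable {x : List AutSymbol} {T : Tables ARel ARel.ar x.length} {ρ : Fin 64 → Fin (x.length + 1)}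

/-- The values of the variables `1`, …, `7`. -/
def parOf (ρ : Fin 64 → Fin (x.length + 1)) : AutPar (x.length + 1) where
  n := ρ 1
  s := ρ 2
  m := ρ 3
  ini := ρ 4
  col := ρ 5
  tbl := ρ 6
  l := ρ 7

/-- The relations that are given by a family of tables. -/
def relsOf (T : Tables ARel ARel.ar x.length) : AutRels (x.length + 1) where
  word := rel2 (T .word)
  plus := rel3 (T .plus)
  times := rel3 (T .times)
  col := rel3 (T .col)

theorem eval_word {i j : Fin 64} : (word i j).eval x T ρ ↔ rel2 (T .word) (ρ i) (ρ j) := by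
  have : (fun k => ρ (![i, j] k)) = ![ρ i, ρ j] := by funext k; fin_cases k <;> rfl
  exact iff_of_eq (congrArg (· ∈ _) this)

theorem eval_loop {i : Fin 64} : (loop i).eval x T ρ ↔ rel1 (T .loop) (ρ i) := by
  have : (fun k => ρ (![i] k)) = ![ρ i] := by funext k; fin_cases k; rfl
  exact iff_of_eq (congrArg (· ∈ _) this)

theorem eval_plus {i j k : Fin 64} :
    (plus i j k).eval x T ρ ↔ rel3 (T .plus) (ρ i) (ρ j) (ρ k) := by
  have : (fun h => ρ (![i, j, k] h)) = ![ρ i, ρ j, ρ k] := by funext h; fin_cases h <;> rfl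
  exact iff_of_eq (congrArg (· ∈ _) this)

theorem eval_times {i j k : Fin 64} :
    (times i j k).eval x T ρ ↔ rel3 (T .times) (ρ i) (ρ j) (ρ k) := by
  have : (fun h => ρ (![i, j, k] h)) = ![ρ i, ρ j, ρ k] := by funext h; fin_cases h <;> rfl
  exact iff_of_eq (congrArg (· ∈ _) this)

theorem eval_col {i j k : Fin 64} :
    (col i j k).eval x T ρ ↔ rel3 (T .col) (ρ i) (ρ j) (ρ k) := by
  have : (fun h => ρ (![i, j, k] h)) = ![ρ i, ρ j, ρ k] := by funext h; fin_cases h <;> rfl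
  exact iff_of_eq (congrArg (· ∈ _) this)

theorem eval_reach {i f q t q' t' : Fin 64} : (reach i f q t q' t').eval x T ρ ↔
    rel6 (T .reach) (ρ i) (ρ f) (ρ q) (ρ t) (ρ q') (ρ t') := by
  have : (fun h => ρ (![i, f, q, t, q', t'] h)) = ![ρ i, ρ f, ρ q, ρ t, ρ q', ρ t'] := by
    funext h
    fin_cases h <;> rfl
  exact iff_of_eq (congrArg (· ∈ _) this)

theorem eval_one {i : Fin 64} : (one i).eval x T ρ ↔ x[(ρ i : ℕ)]? = some (.bit true) := Iff.rfl

theorem eval_headerDef :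
    headerDef.eval x T ρ ↔ headerCond x (parOf ρ) (relsOf T) (ρ 14) := by
  simp [headerDef, headerCond, parOf, relsOf, eval_or, eval_ex, eval_and, eval_succ, eval_sym,
    eval_eq, eval_lt, eval_all, eval_imp, eval_plus, eval_times]

theorem eval_plusDef (h : ρ 63 = 0) :
    plusDef.eval x T ρ ↔ plusRec (relsOf T).plus (ρ 20) (ρ 21) (ρ 22) := by
  simp [plusDef, plusRec, relsOf, eval_or, eval_ex, eval_and, eval_succ, eval_eq, eval_plus, h]

theorem eval_timesDef (h : ρ 63 = 0) :
    timesDef.eval x T ρ ↔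
      timesRec (relsOf T).plus (relsOf T).times (ρ 20) (ρ 21) (ρ 22) := by
  simp [timesDef, timesRec, relsOf, eval_or, eval_ex, eval_and, eval_succ, eval_eq, eval_plus,
    eval_times, h]

theorem eval_colDef (h : ρ 63 = 0) :
    colDef.eval x T ρ ↔ colRec x (ρ 5) (relsOf T).col (ρ 20) (ρ 21) (ρ 22) := by
  simp [colDef, colRec, relsOf, eval_or, eval_ex, eval_and, eval_succ, eval_eq, eval_neg, eval_lt,
    eval_sym, eval_col, h]

/-- The variables `30`, …, `38` are bound in the formulas for edges. -/
theorem ne_of_free {v i : Fin 64} (hv : v < 30 ∨ 38 < v) (hi : 30 ≤ i ∧ i ≤ 38) : v ≠ i := by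
  rintro rfl
  omega

theorem eval_bitDef {q j : Fin 64} (hq : q ≠ 30) (hj : j ≠ 30) :
    (bitDef q j).eval x T ρ ↔ colorBit x (relsOf T) (ρ q) (ρ j) := by
  simp [bitDef, colorBit, relsOf, eval_ex, eval_and, eval_col, eval_one, hq, hj]

theorem eval_leDef {q f : Fin 64} (hq : q < 30 ∨ 38 < q) (hf : f < 30 ∨ 38 < f) :
    (leDef q f).eval x T ρ ↔ colorLE x (relsOf T) (ρ q) (ρ f) := by
  have q0 : q ≠ 30 := ne_of_free hq (by decide)
  have q1 : q ≠ 31 := ne_of_free hq (by decide)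
  have q2 : q ≠ 32 := ne_of_free hq (by decide)
  have f0 : f ≠ 30 := ne_of_free hf (by decide)
  have f1 : f ≠ 31 := ne_of_free hf (by decide)
  have f2 : f ≠ 32 := ne_of_free hf (by decide)
  simp [leDef, colorLE, eval_ex, eval_and, eval_all, eval_imp, eval_neg, eval_lt, eval_bitDef,
    q0, q1, q2, f0, f1, f2]

theorem eval_transDef {q a q' : Fin 64} (hq : q < 30 ∨ 38 < q) (ha : a = 38)
    (hq' : q' < 30 ∨ 38 < q') : (transDef q a q').eval x T ρ ↔
      transBit x (parOf ρ) (relsOf T) (ρ q) (ρ a) (ρ q') := by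
  have q3 : q ≠ 33 := ne_of_free hq (by decide)
  have r3 : q' ≠ 33 := ne_of_free hq' (by decide)
  have r4 : q' ≠ 34 := ne_of_free hq' (by decide)
  have r5 : q' ≠ 35 := ne_of_free hq' (by decide)
  have r6 : q' ≠ 36 := ne_of_free hq' (by decide)
  simp [transDef, transBit, parOf, relsOf, eval_ex, eval_and, eval_times, eval_plus, eval_one,
    q3, r3, r4, r5, r6, ha]

theorem eval_edgeDef {f q t q' t' : Fin 64} (hf : f < 30 ∨ 38 < f) (hq : q < 30 ∨ 38 < q)
    (hq' : q' < 30 ∨ 38 < q') (ht : t ≠ 38) (ht₀ : t ≠ 0) (ht₀' : t' ≠ 0) :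
    (edgeDef f q t q' t').eval x T ρ ↔
      edgeCond x (parOf ρ) (relsOf T) (ρ f) (ρ q) (ρ t) (ρ q') (ρ t') := by
  have q8 : q ≠ 38 := ne_of_free hq (by decide)
  have r8 : q' ≠ 38 := ne_of_free hq' (by decide)
  simp [edgeDef, edgeCond, nxtCond, eval_ex, eval_and, eval_or, eval_neg, eval_lt, eval_eq,
    eval_succ, eval_word, eval_leDef, eval_transDef, hf, hq, hq', ht, ht₀, ht₀', q8, r8, parOf,
    relsOf]

theorem eval_reachDef (h : ρ 63 = 0) : reachDef.eval x T ρ ↔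
    reachRec x (parOf ρ) (relsOf T) (rel6 (T .reach)) (ρ 40) (ρ 41) (ρ 42) (ρ 43) (ρ 44)
      (ρ 45) := by
  rw [reachDef, eval_or, eval_and, eval_and, eval_and, eval_and, eval_and, eval_or, eval_edgeDef
    (by decide) (by decide) (by decide) (by decide) (by decide) (by decide)]
  simp [reachRec, eval_ex, eval_and, eval_eq, eval_lt, eval_succ, eval_reach, h, parOf]

theorem eval_acceptDef (h : ρ 63 = 0) : acceptDef.eval x T ρ ↔
    acceptCond x (parOf ρ) (relsOf T) (rel6 (T .reach)) 0 (ρ 14) := by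
  have e : ∀ ρ : Fin 64 → Fin (x.length + 1), (edgeDef 52 52 53 54 55).eval x T ρ ↔
      edgeCond x (parOf ρ) (relsOf T) (ρ 52) (ρ 52) (ρ 53) (ρ 54) (ρ 55) := fun ρ =>
    eval_edgeDef (by decide) (by decide) (by decide) (by decide) (by decide) (by decide)
  simp [acceptDef, acceptCond, e, eval_ex, eval_and, eval_neg, eval_plus, eval_one, eval_reach,
    eval_bitDef, h, parOf, relsOf]

/-- The components of `P` are the values of the quantified variables `1`, …, `7`. -/
theorem eval_main :
    main.eval x T (fun _ => 0) ↔ ∃ P : AutPar (x.length + 1),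
      headerCond x P (relsOf T) (Fin.last _) ∧
      (∀ t a, rel2 (T .word) t a → t < P.n) ∧
      (∀ t, t < P.n → ∃ a, a < P.s ∧ ∀ b, rel2 (T .word) t b ↔ b = a) ∧
      (∀ t, rel1 (T .loop) t ↔ t = P.l) ∧
      (∀ p, rel3 (T .plus) p = plusRec (rel3 (T .plus)) p) ∧
      (∀ p, rel3 (T .times) p = timesRec (rel3 (T .plus)) (rel3 (T .times)) p) ∧
      (∀ p, rel3 (T .col) p = colRec x P.col (rel3 (T .col)) p) ∧
      (∀ p, rel6 (T .reach) p = reachRec x P (relsOf T) (rel6 (T .reach)) p) ∧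
      acceptCond x P (relsOf T) (rel6 (T .reach)) 0 (Fin.last _) := by
  have key : ∀ e : Fin (x.length + 1), (∀ b, b ≤ e) ↔ e = Fin.last _ := fun e =>
    ⟨fun h => Fin.last_le_iff.1 (h _), fun h b => h ▸ Fin.le_last b⟩
  have hP : ∀ Q : AutPar (x.length + 1) → Prop, (∃ P, Q P) ↔
      ∃ n s m ini col tbl l, Q ⟨n, s, m, ini, col, tbl, l⟩ := fun Q =>
    ⟨fun ⟨P, h⟩ => ⟨P.n, P.s, P.m, P.ini, P.col, P.tbl, P.l, h⟩,
      fun ⟨n, s, m, ini, col, tbl, l, h⟩ => ⟨_, h⟩⟩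
  rw [hP]
  simp [main, eval_ex, eval_and, eval_neg, eval_lt, eval_all, eval_imp, eval_word, eval_loop,
    eval_iff, eval_eq, eval_plus, eval_times, eval_col, eval_reach, eval_headerDef, eval_plusDef,
    eval_timesDef, eval_colDef, eval_reachDef, eval_acceptDef, key, funext_iff, parOf]
  rfl

end AFml

end AutomatonFormula

end LassoDensity

namespace LassoDensity

open Function

/-! ### Counting the models of automata -/

section AutomatonCounting

variable {s m n : ℕ} {A : ParityAutomaton (Fin s) (Fin m)}

/-- The condition determines all numbers except the start of the loop. The position of the
transition table is computed from the end of the input, as the lengths of the colors are not known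
in advance. -/
theorem headerCond_iff (P : AutPar ((encodeAutomaton A n).length + 1))
    (R : AutRels ((encodeAutomaton A n).length + 1)) (hp : ∀ p, R.plus p = plusRec R.plus p)
    (ht : ∀ p, R.times p = timesRec R.plus R.times p) :
    headerCond (encodeAutomaton A n) P R (Fin.last _) ↔ ∃ l : Fin n, P = autPar A l := by
  have h := length_encodeAutomaton A n
  have h' := le_tableStart A n
  simp only [headerCond, plusRec_iff hp, timesRec_iff hp ht, Fin.lt_def, Fin.val_last, Fin.ext_iff]
  constructor
  · rintro ⟨h1, h2, b, h3, h4, c, h5, h6, h7, ⟨b', h8, h9⟩, ⟨c', h10, h11⟩, h12, h13, z, h14, z',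
      h15, h16⟩
    -- the three separators of the head are the first three separators of the input
    have e1 := h7 ⟨n, by omega⟩
    have e2 := h7 ⟨n + 1 + s, by omega⟩
    have e3 := h7 ⟨n + 1 + s + 1 + m, by omega⟩
    simp only [encodeAutomaton_sep A n (show n ≤ n + 1 + s + 1 + m by omega),
      encodeAutomaton_sep A n (show n + 1 + s ≤ n + 1 + s + 1 + m by omega),
      encodeAutomaton_sep A n le_rfl, true_or, or_true, forall_true_left] at e1 e2 e3
    have hc : (c : ℕ) ≤ n + 1 + s + 1 + m := by
      by_contra hc
      have f1 := e1 (by omega)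
      have f2 := e2 (by omega)
      have f3 := e3 (by omega)
      omega
    rw [encodeAutomaton_sep A n (by omega)] at h1 h3 h5
    have g1 : (P.n : ℕ) = n := by omega
    have g2 : (P.s : ℕ) = s := by omega
    have g3 : (P.m : ℕ) = m := by omega
    rw [g2, g3] at h14
    rw [g3, ← h14] at h15
    obtain ⟨pn, ps, pm, pi, pc, pt, pl⟩ := P
    simp only at *
    refine ⟨⟨pl, by omega⟩, ?_⟩
    simp only [autPar, AutPar.mk.injEq, Fin.ext_iff]
    refine ⟨g1, g2, g3, ?_, ?_, ?_, trivial⟩ <;> omega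
  · rintro ⟨l, rfl⟩
    have hl := l.2
    have hms : m * s ≤ m * s * m := by
      rcases Nat.eq_zero_or_pos m with rfl | hm
      · simp
      · exact Nat.le_mul_of_pos_right _ hm
    refine ⟨(encodeAutomaton_sep A n (by simp only [autPar]; omega)).2 (Or.inl rfl), hl,
      ⟨n + 1 + s, by omega⟩, (encodeAutomaton_sep A n (by simp only; omega)).2
        (Or.inr (Or.inl rfl)), ?_, ⟨n + 1 + s + 1 + m, by omega⟩,
      (encodeAutomaton_sep A n le_rfl).2 (Or.inr (Or.inr rfl)), ?_, ?_, ⟨⟨n + 1, by omega⟩, rfl, ?_⟩,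
      ⟨⟨n + 1 + s + 1, by omega⟩, rfl, ?_⟩, rfl, ?_, ⟨m * s, by omega⟩, rfl,
      ⟨m * s * m, by omega⟩, rfl, ?_⟩
    · simp only [autPar]
      omega
    · simp only
      omega
    · intro p hp hp'
      simp only at hp
      rw [encodeAutomaton_sep A n (by omega)] at hp'
      simp only [autPar]
      omega
    all_goals simp only [autPar]
    omega

/-- The tables `T` describe the lasso with the letters `a.2` and the start `a.1` of the loop, and its
product with the automaton. -/
def IsAutTables (A : ParityAutomaton (Fin s) (Fin m)) (a : Fin n × (Fin n → Fin s))
    (T : Tables ARel ARel.ar (encodeAutomaton A n).length) : Prop :=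
  (AFml.relsOf T).Correct a.1 a.2 ∧ (∀ t, rel1 (T .loop) t ↔ (t : ℕ) = a.1) ∧
    ∀ p, rel6 (T .reach) p =
      reachRec (encodeAutomaton A n) (autPar A a.1) (AFml.relsOf T) (rel6 (T .reach)) p

/-- The tables are determined by the lasso: the letters and the start of the loop directly, and the
other relations by recursion on the first argument. -/
theorem existsUnique_isAutTables (a : Fin n × (Fin n → Fin s)) : ∃! T, IsAutTables A a T := by
  obtain ⟨pl, hpl, hpl'⟩ :=
    existsUnique_rec (plusRec (N := (encodeAutomaton A n).length + 1)) plusRec_local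
  obtain ⟨tm, htm, htm'⟩ := existsUnique_rec (timesRec pl) (timesRec_local pl)
  obtain ⟨cl, hcl, hcl'⟩ := existsUnique_rec (colRec (encodeAutomaton A n) (autPar A a.1).col)
    (colRec_local _ _)
  let wd : Fin ((encodeAutomaton A n).length + 1) → Fin ((encodeAutomaton A n).length + 1) → Prop :=
    fun t b => ∃ ht : (t : ℕ) < n, (b : ℕ) = a.2 ⟨t, ht⟩
  let lp : Fin ((encodeAutomaton A n).length + 1) → Prop := fun t => (t : ℕ) = a.1
  obtain ⟨rc, hrc, hrc'⟩ := existsUnique_rec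
    (reachRec (encodeAutomaton A n) (autPar A a.1) ⟨wd, pl, tm, cl⟩) (reachRec_local _ _ _)
  let T₀ : Tables ARel ARel.ar (encodeAutomaton A n).length := fun
    | .word => tab2 wd
    | .loop => tab1 lp
    | .plus => tab3 pl
    | .times => tab3 tm
    | .col => tab3 cl
    | .reach => tab6 rc
  refine ⟨T₀, ⟨⟨fun t i => Iff.rfl, hpl, htm, hcl⟩, fun t => Iff.rfl, hrc⟩, ?_⟩
  rintro T ⟨⟨h1, h2, h3, h4⟩, h5, h6⟩
  have e1 : rel2 (T .word) = wd := by
    funext t i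
    exact propext (h1 t i)
  have e2 : rel1 (T .loop) = lp := by
    funext t
    exact propext (h5 t)
  have e3 : rel3 (T .plus) = pl := hpl' _ h2
  simp only [AFml.relsOf, e3] at h3
  have e4 : rel3 (T .times) = tm := htm' _ h3
  have e5 : rel3 (T .col) = cl := hcl' _ h4
  simp only [AFml.relsOf, e1, e3, e4, e5] at h6
  have e6 : rel6 (T .reach) = rc := hrc' _ h6
  funext g
  cases g with
  | word => exact rel2_inj (by rw [e1, rel2_tab2])
  | loop => exact rel1_inj (by rw [e2, rel1_tab1])
  | plus => exact rel3_inj (by rw [e3, rel3_tab3])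
  | times => exact rel3_inj (by rw [e4, rel3_tab3])
  | col => exact rel3_inj (by rw [e5, rel3_tab3])
  | reach => exact rel6_inj (by rw [e6, rel6_tab6])

theorem isAutTables_inj {a a' : Fin n × (Fin n → Fin s)}
    {T : Tables ARel ARel.ar (encodeAutomaton A n).length} (h : IsAutTables A a T)
    (h' : IsAutTables A a' T) : a = a' := by
  have hlen := length_encodeAutomaton A n
  have hlen' := le_tableStart A n
  have ha := a.1.2
  refine Prod.ext (Fin.ext ?_) (funext fun t => Fin.ext ?_)
  · exact (h'.2.1 ⟨a.1, by omega⟩).1 ((h.2.1 ⟨a.1, by omega⟩).2 rfl)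
  · have ht := (a.2 t).2
    obtain ⟨_, e⟩ := (h'.1.word ⟨t, by omega⟩ ⟨a.2 t, by omega⟩).1 ((h.1.word _ _).2 ⟨t.2, rfl⟩)
    exact e

/-- The first-order sentence holds for the tables that describe the models of the automaton. -/
theorem eval_main_encodeAutomaton (T : Tables ARel ARel.ar (encodeAutomaton A n).length) :
    AFml.main.eval (encodeAutomaton A n) T (fun _ => 0) ↔
      ∃ a : Fin n × (Fin n → Fin s), IsAutTables A a T ∧ lword a.1 a.2 ∈ A.language := by
  have hlen := length_encodeAutomaton A n
  have hlen' := le_tableStart A n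
  rw [AFml.eval_main]
  constructor
  · rintro ⟨P, h1, h2, h3, h4, h5, h6, h7, h8, h9⟩
    obtain ⟨l, rfl⟩ := (headerCond_iff P (AFml.relsOf T) h5 h6).1 h1
    have h10 : ∀ t : Fin n, ∃ a : Fin s, ∀ b, rel2 (T .word) ⟨t, by omega⟩ b ↔ (b : ℕ) = a := by
      intro t
      obtain ⟨a, ha, hb⟩ := h3 ⟨t, by omega⟩ t.2
      exact ⟨⟨a, ha⟩, fun b => (hb b).trans Fin.ext_iff⟩
    choose w hw using h10
    have hR : (AFml.relsOf T).Correct l w := by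
      refine ⟨fun t a => ⟨fun h => ?_, ?_⟩, h5, h6, h7⟩
      · have ht : (t : ℕ) < n := h2 t a h
        exact ⟨ht, (hw ⟨t, ht⟩ a).1 h⟩
      · rintro ⟨ht, h⟩
        exact (hw ⟨t, ht⟩ a).2 h
    exact ⟨(l, w), ⟨hR, fun t => (h4 t).trans Fin.ext_iff, h8⟩, (acceptCond_iff hR h8).1 h9⟩
  · rintro ⟨⟨l, w⟩, ⟨hR, h1, h2⟩, h3⟩
    refine ⟨autPar A l, (headerCond_iff _ _ hR.plus hR.times).2 ⟨l, rfl⟩, fun t a h => ?_,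
      fun t ht => ?_, fun t => (h1 t).trans (Fin.ext_iff (b := (autPar A l).l)).symm,
      hR.plus, hR.times, hR.col, h2,
      (acceptCond_iff hR h2).2 h3⟩
    · exact ((hR.word t a).1 h).1
    · have ht' : (t : ℕ) < n := ht
      have hs := (w ⟨t, ht'⟩).2
      refine ⟨⟨w ⟨t, ht'⟩, by omega⟩, hs, fun b => ?_⟩
      rw [Fin.ext_iff]
      exact (hR.word t b).trans ⟨fun ⟨_, h⟩ => h, fun h => ⟨ht', h⟩⟩

/-- Counting the models of parity automata is in #P. -/
theorem exists_sharpP_automaton : ∃ f ∈ SharpP AutSymbol,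
    ∀ (s m : ℕ) (A : ParityAutomaton (Fin s) (Fin m)) (n : ℕ),
      f (encodeAutomaton A n) = numModels A.language n := by
  refine ⟨_, card_tables_mem_sharpP AFml.main AFml.wf_main, fun s m A n => ?_⟩
  rw [numModels_eq]
  exact ncard_eq_of_existsUnique (IsAutTables A) _ _ existsUnique_isAutTables
    (fun _ _ _ => isAutTables_inj) eval_main_encodeAutomaton

end AutomatonCounting

end LassoDensity

theorem mainTheorem10 :
    (∃ f ∈ LassoDensity.SharpP LassoDensity.LTLSymbol,
      ∀ (k : ℕ) (φ : LassoDensity.LTL (Fin k)) (n : ℕ),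
        f (LassoDensity.encodeLTL φ n) = LassoDensity.numModels φ.language n ∧
        LassoDensity.density φ.language n =
          (f (LassoDensity.encodeLTL φ n) : ℚ) / ((n : ℚ) * ((2 : ℚ) ^ k) ^ n)) ∧
    (∃ f ∈ LassoDensity.SharpP LassoDensity.AutSymbol,
      ∀ (s m : ℕ) (A : LassoDensity.ParityAutomaton (Fin s) (Fin m)), A.IsBuchi → ∀ n : ℕ,
        f (LassoDensity.encodeAutomaton A n) = LassoDensity.numModels A.language n ∧
        LassoDensity.density A.language n =
          (f (LassoDensity.encodeAutomaton A n) : ℚ) / ((n : ℚ) * (s : ℚ) ^ n)) ∧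
    (∃ f ∈ LassoDensity.SharpP LassoDensity.AutSymbol,
      ∀ (s m : ℕ) (A : LassoDensity.ParityAutomaton (Fin s) (Fin m)), A.IsDeterministic → ∀ n : ℕ,
        f (LassoDensity.encodeAutomaton A n) = LassoDensity.numModels A.language n ∧
        LassoDensity.density A.language n =
          (f (LassoDensity.encodeAutomaton A n) : ℚ) / ((n : ℚ) * (s : ℚ) ^ n)) := by
  obtain ⟨f, hf, hf'⟩ := LassoDensity.exists_sharpP_LTL
  obtain ⟨g, hg, hg'⟩ := LassoDensity.exists_sharpP_automaton
  refine ⟨⟨f, hf, fun k φ n => ⟨hf' k φ n, ?_⟩⟩, ⟨g, hg, fun s m A _ n => ⟨hg' s m A n, ?_⟩⟩,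
    ⟨g, hg, fun s m A _ n => ⟨hg' s m A n, ?_⟩⟩⟩
  · rw [LassoDensity.density_eq, hf']
    have : Nat.card (Set (Fin k)) = 2 ^ k := by
      rw [Nat.card_eq_fintype_card, Fintype.card_set, Fintype.card_fin]
    rw [this]
    push_cast
    rfl
  · rw [LassoDensity.density_eq, hg', Nat.card_fin]
  · rw [LassoDensity.density_eq, hg', Nat.card_fin]
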